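/- Consider $N\ge 1$ particles in $\mathbb R^D$ with the Hamiltonian $$H=\tfrac12\Big(\sum_{i}\big[-\partial^2/\partial\mathbf r_i^2+\omega_t^2\mathbf r_i^2\big]+\sum_{i<j}\omega_p^2(\mathbf r_i-\mathbf r_j)^2\Big),$$ where $\omega_t>0$ (possibly depending on $D$), the real number $\lambda_p^2=\omega_p^2/\omega_t^2$ (negative for a repulsive interaction) does not depend on $D$, and $1+N\lambda_p^2>0$. Put $\lambda=\sqrt{1+N\lambda_p^2}$, $\delta=1/D$, $P=N(N+1)/2$. For every integer $D>N$, $H$ has a unique positive normalized ground state $\Psi$ (an $L^2$, $C^2$ eigenfunction of least eigenvalue). Let $r_i=|\mathbf r_i|>0$ and $\gamma_{ij}=\mathbf r_i\cdot\mathbf r_j/(r_ir_j)$ ($i<j$) be the internal coordinates, restricted to those values for which the matrix of angle cosines (diagonal entries $1$) is positive definite; let $\Gamma$ be its determinant. The Jacobian-weighted wavefunction is the function of the internal coordinates $$\Psi_J=\mathcal N\,\Gamma^{(D-N-1)/4}\prod_j r_j^{(D-1)/2}\,\Psi,\qquad \mathcal N>0,\qquad \int\Psi_J^2\prod_i dr_i\prod_{j<k}d\gamma_{jk}=1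 ,$$ which exists for every $D>N$. Let $\bar r_i=\sqrt{\omega_t/D}\;r_i$ be the scaled radii. **(1) Large-$D$ structure.** There is exactly one point of the domain of the coordinates $(\bar r_i,\gamma_{ij})$ at which $D^{-1}\partial\log\Psi_J\to0$ as $D\to\infty$ for the derivatives with respect to all $\bar r_i$ and $\gamma_{jk}$. There all $\bar r_i=\bar r_\infty>0$ and all $\gamma_{jk}=\gamma_\infty$, with $$\gamma_\infty=\frac{\lambda-1}{N+\lambda-1},\qquad \bar r_\infty^2=\frac{N+\lambda-1}{2\lambda N}.$$ **(2) Expansion.** Write $\bar r_i=\bar r_\infty+\delta^{1/2}\bar r'_i$, $\gamma_{ij}=\gamma_\infty+\delta^{1/2}\gamma'_{ij}$, $\bar y'=(\bar r',\gamma')\in\mathbb R^P$. There is a symmetric positive definite $P\times P$ matrix $\bar\Omega$ such that $$\Psi_J=\omega_t^{N/4}D^{N(N-1)/8}\det(2\bar\Omega)^{1/4}\,\big(\pi^{-1/4}\big)^{P}\,\big(1+\tfrac12\delta^{1/2}\Delta(\bar y')+O(\delta)\big)\exp\!\big(-\bar y'^{T}\bar\Omega\,\bar y'\big),\qquad D\to\infty,$$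 with $O(\delta)$ uniform for $\bar y'$ in bounded sets (for such $\bar y'$ and large $D$ the point lies in the domain), where $$\bar y'^T\bar\Omega\bar y'=\sum_{\mathcal G\text{ of rank }2}\triangle(\mathcal G)\,B(\mathcal G)[\bar y'],\qquad \Delta=\sum_{\mathcal G\text{ of rank }1\text{ or }3}\triangle(\mathcal G)\,B(\mathcal G)[\bar y'].$$ Here $\mathcal G$ runs over the unlabelled graphs without isolated vertices, loops and multiple edges allowed; the rank is the number of edges, loops included. If $\mathcal G$ has $a$ non-loop edges and $b$ loops, $B(\mathcal G)[\bar y']=\sum B(\mathcal G)_{e_1,\dots,e_a,k_1,\dots,k_b}\gamma'_{e_1}\cdots\gamma'_{e_a}\bar r'_{k_1}\cdots\bar r'_{k_b}$, each $e_s$ running over all pairs $(ij)$, $i<j$, and each $k_t$ over $1,\dots,N$ independently; the binary invariant $B(\mathcal G)_{e,k}$ is $1$ if the graph on the occurring particle labels with an edge $ij$ for every $e_s=(ij)$ and a loop at $k_t$ for every $t$ is isomorphic to $\mathcal G$, and $0$ otherwise. The coefficients, with $\gamma=\gamma_\infty$ and $\lambda_{\rm eff}=N\lambda/(N+\lambda-1)$,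 are as follows. Rank one: one loop, $-1/\bar r_\infty$; one edge, $6\mathcal A(N+1)\gamma$. Rank two: two loops at one vertex, $\lambda_{\rm eff}+\frac{\lambda-1}{2N}(\lambda_{\rm eff}-1)$; two loops at different vertices, $-\frac{\lambda-1}{N}\frac{\gamma}{2}$; an edge with a loop at one of its endpoints, $-\frac{\lambda-1}{N}\bar r_\infty$; double edge, $\mathcal H(\mathcal I+\mathcal J)$; path of two edges, $\mathcal H(\mathcal I-\gamma/2)$; two disjoint edges, $\mathcal H\mathcal I$. Rank three: three loops at one vertex, $1/(3\bar r_\infty^3)$; an edge with one loop at each endpoint, $(\lambda-1)/N$; triple edge, $\mathcal A(\mathcal B+\mathcal C\mathcal D)$; triangle, $\mathcal A(\mathcal B+\mathcal C\mathcal E+\mathcal F)$; double edge with an adjacent edge, $\mathcal A(\mathcal B+\mathcal C(\mathcal D/3+2\mathcal E/3))$; star of three edges, $\mathcal A(\mathcal B+\mathcal C\mathcal E)$; path of three edges, $\mathcal A(\mathcal B+2\mathcal C\mathcal E/3-\mathcal G)$; double edge with a disjoint edge, $\mathcal A(\mathcal B+\mathcal C\mathcal D/3+2\mathcal G)$; path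 of two edges with a disjoint edge, $\mathcal A(\mathcal B+\mathcal C\mathcal E/3)$; three disjoint edges, $\mathcal A\mathcal B$. All other rank-two and rank-three coefficients vanish. Here $$\mathcal A=\frac1{6(1-\gamma)(1+(N-1)\gamma)},\quad \mathcal B=-\frac{8\gamma^3}{(1-\gamma)^2(1+(N-1)\gamma)^2},\quad \mathcal C=-\frac{6\gamma}{(1-\gamma)^2(1+(N-1)\gamma)},$$ $$\mathcal D=1+(N-3)\gamma,\quad \mathcal E=-\gamma,\quad \mathcal F=\frac{1+(N-4)\gamma}{(1-\gamma)^2},\quad \mathcal G=\frac{\gamma}{(1-\gamma)^2},$$ $$\mathcal H=\frac1{2(1-\gamma)^2(1+(N-1)\gamma)},\quad \mathcal I=\frac{\gamma^2}{1+(N-1)\gamma},\quad \mathcal J=\frac{1+(N-3)\gamma}{2}.$$ -/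

import Mathlib

open scoped Topology Matrix

namespace HarmonicDPT

/-! ### The quantum-mechanical system -/

/-- Configurations of `N` particles in `ℝ^D`. -/
abbrev Config (N D : ℕ) : Type := EuclideanSpace ℝ (Fin N × Fin D)

/-- Pairs `(ij)` of particle labels, listed with `i < j`. -/
abbrev Pair (N : ℕ) : Type := {p : Fin N × Fin N // p.1 < p.2}

/-- The position vector of the `i`-th particle. -/
noncomputable def position {N D : ℕ} (x : Config N D) (i : Fin N) : EuclideanSpace ℝ (Fin D) :=
  WithLp.toLp 2 fun a => x (i, a)

/-- The Hamiltonian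
`½ (∑ᵢ [-∂²/∂𝐫ᵢ² + ω² 𝐫ᵢ²] + ∑_{i<j} ω_p² |𝐫ᵢ - 𝐫ⱼ|²)`, where `ω` is the trap frequency and
`ω_p² = μ ω²`; here `μ = (ω_p/ω)²` is negative for a repulsive interaction. -/
noncomputable def hamiltonian {N D : ℕ} (ω μ : ℝ) (Ψ : Config N D → ℝ) (x : Config N D) : ℝ :=
  (1 / 2) * (-(Laplacian.laplacian Ψ x) + (∑ i, ω ^ 2 * ‖position x i‖ ^ 2) * Ψ x
    + (∑ p : Pair N, μ * ω ^ 2 * ‖position x p.1.1 - position x p.1.2‖ ^ 2) * Ψ x)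

/-- `Ψ` is a square-integrable eigenfunction of the Hamiltonian with eigenvalue `E`. -/
structure IsEigenfunction {N D : ℕ} (ω μ E : ℝ) (Ψ : Config N D → ℝ) : Prop where
  contDiff : ContDiff ℝ 2 Ψ
  memLp : MeasureTheory.MemLp Ψ 2 MeasureTheory.volume
  ne_zero : Ψ ≠ 0
  eigen : ∀ x, hamiltonian ω μ Ψ x = E * Ψ x

/-- `Ψ` is the ground state: the normalized eigenfunction of least eigenvalue, with its phase
chosen such that it is positive. -/
structure IsGroundState {N D : ℕ} (ω μ : ℝ) (Ψ : Config N D → ℝ) : Prop where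
  lowest : ∃ E, IsEigenfunction ω μ E Ψ ∧
    ∀ (E' : ℝ) (Ψ' : Config N D → ℝ), IsEigenfunction ω μ E' Ψ' → E ≤ E'
  normalized : ∫ x, Ψ x ^ 2 = 1
  pos : ∀ x, 0 < Ψ x

/-! ### Internal coordinates and the Jacobian-weighted wavefunction -/

/-- Values of the internal coordinates: `N` radii `rᵢ` and, for `i < j`, angle cosines `γᵢⱼ`. -/
abbrev Internal (N : ℕ) : Type := (Fin N → ℝ) × (Pair N → ℝ)

/-- The internal coordinates `rᵢ = |𝐫ᵢ|`, `γᵢⱼ = 𝐫ᵢ·𝐫ⱼ/(rᵢ rⱼ)` of a configuration. -/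
noncomputable def internal {N D : ℕ} (x : Config N D) : Internal N :=
  (fun i => ‖position x i‖,
   fun p => inner ℝ (position x p.1.1) (position x p.1.2)
      / (‖position x p.1.1‖ * ‖position x p.1.2‖))

/-- The symmetric matrix of angle cosines, with diagonal entries `1`; the Grammian determinant `Γ`
is its determinant. -/
noncomputable def gram {N : ℕ} (γ : Pair N → ℝ) : Matrix (Fin N) (Fin N) ℝ :=
  Matrix.of fun i j =>
    if h : i < j then γ ⟨(i, j), h⟩ else if h : j < i then γ ⟨(j, i), h⟩ else 1

/-- The range of the internal coordinates (of configurations with linearly independent position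
vectors). -/
def domain (N : ℕ) : Set (Internal N) :=
  {q | (∀ i, 0 < q.1 i) ∧ (gram q.2).PosDef}

/-- The square root of the part `Γ^((D-N-1)/2) ∏ⱼ rⱼ^(D-1)` of the Jacobian that depends on the
internal coordinates. -/
noncomputable def sqrtJacobian (N D : ℕ) (q : Internal N) : ℝ :=
  (gram q.2).det ^ (((D : ℝ) - N - 1) / 4) * ∏ j, q.1 j ^ (((D : ℝ) - 1) / 2)

/-- `ΨJ`, a function of the internal coordinates, is the Jacobian-weighted wavefunction of `Ψ`,
with the normalization `∫ ΨJ² ∏ᵢ drᵢ ∏_{j<k} dγⱼₖ = 1`. -/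
def IsJacobianWeighted {N D : ℕ} (Ψ : Config N D → ℝ) (ΨJ : Internal N → ℝ) : Prop :=
  (∃ c : ℝ, 0 < c ∧ ∀ x : Config N D, internal x ∈ domain N →
      ΨJ (internal x) = c * sqrtJacobian N D (internal x) * Ψ x) ∧
    ∫ q in domain N, ΨJ q ^ 2 = 1

/-! ### Dimensional scaling and the large-`D` structure -/

/-- The internal coordinates `(rᵢ, γᵢⱼ)` with dimensionally scaled values `(r̄ᵢ, γᵢⱼ)`:
`rᵢ = D^(1/2) r̄ᵢ / ω^(1/2)`. -/
noncomputable def unscale {N : ℕ} (ω : ℝ) (D : ℕ) (q : Internal N) : Internal N :=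
  (fun i => √((D : ℝ) / ω) * q.1 i, q.2)

/-- `q = (r̄ᵢ, γᵢⱼ)` is a large-dimension structure of the family `ΨJ`: the derivatives with respect
to all scaled internal coordinates vanish at `D = ∞`. Since the exponent of the wavefunction is
proportional to `D`, this refers to the limit of `D⁻¹ ∂(log ΨJ) = D⁻¹ (∂ΨJ)/ΨJ`. -/
def IsLargeDStructure {N : ℕ} (ω : ℕ → ℝ) (ΨJ : ℕ → Internal N → ℝ) (q : Internal N) : Prop :=
  q ∈ domain N ∧
    (∀ᶠ D : ℕ in Filter.atTop,
      DifferentiableAt ℝ (fun q' => Real.log (ΨJ D (unscale (ω D) D q'))) q) ∧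
    Filter.Tendsto
      (fun D : ℕ => (D : ℝ)⁻¹ • fderiv ℝ (fun q' => Real.log (ΨJ D (unscale (ω D) D q'))) q)
      Filter.atTop (𝓝 0)

/-- `λ = (1 + N μ)^(1/2)`, where `μ = (ω_p/ω)²`. -/
noncomputable def lam (N : ℕ) (μ : ℝ) : ℝ := √(1 + N * μ)

/-- `γ∞` as a function of `N` and `l = λ`. -/
noncomputable def gammaInf (N : ℕ) (l : ℝ) : ℝ := (l - 1) / (N + (l - 1))

/-- `r̄∞` as a function of `N` and `l = λ`. -/
noncomputable def rInf (N : ℕ) (l : ℝ) : ℝ := √((N + (l - 1)) / (2 * l * N))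

/-- The scaled internal coordinates `r̄ᵢ = r̄∞ + δ^(1/2) r̄'ᵢ`, `γᵢⱼ = γ∞ + δ^(1/2) γ'ᵢⱼ` with
displacement `y = (r̄', γ')`, where `δ = 1/D`. -/
noncomputable def displaced (N : ℕ) (l : ℝ) (D : ℕ) (y : Internal N) : Internal N :=
  (fun i => rInf N l + √(1 / (D : ℝ)) * y.1 i, fun p => gammaInf N l + √(1 / (D : ℝ)) * y.2 p)

/-! ### Graphs and binary invariants -/

/-- The unlabelled graphs (loops and multiple edges allowed) with one, two or three edges that label
the binary invariants: `r` stands for a loop and `g` for an edge with two distinct endpoints; the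
final letters number the graphs of a block. -/
inductive Graph : Type
  | r | g
  | rra | rrb
  | gra | grb
  | gga | ggb | ggc
  | rrra | rrrb | rrrc
  | grra | grrb | grrc | grrd | grre
  | ggra | ggrb | ggrc | ggrd | ggre | ggrf | ggrg
  | ggga | gggb | gggc | gggd | ggge | gggf | gggg | gggh
  deriving DecidableEq

instance : Fintype Graph where
  elems := {.r, .g, .rra, .rrb, .gra, .grb, .gga, .ggb, .ggc, .rrra, .rrrb, .rrrc, .grra, .grrb,
    .grrc, .grrd, .grre, .ggra, .ggrb, .ggrc, .ggrd, .ggre, .ggrf, .ggrg, .ggga, .gggb, .gggc,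
    .gggd, .ggge, .gggf, .gggg, .gggh}
  complete := by intro x; cases x <;> decide

/-- The edges with two distinct endpoints. -/
def Graph.edges : Graph → List (ℕ × ℕ)
  | r => []
  | g => [(0, 1)]
  | rra => []
  | rrb => []
  | gra => [(0, 1)]
  | grb => [(0, 1)]
  | gga => [(0, 1), (0, 1)]
  | ggb => [(0, 1), (1, 2)]
  | ggc => [(0, 1), (2, 3)]
  | rrra => []
  | rrrb => []
  | rrrc => []
  | grra => [(0, 1)]
  | grrb => [(0, 1)]
  | grrc => [(0, 1)]
  | grrd => [(0, 1)]
  | grre => [(0, 1)]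
  | ggra => [(0, 1), (0, 1)]
  | ggrb => [(0, 1), (0, 1)]
  | ggrc => [(0, 1), (1, 2)]
  | ggrd => [(0, 1), (1, 2)]
  | ggre => [(0, 1), (1, 2)]
  | ggrf => [(0, 1), (2, 3)]
  | ggrg => [(0, 1), (2, 3)]
  | ggga => [(0, 1), (0, 1), (0, 1)]
  | gggb => [(0, 1), (1, 2), (0, 2)]
  | gggc => [(0, 1), (0, 1), (1, 2)]
  | gggd => [(0, 1), (0, 2), (0, 3)]
  | ggge => [(0, 1), (1, 2), (2, 3)]
  | gggf => [(0, 1), (0, 1), (2, 3)]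
  | gggg => [(0, 1), (1, 2), (3, 4)]
  | gggh => [(0, 1), (2, 3), (4, 5)]

/-- The loops, each given by its vertex. -/
def Graph.loops : Graph → List ℕ
  | r => [0]
  | g => []
  | rra => [0, 0]
  | rrb => [0, 1]
  | gra => [0]
  | grb => [2]
  | gga => []
  | ggb => []
  | ggc => []
  | rrra => [0, 0, 0]
  | rrrb => [0, 0, 1]
  | rrrc => [0, 1, 2]
  | grra => [0, 0]
  | grrb => [0, 1]
  | grrc => [0, 2]
  | grrd => [2, 2]
  | grre => [2, 3]
  | ggra => [0]
  | ggrb => [2]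
  | ggrc => [1]
  | ggrd => [0]
  | ggre => [3]
  | ggrf => [0]
  | ggrg => [4]
  | ggga => []
  | gggb => []
  | gggc => []
  | gggd => []
  | ggge => []
  | gggf => []
  | gggg => []
  | gggh => []

/-- The rank of the binary invariant: the number of edges, loops included. -/
def Graph.rank (G : Graph) : ℕ := G.edges.length + G.loops.length

/-- All edges, a loop at `v` being the unordered pair `s(v, v)`. -/
def Graph.allEdges (G : Graph) : Multiset (Sym2 ℕ) :=
  (G.edges.map fun e => s(e.1, e.2) : Multiset (Sym2 ℕ))
    + (G.loops.map fun v => s(v, v) : Multiset (Sym2 ℕ))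

/-- The edges of the labelled graph of the tensor element with indices `(ij)_1, …, k_1, …`: an
edge for every double index, a loop for every single index. -/
def elementGraph {N a b : ℕ} (e : Fin a → Pair N) (k : Fin b → Fin N) : Multiset (Sym2 (Fin N)) :=
  Multiset.map (fun s => s((e s).1.1, (e s).1.2)) Finset.univ.val
    + Multiset.map (fun t => s(k t, k t)) Finset.univ.val

/-- The tensor element with indices `e`, `k` is labelled by `G`: an injective labelling of the
vertices of `G` by particles turns `G` into the graph of the tensor element. -/
def Graph.Labels {N : ℕ} (G : Graph) {a b : ℕ} (e : Fin a → Pair N) (k : Fin b → Fin N) : Prop :=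
  ∃ f : ℕ → Fin N, Set.InjOn f {v | ∃ ε ∈ G.allEdges, v ∈ ε} ∧
    G.allEdges.map (Sym2.map f) = elementGraph e k

open Classical in
/-- The binary invariant `B(G)`. -/
noncomputable def Graph.binaryInvariant {N : ℕ} (G : Graph)
    (e : Fin G.edges.length → Pair N) (k : Fin G.loops.length → Fin N) : ℝ :=
  if G.Labels e k then 1 else 0

/-- The contraction `[B(G)]_{(ij),…,k,…} γ'_{(ij)} ⋯ r̄'_k ⋯` of the binary invariant with the
displacement `y = (r̄', γ')`, all indices being summed over. -/
noncomputable def Graph.contract {N : ℕ} (G : Graph) (y : Internal N) : ℝ :=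
  ∑ e : Fin G.edges.length → Pair N, ∑ k : Fin G.loops.length → Fin N,
    G.binaryInvariant e k * (∏ s, y.2 (e s)) * ∏ t, y.1 (k t)

/-! ### The coefficients -/

noncomputable def lamEff (N : ℕ) (l : ℝ) : ℝ := N * l / (N + l - 1)

noncomputable def cA (N : ℕ) (γ : ℝ) : ℝ := 1 / (6 * (1 - γ) * (1 + (N - 1) * γ))

noncomputable def cB (N : ℕ) (γ : ℝ) : ℝ :=
  -(8 * γ ^ 3 / ((1 - γ) ^ 2 * (1 + (N - 1) * γ) ^ 2))

noncomputable def cC (N : ℕ) (γ : ℝ) : ℝ := -(6 * γ / ((1 - γ) ^ 2 * (1 + (N - 1) * γ)))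

noncomputable def cD (N : ℕ) (γ : ℝ) : ℝ := 1 + (N - 3) * γ

noncomputable def cE (γ : ℝ) : ℝ := -γ

noncomputable def cF (N : ℕ) (γ : ℝ) : ℝ := (1 + (N - 4) * γ) / (1 - γ) ^ 2

noncomputable def cG (γ : ℝ) : ℝ := γ / (1 - γ) ^ 2

noncomputable def cH (N : ℕ) (γ : ℝ) : ℝ := 1 / (2 * (1 - γ) ^ 2 * (1 + (N - 1) * γ))

noncomputable def cI (N : ℕ) (γ : ℝ) : ℝ := γ ^ 2 / (1 + (N - 1) * γ)

noncomputable def cJ (N : ℕ) (γ : ℝ) : ℝ := (1 + (N - 3) * γ) / 2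

/-- The coefficients of the binary invariants as functions of `N`, `l = λ`, `ρ = r̄∞` and
`γ = γ∞`. -/
noncomputable def coeffAux (N : ℕ) (l ρ γ : ℝ) : Graph → ℝ
  | .r => -(1 / ρ)
  | .g => cA N γ * 6 * (N + 1) * γ
  | .rrra => 1 / (3 * ρ ^ 3)
  | .grrb => (l - 1) / N
  | .ggga => cA N γ * (cB N γ + cC N γ * cD N γ)
  | .gggb => cA N γ * (cB N γ + cC N γ * cE γ + cF N γ)
  | .gggc => cA N γ * (cB N γ + cC N γ * (cD N γ / 3 + 2 * cE γ / 3))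
  | .gggd => cA N γ * (cB N γ + cC N γ * cE γ)
  | .ggge => cA N γ * (cB N γ + 2 * cC N γ * cE γ / 3 - cG γ)
  | .gggf => cA N γ * (cB N γ + cC N γ * cD N γ / 3 + 2 * cG γ)
  | .gggg => cA N γ * (cB N γ + cC N γ * cE γ / 3)
  | .gggh => cA N γ * cB N γ
  | .rra => lamEff N l + (l - 1) / (2 * N) * (lamEff N l - 1)
  | .rrb => -((l - 1) / N) * (γ / 2)
  | .gra => -((l - 1) / N) * ρ
  | .gga => cH N γ * (cI N γ + cJ N γ)
  | .ggb => cH N γ * (cI N γ - γ / 2)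
  | .ggc => cH N γ * cI N γ
  | .rrrb | .rrrc | .grb | .grra | .grrc | .grrd | .grre => 0
  | .ggra | .ggrb | .ggrc | .ggrd | .ggre | .ggrf | .ggrg => 0

/-- The coefficients `△(G)`. -/
noncomputable def coeff (N : ℕ) (l : ℝ) (G : Graph) : ℝ :=
  coeffAux N l (rInf N l) (gammaInf N l) G

end HarmonicDPT

/-! The ground state is an explicit Gaussian, so the theorem becomes Laplace's method for one
explicit function.

Put λ = √(1 + Nμ) and let K be the matrix λ + ((1 - λ)/N) J, with J the all-ones matrix: K is λ on
relative coordinates and 1 on the centre of mass. The Gaussian g = exp(-(ω/2) ∑ K_ij 𝐫ᵢ·𝐫ⱼ) is a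
positive eigenfunction because K² reproduces the potential. If u = f g is another square-integrable
eigenfunction with eigenvalue e ≤ e₀, integration by parts gives (e₀ - e) ∫ u² + ∫ g² |∇f|² = 0, so
e = e₀ and f is constant (`eigenfunction_eq_smul_of_le`). This gives existence, uniqueness and the
form of the ground state (`isGroundState_iff`).

In scaled coordinates ΨJ is a constant times exp(D · `phase` - `weight`), where neither function
depends on D. Let S be the matrix of inner products rᵢ γᵢⱼ rⱼ and X = 2 K^(1/2) S K^(1/2). Then
`phase` is (log det X - tr X)/4 up to a constant (`phase_center_sub`). The scalar inequality log x ≤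
x - 1 on the eigenvalues of X shows that the maximum is attained exactly at X = 1, that is at S =
(2K)⁻¹, which is the point with r̄∞ and γ∞. The critical point equations also force X = 1
(`eq_center_of_fderiv_phase_eq_zero`), which is part (1).

For part (2), log det is expanded to third order at this point (`log_det_add`, `exists_expansion`).
The second order is -½ tr((K δS)²), and it is negative definite because the displacement determines
δS. The third order of `phase` and the first order of `weight` form the correction of relative order
√δ. The normalization integral is a Gaussian integral up to O(δ): away from the maximum the density
is exponentially small (`exists_phase_gap`), and the term of order √δ is odd and integrates to zero
(`exists_abs_integral_relDensity_sub_le`).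

Finally, the inverse of the limiting matrix of angle cosines has one value on the diagonal and
another off it. An entry of the tensors of tr((V A)²) and tr((V A)³) therefore depends only on which
end points of the edges coincide, that is on an unlabelled graph. The stated coefficients are these
entries, checked graph by graph as identities of rational functions of N and λ. -/

namespace HarmonicDPT

/-! ### Positive eigenfunctions of Schrödinger operators -/

section GroundState

open MeasureTheory

variable {ι : Type*} [Fintype ι]

/-- Partial derivatives in a Euclidean space. -/
noncomputable def partialDeriv [DecidableEq ι] (m : ι) (f : EuclideanSpace ℝ ι → ℝ)
    (x : EuclideanSpace ℝ ι) : ℝ :=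
  fderiv ℝ f x (EuclideanSpace.single m 1)

lemma partialDeriv_mul [DecidableEq ι] {f g : EuclideanSpace ℝ ι → ℝ} {x : EuclideanSpace ℝ ι}
    (hf : DifferentiableAt ℝ f x) (hg : DifferentiableAt ℝ g x) (m : ι) :
    partialDeriv m (fun y => f y * g y) x
      = f x * partialDeriv m g x + g x * partialDeriv m f x := by
  simp only [partialDeriv]
  rw [fderiv_fun_mul hf hg]
  simp

lemma partialDeriv_sub [DecidableEq ι] {f g : EuclideanSpace ℝ ι → ℝ} {x : EuclideanSpace ℝ ι}
    (hf : DifferentiableAt ℝ f x) (hg : DifferentiableAt ℝ g x) (m : ι) :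
    partialDeriv m (fun y => f y - g y) x = partialDeriv m f x - partialDeriv m g x := by
  simp only [partialDeriv]
  rw [fderiv_fun_sub hf hg]
  simp

lemma contDiff_partialDeriv [DecidableEq ι] {f : EuclideanSpace ℝ ι → ℝ} {n k : WithTop ℕ∞}
    (hf : ContDiff ℝ n f) (hk : k + 1 ≤ n) (m : ι) : ContDiff ℝ k (partialDeriv m f) :=
  (hf.fderiv_right hk).clm_apply contDiff_const

lemma laplacian_eq_sum_partialDeriv [DecidableEq ι] {f : EuclideanSpace ℝ ι → ℝ}
    (hf : ContDiff ℝ 2 f) (x : EuclideanSpace ℝ ι) :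
    Laplacian.laplacian f x = ∑ m, partialDeriv m (partialDeriv m f) x := by
  rw [InnerProductSpace.laplacian_eq_iteratedFDeriv_orthonormalBasis f
    (EuclideanSpace.basisFun ι ℝ)]
  refine Finset.sum_congr rfl fun m _ => ?_
  rw [iteratedFDeriv_two_apply]
  have hd : DifferentiableAt ℝ (fderiv ℝ f) x :=
    (hf.fderiv_right (m := 1) (by norm_num)).differentiable (by norm_num) x
  unfold partialDeriv
  rw [fderiv_clm_apply hd (differentiableAt_const _)]
  simp

lemma integral_partialDeriv_eq_zero [DecidableEq ι] {f : EuclideanSpace ℝ ι → ℝ}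
    (hf : ContDiff ℝ 1 f) (hc : HasCompactSupport f) (m : ι) :
    ∫ x, partialDeriv m f x = 0 := by
  have hd : Differentiable ℝ f := hf.differentiable (by norm_num)
  have hint : Integrable (fun x => partialDeriv m f x) := by
    refine Continuous.integrable_of_hasCompactSupport
      (contDiff_partialDeriv (k := 0) hf (by norm_num) m).continuous ?_
    exact hc.fderiv_apply (𝕜 := ℝ) _
  have h := integral_mul_fderiv_eq_neg_fderiv_mul_of_integrable (μ := volume) (𝕜 := ℝ)
    (f := fun _ => (1 : ℝ)) (g := f) (v := EuclideanSpace.single m 1) (by simp)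
    (by simpa [partialDeriv] using hint)
    (by simpa using hf.continuous.integrable_of_hasCompactSupport hc)
    (fun x _ => differentiableAt_const _) (fun x _ => hd x)
  simpa [partialDeriv] using h

/-- The energy identity obtained by writing an eigenfunction as `f * g` with `g` a positive
eigenfunction, localized by a cutoff `χ`. -/
lemma integral_cutoff_energy [DecidableEq ι] {V f g χ : EuclideanSpace ℝ ι → ℝ} {e e₀ : ℝ}
    (hf : ContDiff ℝ 2 f) (hg : ContDiff ℝ 2 g) (hχ : ContDiff ℝ 2 χ) (hc : HasCompactSupport χ)
    (hΔg : ∀ x, Laplacian.laplacian g x = (V x - e₀) * g x)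
    (hΔu : ∀ x, Laplacian.laplacian (fun x => f x * g x) x = (V x - e) * (f x * g x)) :
    ∫ x, ((e₀ - e) * (χ x * (f x * g x)) ^ 2
        + ∑ m, (g x * partialDeriv m (fun y => χ y * f y) x) ^ 2)
      = ∫ x, ∑ m, (f x * g x * partialDeriv m χ x) ^ 2 := by
  -- With u = f g, the field v = g ∇u - u ∇g equals g² ∇f. The potential cancels in its divergence,
  -- which is (e₀ - e) u g. The identity follows by integrating the divergence of w v with w = χ² f.
  set v : ι → EuclideanSpace ℝ ι → ℝ := fun m x =>
    g x * partialDeriv m (fun y => f y * g y) x - (f x * g x) * partialDeriv m g x with hv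
  have hu : ContDiff ℝ 2 (fun x => f x * g x) := hf.mul hg
  have df : Differentiable ℝ f := hf.differentiable (by norm_num)
  have dg : Differentiable ℝ g := hg.differentiable (by norm_num)
  have dχ : Differentiable ℝ χ := hχ.differentiable (by norm_num)
  have d2 : ∀ {k : EuclideanSpace ℝ ι → ℝ}, ContDiff ℝ 2 k → ∀ m,
      ContDiff ℝ 1 (partialDeriv m k) := fun hk m => contDiff_partialDeriv hk (by norm_num) m
  have c1 : ∀ {k : EuclideanSpace ℝ ι → ℝ}, ContDiff ℝ 2 k → ContDiff ℝ 1 k :=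
    fun hk => hk.of_le (by norm_num)
  have hvc : ∀ m, ContDiff ℝ 1 (v m) := fun m =>
    ((c1 hg).mul (d2 hu m)).sub ((c1 hu).mul (d2 hg m))
  set w : EuclideanSpace ℝ ι → ℝ := fun x => χ x * (χ x * f x) with hw
  have hwc : ContDiff ℝ 2 w := hχ.mul (hχ.mul hf)
  have hdiv : ∀ x, ∑ m, partialDeriv m (v m) x = (e₀ - e) * (f x * g x * g x) := by
    intro x
    have h1 : ∀ m, partialDeriv m (v m) x
        = g x * partialDeriv m (partialDeriv m (fun y => f y * g y)) x
          - (f x * g x) * partialDeriv m (partialDeriv m g) x := by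
      intro m
      have a1 := (d2 hu m).differentiable (by norm_num) x
      have a2 := (d2 hg m).differentiable (by norm_num) x
      simp only [hv]
      have e1 := partialDeriv_mul (dg x) a1 m
      have e2 := partialDeriv_mul (hu.differentiable (by norm_num) x) a2 m
      have e3 := partialDeriv_sub ((dg x).mul a1) ((hu.differentiable (by norm_num) x).mul a2) m
      simp only [Pi.mul_apply] at e3
      refine e3.trans ((congrArg₂ (· - ·) e1 e2).trans ?_)
      ring
    simp_rw [h1]
    rw [Finset.sum_sub_distrib, ← Finset.mul_sum, ← Finset.mul_sum,
      ← laplacian_eq_sum_partialDeriv hu, ← laplacian_eq_sum_partialDeriv hg, hΔg, hΔu]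
    ring
  -- Rests on the pointwise identity ∂(χ² f) ∂f = (∂(χ f))² - f² (∂χ)², multiplied by g².
  have hprod : ∀ m x, partialDeriv m (fun y => w y * v m y) x
      = w x * partialDeriv m (v m) x + ((g x * partialDeriv m (fun y => χ y * f y) x) ^ 2
        - (f x * g x * partialDeriv m χ x) ^ 2) := by
    intro m x
    rw [partialDeriv_mul (hwc.differentiable (by norm_num) x)
      ((hvc m).differentiable (by norm_num) x)]
    simp only [hw, hv]
    have e1 := partialDeriv_mul (dχ x) ((dχ x).mul (df x)) m
    simp only [Pi.mul_apply] at e1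
    have e2 := partialDeriv_mul (dχ x) (df x) m
    rw [e1, partialDeriv_mul (df x) (dg x)]
    have e3 : partialDeriv m (χ * f) x = partialDeriv m (fun y => χ y * f y) x := rfl
    rw [e3, e2]
    ring
  have hcw : ∀ m, HasCompactSupport (fun y => w y * v m y) := fun m => by
    have : HasCompactSupport w := hc.mul_right
    exact this.mul_right
  have hwv : ∀ m, ContDiff ℝ 1 (fun y => w y * v m y) := fun m => (c1 hwc).mul (hvc m)
  have hpt : ∀ x, ∑ m, partialDeriv m (fun y => w y * v m y) x
      = ((e₀ - e) * (χ x * (f x * g x)) ^ 2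
        + ∑ m, (g x * partialDeriv m (fun y => χ y * f y) x) ^ 2)
        - ∑ m, (f x * g x * partialDeriv m χ x) ^ 2 := by
    intro x
    simp_rw [hprod]
    rw [Finset.sum_add_distrib, Finset.sum_sub_distrib, ← Finset.mul_sum, hdiv]
    simp only [hw]
    ring
  have hzero : ∫ x, ∑ m, partialDeriv m (fun y => w y * v m y) x = 0 := by
    rw [integral_finsetSum]
    · exact Finset.sum_eq_zero fun m _ => integral_partialDeriv_eq_zero (hwv m) (hcw m) m
    · intro m _
      exact ((contDiff_partialDeriv (k := 0) (hwv m) (by norm_num) m).continuous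
        ).integrable_of_hasCompactSupport ((hcw m).fderiv_apply (𝕜 := ℝ) _)
  have hχf : ContDiff ℝ 2 (fun y => χ y * f y) := hχ.mul hf
  have hcχf : HasCompactSupport (fun y => χ y * f y) := hc.mul_right
  simp_rw [hpt] at hzero
  rw [integral_sub] at hzero
  · linarith
  · refine Continuous.integrable_of_hasCompactSupport ?_ ?_
    · have := fun m => (d2 hχf m).continuous
      have := hχ.continuous; have := hf.continuous; have := hg.continuous
      fun_prop
    · refine HasCompactSupport.intro hc fun x hx => ?_
      have h0 : χ x = 0 := image_eq_zero_of_notMem_tsupport hx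
      have h1 : ∀ m, partialDeriv m (fun y => χ y * f y) x = 0 := by
        intro m
        have : x ∉ tsupport (fun y => χ y * f y) := fun h => hx (tsupport_mul_subset_left h)
        simp [partialDeriv, fderiv_of_notMem_tsupport (𝕜 := ℝ) this]
      simp [h0, h1]
  · refine Continuous.integrable_of_hasCompactSupport ?_ ?_
    · have := fun m => (d2 hχ m).continuous
      have := hf.continuous; have := hg.continuous
      fun_prop
    · refine HasCompactSupport.intro hc fun x hx => ?_
      have h1 : ∀ m, partialDeriv m χ x = 0 := by
        intro m
        simp [partialDeriv, fderiv_of_notMem_tsupport (𝕜 := ℝ) hx]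
      simp [h1]

/-- Smooth cutoff functions whose gradient is small. -/
lemma exists_cutoff [DecidableEq ι] : ∃ C : ℝ, ∀ r : ℝ, 1 ≤ r → ∃ χ : EuclideanSpace ℝ ι → ℝ,
    ContDiff ℝ 2 χ ∧ HasCompactSupport χ ∧ (∀ x, ‖x‖ ≤ r → χ x = 1) ∧
      ∀ x m, |partialDeriv m χ x| ≤ C / r := by
  let ψ : ContDiffBump (0 : EuclideanSpace ℝ ι) := ⟨1, 2, one_pos, one_lt_two⟩
  have hψ : ContDiff ℝ 2 ψ := ψ.contDiff
  have hcont : Continuous (fderiv ℝ ψ) := hψ.continuous_fderiv (by norm_num)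
  obtain ⟨C, hC⟩ := hcont.bounded_above_of_compact_support (ψ.hasCompactSupport.fderiv (𝕜 := ℝ))
  -- Dilating one fixed bump function by r divides its gradient by r.
  refine ⟨C, fun r hr => ⟨fun x => ψ (r⁻¹ • x), ?_, ?_, ?_, ?_⟩⟩
  · exact hψ.comp (contDiff_id.const_smul _)
  · exact ψ.hasCompactSupport.comp_smul (by positivity)
  · intro x hx
    apply ψ.one_of_mem_closedBall
    rw [mem_closedBall_zero_iff, norm_smul, norm_inv, Real.norm_of_nonneg (by linarith)]
    rw [inv_mul_le_iff₀ (by linarith)]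
    simpa [ψ] using hx
  · intro x m
    have hd : HasFDerivAt (fun x => ψ (r⁻¹ • x))
        ((fderiv ℝ ψ (r⁻¹ • x)).comp (r⁻¹ • ContinuousLinearMap.id ℝ _)) x :=
      ((hψ.differentiable (by norm_num) _).hasFDerivAt).comp x
        ((hasFDerivAt_id x).const_smul (r⁻¹))
    simp only [partialDeriv]
    rw [hd.fderiv]
    have := (fderiv ℝ ψ (r⁻¹ • x)).le_of_opNorm_le (hC (r⁻¹ • x))
      (r⁻¹ • EuclideanSpace.single m (1 : ℝ))
    rw [norm_smul] at this
    simp only [ContinuousLinearMap.comp_apply, _root_.smul_apply,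
      ContinuousLinearMap.id_apply]
    rw [← Real.norm_eq_abs]
    refine this.trans (le_of_eq ?_)
    simp [abs_of_pos (lt_of_lt_of_le one_pos hr)]
    ring

/-- A positive solution of the Schrödinger equation has the least eigenvalue, and this eigenvalue
is simple. -/
theorem eigenfunction_eq_smul_of_le {V g u : EuclideanSpace ℝ ι → ℝ} {e e₀ : ℝ}
    (hg : ContDiff ℝ 2 g) (hpos : ∀ x, 0 < g x) (hu : ContDiff ℝ 2 u) (huL : MemLp u 2)
    (hu0 : u ≠ 0)
    (hΔg : ∀ x, Laplacian.laplacian g x = (V x - e₀) * g x)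
    (hΔu : ∀ x, Laplacian.laplacian u x = (V x - e) * u x) (he : e ≤ e₀) :
    e = e₀ ∧ ∃ c : ℝ, ∀ x, u x = c * g x := by
  classical
  set f : EuclideanSpace ℝ ι → ℝ := fun x => u x / g x with hfdef
  have hf : ContDiff ℝ 2 f := hu.div hg fun x => (hpos x).ne'
  have hfg : (fun x => f x * g x) = u := by
    funext x; simp [hfdef, (hpos x).ne']
  have hfg' : ∀ x, f x * g x = u x := fun x => congrFun hfg x
  have hu2 : Integrable (fun x => u x ^ 2) := huL.integrable_sq
  obtain ⟨C, hC⟩ := exists_cutoff (ι := ι)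
  -- The energy density without cutoff. Both summands are nonnegative when e ≤ e₀, so it suffices
  -- that its integral over every ball vanishes.
  set T : EuclideanSpace ℝ ι → ℝ := fun x =>
    (e₀ - e) * u x ^ 2 + ∑ m, (g x * partialDeriv m f x) ^ 2 with hT
  have hTc : Continuous T := by
    have := fun m => (contDiff_partialDeriv (k := 1) hf (by norm_num) m).continuous
    have := hg.continuous; have := hu.continuous
    fun_prop
  have hT0 : ∀ x, 0 ≤ T x := fun x =>
    add_nonneg (mul_nonneg (by linarith) (sq_nonneg _))
      (Finset.sum_nonneg fun m _ => sq_nonneg _)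
  -- The cutoff at radius r ≥ r₀ is 1 on the ball, so `T` is the localized density there. The
  -- right-hand side of the energy identity is O(r⁻²) because u is square integrable, and r is
  -- arbitrary.
  have hball : ∀ r₀ : ℝ, 1 ≤ r₀ → ∫ x in Metric.ball 0 r₀, T x = 0 := by
    intro r₀ hr₀
    have hbd : ∀ r : ℝ, r₀ ≤ r → ∫ x in Metric.ball 0 r₀, T x
        ≤ (C / r) ^ 2 * (Fintype.card ι * ∫ x, u x ^ 2) := by
      intro r hr
      obtain ⟨χ, hχ, hcs, hχ1, hχd⟩ := hC r (hr₀.trans hr)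
      have hid := integral_cutoff_energy (V := V) (e := e) (e₀ := e₀) hf hg hχ hcs hΔg
        (by rw [hfg]; intro x; rw [hfg']; exact hΔu x)
      have hχf : ContDiff ℝ 2 (fun y => χ y * f y) := hχ.mul hf
      have hright : ∫ x, ∑ m, (f x * g x * partialDeriv m χ x) ^ 2
          ≤ (C / r) ^ 2 * (Fintype.card ι * ∫ x, u x ^ 2) := by
        rw [← integral_const_mul, ← integral_const_mul]
        refine integral_mono_of_nonneg
          (Filter.Eventually.of_forall fun x => Finset.sum_nonneg fun m _ => sq_nonneg _)
          ((hu2.const_mul _).const_mul _) (Filter.Eventually.of_forall fun x => ?_)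
        have : ∀ m ∈ Finset.univ, (f x * g x * partialDeriv m χ x) ^ 2
            ≤ (C / r) ^ 2 * u x ^ 2 := by
          intro m _
          rw [hfg', mul_pow, mul_comm]
          exact mul_le_mul_of_nonneg_right (sq_le_sq' (abs_le.1 (hχd x m)).1
            (abs_le.1 (hχd x m)).2) (sq_nonneg _)
        refine (Finset.sum_le_sum this).trans (le_of_eq ?_)
        simp; ring
      refine le_trans ?_ hright
      rw [← hid]
      set S : EuclideanSpace ℝ ι → ℝ := fun x => (e₀ - e) * (χ x * (f x * g x)) ^ 2
        + ∑ m, (g x * partialDeriv m (fun y => χ y * f y) x) ^ 2 with hS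
      have hS0 : ∀ x, 0 ≤ S x := fun x =>
        add_nonneg (mul_nonneg (by linarith) (sq_nonneg _))
          (Finset.sum_nonneg fun m _ => sq_nonneg _)
      have hSint : Integrable S := by
        refine Continuous.integrable_of_hasCompactSupport ?_ ?_
        · have := fun m => (contDiff_partialDeriv (k := 1) hχf (by norm_num) m).continuous
          have := hχ.continuous; have := hf.continuous; have := hg.continuous
          fun_prop
        · refine HasCompactSupport.intro hcs fun x hx => ?_
          have h0 : χ x = 0 := image_eq_zero_of_notMem_tsupport hx
          have h1 : ∀ m, partialDeriv m (fun y => χ y * f y) x = 0 := by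
            intro m
            have : x ∉ tsupport (fun y => χ y * f y) := fun h => hx (tsupport_mul_subset_left h)
            simp [partialDeriv, fderiv_of_notMem_tsupport (𝕜 := ℝ) this]
          simp [hS, h0, h1]
      calc ∫ x in Metric.ball 0 r₀, T x = ∫ x in Metric.ball 0 r₀, S x := by
            refine setIntegral_congr_fun Metric.isOpen_ball.measurableSet fun x hx => ?_
            have hx' : ‖x‖ < r₀ := by simpa using hx
            have hev : (fun y => χ y * f y) =ᶠ[𝓝 x] f := by
              filter_upwards [Metric.isOpen_ball.mem_nhds hx] with y hy
              have hy' : ‖y‖ < r₀ := by simpa using hy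
              rw [hχ1 y (by linarith), one_mul]
            have : ∀ m, partialDeriv m (fun y => χ y * f y) x = partialDeriv m f x := by
              intro m; simp only [partialDeriv]; rw [hev.fderiv_eq]
            simp only [hT, hS, this, hχ1 x (by linarith), hfg', one_mul]
        _ ≤ ∫ x, S x := setIntegral_le_integral hSint (Filter.Eventually.of_forall hS0)
    have hlim : Filter.Tendsto (fun r : ℝ => (C / r) ^ 2 * (Fintype.card ι * ∫ x, u x ^ 2))
        Filter.atTop (𝓝 0) := by
      have := ((tendsto_const_nhds (x := C)).div_atTop Filter.tendsto_id).pow 2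
      simpa using this.mul_const (Fintype.card ι * ∫ x, u x ^ 2)
    refine le_antisymm (ge_of_tendsto hlim ?_)
      (setIntegral_nonneg Metric.isOpen_ball.measurableSet fun x _ => hT0 x)
    filter_upwards [Filter.eventually_ge_atTop r₀] with r hr using hbd r hr
  have hTzero : ∀ x, T x = 0 := by
    intro x
    by_contra hne
    have hx0 : 0 < T x := lt_of_le_of_ne (hT0 x) (Ne.symm hne)
    set r₀ : ℝ := ‖x‖ + 1
    have hr₀ : 1 ≤ r₀ := by simp [r₀]
    have hint : IntegrableOn T (Metric.ball 0 r₀) :=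
      (hTc.continuousOn.integrableOn_compact (isCompact_closedBall 0 r₀)).mono_set
        Metric.ball_subset_closedBall
    have : 0 < ∫ x in Metric.ball 0 r₀, T x := by
      rw [setIntegral_pos_iff_support_of_nonneg_ae (Filter.Eventually.of_forall hT0) hint]
      have ho : IsOpen (Function.support T ∩ Metric.ball 0 r₀) :=
        (hTc.isOpen_support).inter Metric.isOpen_ball
      exact ho.measure_pos _ ⟨x, hx0.ne', by simp [r₀]⟩
    exact this.ne' (hball r₀ hr₀)
  obtain ⟨x₀, hx₀⟩ : ∃ x, u x ≠ 0 := by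
    by_contra h; push Not at h; exact hu0 (funext h)
  have hsplit : ∀ x, (e₀ - e) * u x ^ 2 = 0 ∧ ∑ m, (g x * partialDeriv m f x) ^ 2 = 0 := by
    intro x
    have h1 : 0 ≤ (e₀ - e) * u x ^ 2 := mul_nonneg (by linarith) (sq_nonneg _)
    have h2 : 0 ≤ ∑ m, (g x * partialDeriv m f x) ^ 2 := Finset.sum_nonneg fun m _ => sq_nonneg _
    have := hTzero x
    simp only [hT] at this
    constructor <;> linarith
  refine ⟨?_, f 0, fun x => ?_⟩
  · have := (hsplit x₀).1
    rcases mul_eq_zero.1 this with h | h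
    · linarith
    · exact absurd (pow_eq_zero_iff (by norm_num) |>.1 h) hx₀
  · have hfd : ∀ x, fderiv ℝ f x = 0 := by
      intro x
      have h := (Finset.sum_eq_zero_iff_of_nonneg fun m _ => sq_nonneg _).1 (hsplit x).2
      have h' : ∀ m, fderiv ℝ f x (EuclideanSpace.single m 1) = 0 := by
        intro m
        have := pow_eq_zero_iff (by norm_num) |>.1 (h m (Finset.mem_univ m))
        exact (mul_eq_zero.1 this).resolve_left (hpos x).ne'
      apply ContinuousLinearMap.coe_injective
      refine (EuclideanSpace.basisFun ι ℝ).toBasis.ext fun m => ?_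
      simpa using h' m
    rw [← hfg' x, is_const_of_fderiv_eq_zero (hf.differentiable (by norm_num)) hfd x 0]

end GroundState

end HarmonicDPT

/-! ### The Gaussian ground state -/

namespace HarmonicDPT

/-- The bridge between double sums over particles, natural for matrices, and sums over pairs i < j,
in which the interaction and the tensors are indexed. -/
lemma sum_sum_eq_diag_add_pair {N : ℕ} {M : Type*} [AddCommMonoid M] (f : Fin N → Fin N → M) :
    ∑ i, ∑ j, f i j = ∑ i, f i i + ∑ p : Pair N, (f p.1.1 p.1.2 + f p.1.2 p.1.1) := by
  have hsub : ∀ g : Fin N × Fin N → M,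
      ∑ p : Pair N, g p.1 = ∑ q : Fin N × Fin N, if q.1 < q.2 then g q else 0 := by
    intro g
    rw [← Finset.sum_filter]
    exact (Finset.sum_subtype _ (by simp) g).symm
  have h1 := hsub fun q => f q.1 q.2 + f q.2 q.1
  rw [h1, Fintype.sum_prod_type]
  have h2 : ∑ i : Fin N, ∑ j : Fin N, (if i < j then f i j + f j i else 0)
      = ∑ i : Fin N, ∑ j : Fin N, ((if i < j then f i j else 0) + if j < i then f i j else 0) := by
    simp_rw [Finset.sum_add_distrib]
    rw [Finset.sum_comm (f := fun i j => if j < i then f i j else 0), ← Finset.sum_add_distrib]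
    refine Finset.sum_congr rfl fun i _ => ?_
    rw [← Finset.sum_add_distrib]
    refine Finset.sum_congr rfl fun j _ => ?_
    split_ifs <;> simp
  simp only at h2 ⊢
  rw [h2, ← Finset.sum_add_distrib]
  refine Finset.sum_congr rfl fun i _ => ?_
  have h3 : f i i = ∑ j, if i = j then f i j else 0 := by simp
  rw [h3, ← Finset.sum_add_distrib]
  refine Finset.sum_congr rfl fun j _ => ?_
  rcases lt_trichotomy i j with h | h | h
  · simp [h, h.ne, h.asymm]
  · simp [h]
  · simp [h, h.ne', h.asymm]

lemma lam_pos {N : ℕ} {μ : ℝ} (hμ : 0 < 1 + N * μ) : 0 < lam N μ := Real.sqrt_pos.2 hμ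

lemma lam_sq {N : ℕ} {μ : ℝ} (hμ : 0 < 1 + N * μ) : lam N μ ^ 2 = 1 + N * μ :=
  Real.sq_sqrt hμ.le

section Gaussian

variable {N D : ℕ}

/-- The quadratic form in the exponent of the ground state. -/
noncomputable def groundForm (l : ℝ) (x : Config N D) : ℝ :=
  l * ∑ i, ‖position x i‖ ^ 2 + (1 - l) / N * ‖∑ i, position x i‖ ^ 2

/-- The gradient of half the quadratic form `groundForm`. -/
noncomputable def groundGrad (l : ℝ) (x : Config N D) (m : Fin N × Fin D) : ℝ :=
  l * x m + (1 - l) / N * ∑ i, x (i, m.2)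

lemma position_apply (x : Config N D) (i : Fin N) (a : Fin D) : position x i a = x (i, a) := rfl

lemma sum_norm_position_sq (x : Config N D) : ∑ i, ‖position x i‖ ^ 2 = ∑ m, x m ^ 2 := by
  simp [EuclideanSpace.real_norm_sq_eq, position_apply, Fintype.sum_prod_type]

lemma norm_sum_position_sq (x : Config N D) :
    ‖∑ i, position x i‖ ^ 2 = ∑ a, (∑ i, x (i, a)) ^ 2 := by
  simp [EuclideanSpace.real_norm_sq_eq, position_apply]

/-- Splits the interaction into a multiple of the trap potential and a centre-of-mass term. The full
double sum counts every pair twice, and its diagonal vanishes. -/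
lemma sum_pair_norm_sub_sq (x : Config N D) :
    ∑ p : Pair N, ‖position x p.1.1 - position x p.1.2‖ ^ 2
      = N * ∑ i, ‖position x i‖ ^ 2 - ‖∑ i, position x i‖ ^ 2 := by
  have h := sum_sum_eq_diag_add_pair fun i j : Fin N => ‖position x i - position x j‖ ^ 2
  have h2 : ∑ i, ∑ j, ‖position x i - position x j‖ ^ 2
      = 2 * (N * ∑ i, ‖position x i‖ ^ 2 - ‖∑ i, position x i‖ ^ 2) := by
    have : ‖∑ i, position x i‖ ^ 2 = ∑ i, ∑ j, inner ℝ (position x i) (position x j) := by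
      rw [← real_inner_self_eq_norm_sq, sum_inner]
      simp_rw [inner_sum]
    rw [this]
    simp_rw [@norm_sub_sq_real, Finset.sum_add_distrib, Finset.sum_sub_distrib, ← Finset.mul_sum]
    simp [← Finset.mul_sum]
    ring
  rw [h2] at h
  have h3 : ∀ p : Pair N, ‖position x p.1.2 - position x p.1.1‖
      = ‖position x p.1.1 - position x p.1.2‖ := fun p => norm_sub_rev _ _
  simp [Finset.sum_add_distrib, h3] at h
  linarith

lemma contDiff_groundForm (l : ℝ) {n : WithTop ℕ∞} :
    ContDiff ℝ n (groundForm l : Config N D → ℝ) := by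
  have : (groundForm l : Config N D → ℝ)
      = fun x => l * ∑ m, x m ^ 2 + (1 - l) / N * ∑ a, (∑ i, x (i, a)) ^ 2 := by
    funext x; rw [groundForm, sum_norm_position_sq, norm_sum_position_sq]
  rw [this]
  fun_prop

lemma partialDeriv_groundForm (l : ℝ) (x : Config N D) (m : Fin N × Fin D) :
    partialDeriv m (groundForm l) x = 2 * groundGrad l x m := by
  have hform : (groundForm l : Config N D → ℝ)
      = fun x => l * ∑ m, x m ^ 2 + (1 - l) / N * ∑ a, (∑ i, x (i, a)) ^ 2 := by
    funext x; rw [groundForm, sum_norm_position_sq, norm_sum_position_sq]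
  have hc : ∀ k : Fin N × Fin D, HasFDerivAt (fun x : Config N D => x k)
      (EuclideanSpace.proj k : Config N D →L[ℝ] ℝ) x := fun k =>
    (EuclideanSpace.proj k : Config N D →L[ℝ] ℝ).hasFDerivAt
  have h := ((HasFDerivAt.fun_sum (u := Finset.univ) fun k _ => (hc k).pow 2).const_mul l).fun_add
    ((HasFDerivAt.fun_sum (u := Finset.univ) fun a _ =>
      (HasFDerivAt.fun_sum (u := Finset.univ) fun i _ => hc (i, a)).pow 2).const_mul ((1 - l) / N))
  rw [partialDeriv, hform, HasFDerivAt.fderiv h]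
  obtain ⟨j, b⟩ := m
  simp [groundGrad, Prod.ext_iff, Fintype.sum_prod_type, ite_and]
  ring

/-- The unnormalized ground state. -/
noncomputable def gaussianState (ω l : ℝ) (x : Config N D) : ℝ :=
  Real.exp (-(ω / 2) * groundForm l x)

lemma contDiff_gaussianState (ω l : ℝ) {n : WithTop ℕ∞} :
    ContDiff ℝ n (gaussianState ω l : Config N D → ℝ) :=
  (contDiff_const.mul (contDiff_groundForm l)).exp

lemma gaussianState_pos (ω l : ℝ) (x : Config N D) : 0 < gaussianState ω l x := Real.exp_pos _

lemma partialDeriv_gaussianState (ω l : ℝ) (m : Fin N × Fin D) :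
    partialDeriv m (gaussianState ω l : Config N D → ℝ)
      = fun x => (-ω * groundGrad l x m) * gaussianState ω l x := by
  funext x
  have hd : DifferentiableAt ℝ (groundForm l : Config N D → ℝ) x :=
    (contDiff_groundForm l (n := 1)).differentiable (by norm_num) x
  have h := (hd.hasFDerivAt.const_mul (-(ω / 2))).exp
  have h2 := partialDeriv_groundForm l x m
  rw [partialDeriv] at h2 ⊢
  unfold gaussianState
  rw [h.fderiv]
  simp [h2]
  ring

lemma partialDeriv_groundGrad (l : ℝ) (x : Config N D) (m : Fin N × Fin D) :
    partialDeriv m (fun y => groundGrad l y m) x = l + (1 - l) / N := by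
  have hc : ∀ k : Fin N × Fin D, HasFDerivAt (fun x : Config N D => x k)
      (EuclideanSpace.proj k : Config N D →L[ℝ] ℝ) x := fun k =>
    (EuclideanSpace.proj k : Config N D →L[ℝ] ℝ).hasFDerivAt
  have h := ((hc m).const_mul l).fun_add
    ((HasFDerivAt.fun_sum (u := Finset.univ) fun i _ => hc (i, m.2)).const_mul ((1 - l) / N))
  unfold groundGrad
  rw [partialDeriv, HasFDerivAt.fderiv h]
  obtain ⟨j, b⟩ := m
  simp [Prod.ext_iff]

lemma differentiable_groundGrad (l : ℝ) (m : Fin N × Fin D) :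
    Differentiable ℝ (fun y : Config N D => groundGrad l y m) := by
  unfold groundGrad; fun_prop

/-- The gradient is the image of x under K, which has eigenvalues l and 1; K² is the same expression
with l² in place of l. -/
lemma sum_groundGrad_sq (hN : 1 ≤ N) (l : ℝ) (x : Config N D) :
    ∑ m, groundGrad l x m ^ 2 = l ^ 2 * ∑ i, ‖position x i‖ ^ 2
      + (1 - l ^ 2) / N * ‖∑ i, position x i‖ ^ 2 := by
  rw [sum_norm_position_sq, norm_sum_position_sq, Fintype.sum_prod_type, Fintype.sum_prod_type,
    Finset.sum_comm, Finset.sum_comm (f := fun i a => x (i, a) ^ 2), Finset.mul_sum,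
    Finset.mul_sum, ← Finset.sum_add_distrib]
  refine Finset.sum_congr rfl fun a _ => ?_
  have hN' : (N : ℝ) ≠ 0 := by positivity
  simp only [groundGrad, add_sq, Finset.sum_add_distrib]
  simp only [mul_pow, ← Finset.mul_sum, ← Finset.sum_mul, mul_assoc, Finset.sum_const,
    Finset.card_univ, Fintype.card_fin, nsmul_eq_mul]
  field_simp
  ring

/-- Differentiating the exponential twice gives ω² |K x|² - ω tr K, the trace being over all
coordinates. By λ² = 1 + Nμ the quadratic part is exactly the potential, and the constant is twice
the ground state energy. -/
lemma laplacian_gaussianState (hN : 1 ≤ N) {μ : ℝ} (hμ : 0 < 1 + N * μ) (ω : ℝ)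
    (x : Config N D) :
    Laplacian.laplacian (gaussianState ω (lam N μ)) x
      = ((∑ i, ω ^ 2 * ‖position x i‖ ^ 2
          + ∑ p : Pair N, μ * ω ^ 2 * ‖position x p.1.1 - position x p.1.2‖ ^ 2)
        - ω * (N * D * (lam N μ + (1 - lam N μ) / N))) * gaussianState ω (lam N μ) x := by
  have hN' : (N : ℝ) ≠ 0 := by positivity
  rw [laplacian_eq_sum_partialDeriv (contDiff_gaussianState ω _), ← Finset.mul_sum,
    ← Finset.mul_sum, sum_pair_norm_sub_sq]
  have h1 : ∀ m, partialDeriv m (partialDeriv m (gaussianState ω (lam N μ))) x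
      = (ω ^ 2 * groundGrad (lam N μ) x m ^ 2 - ω * (lam N μ + (1 - lam N μ) / N))
        * gaussianState ω (lam N μ) x := by
    intro m
    rw [partialDeriv_gaussianState]
    have d1 : DifferentiableAt ℝ (fun y : Config N D => -ω * groundGrad (lam N μ) y m) x :=
      (differentiable_groundGrad _ m x).const_mul _
    have d2 : DifferentiableAt ℝ (gaussianState ω (lam N μ) : Config N D → ℝ) x :=
      (contDiff_gaussianState ω _ (n := 1)).differentiable (by norm_num) x
    have e1 := partialDeriv_mul d1 d2 m
    refine e1.trans ?_
    have e2 : partialDeriv m (fun y : Config N D => -ω * groundGrad (lam N μ) y m) x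
        = -ω * (lam N μ + (1 - lam N μ) / N) := by
      rw [← partialDeriv_groundGrad (lam N μ) x m]
      simp only [partialDeriv]
      rw [fderiv_const_mul (differentiable_groundGrad _ m x)]
      simp
    rw [e2, partialDeriv_gaussianState]
    ring
  simp_rw [h1]
  rw [← Finset.sum_mul, Finset.sum_sub_distrib, ← Finset.mul_sum, sum_groundGrad_sq hN, lam_sq hμ]
  simp
  left
  field_simp
  ring

/-- By Cauchy–Schwarz t / N lies between 0 and s, and the form is l (s - t / N) + t / N. -/
lemma groundForm_ge (hN : 1 ≤ N) {l : ℝ} (x : Config N D) :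
    min l 1 * ‖x‖ ^ 2 ≤ groundForm l x := by
  have hN' : (0 : ℝ) < N := by positivity
  have h1 : ‖x‖ ^ 2 = ∑ i, ‖position x i‖ ^ 2 := by
    rw [sum_norm_position_sq, EuclideanSpace.real_norm_sq_eq]
  have h2 : ‖∑ i, position x i‖ ^ 2 ≤ N * ∑ i, ‖position x i‖ ^ 2 := by
    have h3 : ‖∑ i, position x i‖ ^ 2 ≤ (∑ i, ‖position x i‖) ^ 2 :=
      pow_le_pow_left₀ (norm_nonneg _) (norm_sum_le _ _) 2
    refine h3.trans ?_
    simpa using sq_sum_le_card_mul_sum_sq (s := Finset.univ) (f := fun i => ‖position x i‖)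
  rw [groundForm, h1]
  set s := ∑ i, ‖position x i‖ ^ 2
  set t := ‖∑ i, position x i‖ ^ 2 with ht
  have ht0 : 0 ≤ t := sq_nonneg _
  have h4 : 0 ≤ t / N := by positivity
  have h5 : t / N ≤ s := by rw [div_le_iff₀ hN']; linarith
  have h6 : l * s + (1 - l) / N * t = l * s + (1 - l) * (t / N) := by ring
  rw [h6]
  rcases le_total l 1 with h | h
  · rw [min_eq_left h]; nlinarith
  · rw [min_eq_right h]; nlinarith

end Gaussian

/-! ### Integrability of Gaussians with polynomial factors -/

section Decay

open MeasureTheory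

/-- Every power is dominated by a Gaussian, in terms of the Japanese bracket. -/
lemma exists_rpow_mul_exp_le (k : ℝ) {c : ℝ} (hc : 0 < c) :
    ∃ C : ℝ, 0 < C ∧ ∀ t : ℝ, 0 ≤ t → (1 + t) ^ k * Real.exp (-c * t ^ 2) ≤ C := by
  obtain ⟨n, hn⟩ := exists_nat_ge k
  refine ⟨Real.exp (c⁻¹ * n ^ 2), Real.exp_pos _, fun t ht => ?_⟩
  have h1 : (1 + t) ^ k ≤ Real.exp (n * t) := by
    calc (1 + t) ^ k ≤ (1 + t) ^ (n : ℝ) := Real.rpow_le_rpow_of_exponent_le (by linarith) hn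
      _ = (1 + t) ^ n := Real.rpow_natCast _ _
      _ ≤ (Real.exp t) ^ n := by
        apply pow_le_pow_left₀ (by linarith)
        linarith [Real.add_one_le_exp t]
      _ = Real.exp (n * t) := by rw [← Real.exp_nat_mul]
  calc (1 + t) ^ k * Real.exp (-c * t ^ 2) ≤ Real.exp (n * t) * Real.exp (-c * t ^ 2) := by gcongr
    _ = Real.exp (n * t + -c * t ^ 2) := (Real.exp_add _ _).symm
    _ ≤ Real.exp (c⁻¹ * n ^ 2) := by
      apply Real.exp_le_exp.2
      -- Expanded, this nonnegative quantity says n t - c t² ≤ n² / c.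
      have : 0 ≤ c⁻¹ * ((c * t - n) ^ 2 + c * t * n) := by positivity
      have e : c⁻¹ * ((c * t - n) ^ 2 + c * t * n) = c⁻¹ * n ^ 2 - (n * t + -c * t ^ 2) := by
        field_simp; ring
      linarith

variable {E : Type*} [NormedAddCommGroup E] [NormedSpace ℝ E] [FiniteDimensional ℝ E]
  [MeasurableSpace E] [BorelSpace E] {ν : Measure E} [ν.IsAddHaarMeasure]

/-- The Gaussian absorbs d = dim E + 1 additional powers, which leaves the integrable function (1 +
‖y‖)^(-d). -/
lemma integrable_rpow_mul_exp_neg (k : ℝ) {c : ℝ} (hc : 0 < c) :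
    Integrable (fun y : E => (1 + ‖y‖) ^ k * Real.exp (-c * ‖y‖ ^ 2)) ν := by
  set d : ℝ := Module.finrank ℝ E + 1
  obtain ⟨C, -, hC⟩ := exists_rpow_mul_exp_le (k + d) hc
  have hint : Integrable (fun y : E => C * (1 + ‖y‖) ^ (-d)) ν :=
    (integrable_one_add_norm (by simp [d])).const_mul C
  refine hint.mono' (Continuous.aestronglyMeasurable ?_) (Filter.Eventually.of_forall fun y => ?_)
  · refine Continuous.mul ?_ (by fun_prop)
    exact Continuous.rpow_const (by fun_prop) fun y => Or.inl (by positivity)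
  · have hp : 0 < 1 + ‖y‖ := by positivity
    rw [Real.norm_of_nonneg (by positivity)]
    have := mul_le_mul_of_nonneg_left (hC ‖y‖ (norm_nonneg y)) (Real.rpow_nonneg hp.le (-d))
    refine le_trans (le_of_eq ?_) (this.trans (le_of_eq (mul_comm _ _)))
    rw [← mul_assoc, ← Real.rpow_add hp]
    ring_nf

end Decay

/-! ### Existence and uniqueness of the ground state -/

section GroundState

open MeasureTheory

variable {N D : ℕ}

lemma integrable_gaussianState_sq (hN : 1 ≤ N) {ω l : ℝ} (hω : 0 < ω) (hl : 0 < l) :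
    Integrable (fun x : Config N D => gaussianState ω l x ^ 2) := by
  have hc : 0 < ω * min l 1 := mul_pos hω (lt_min hl one_pos)
  refine (integrable_rpow_mul_exp_neg 0 hc (E := Config N D)).mono'
    (((contDiff_gaussianState ω l (n := 0)).continuous.pow 2).aestronglyMeasurable)
    (Filter.Eventually.of_forall fun x => ?_)
  rw [Real.norm_of_nonneg (sq_nonneg _), Real.rpow_zero, one_mul, gaussianState, ← Real.exp_nat_mul]
  apply Real.exp_le_exp.2
  have := mul_le_mul_of_nonneg_left (groundForm_ge hN (l := l) x) hω.le
  push_cast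
  linarith

lemma integral_gaussianState_sq_pos (hN : 1 ≤ N) {ω l : ℝ} (hω : 0 < ω) (hl : 0 < l) :
    0 < ∫ x : Config N D, gaussianState ω l x ^ 2 := by
  rw [integral_pos_iff_support_of_nonneg (fun x => sq_nonneg _)
    (integrable_gaussianState_sq hN hω hl)]
  have : Function.support (fun x : Config N D => gaussianState ω l x ^ 2) = Set.univ := by
    ext x; simp [(gaussianState_pos ω l x).ne']
  rw [this]
  exact isOpen_univ.measure_pos _ Set.univ_nonempty

/-- Twice the potential energy. -/
noncomputable def potential (ω μ : ℝ) (x : Config N D) : ℝ :=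
  ∑ i, ω ^ 2 * ‖position x i‖ ^ 2
    + ∑ p : Pair N, μ * ω ^ 2 * ‖position x p.1.1 - position x p.1.2‖ ^ 2

lemma hamiltonian_eq_iff (ω μ E : ℝ) (Ψ : Config N D → ℝ) (x : Config N D) :
    hamiltonian ω μ Ψ x = E * Ψ x
      ↔ Laplacian.laplacian Ψ x = (potential ω μ x - 2 * E) * Ψ x := by
  unfold hamiltonian potential
  constructor <;> intro h <;> linarith

/-- Twice the ground state energy. -/
noncomputable def groundEnergy (N D : ℕ) (ω l : ℝ) : ℝ := ω * (N * D * (l + (1 - l) / N))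

lemma isEigenfunction_gaussianState (hN : 1 ≤ N) {μ ω : ℝ} (hμ : 0 < 1 + N * μ) (hω : 0 < ω)
    {c : ℝ} (hc : 0 < c) :
    IsEigenfunction ω μ (groundEnergy N D ω (lam N μ) / 2)
      (fun x : Config N D => c * gaussianState ω (lam N μ) x) where
  contDiff := contDiff_const.mul (contDiff_gaussianState _ _)
  memLp := by
    rw [memLp_two_iff_integrable_sq
      (contDiff_const.mul (contDiff_gaussianState _ _) (n := 0)).continuous.aestronglyMeasurable]
    simp_rw [mul_pow]
    exact (integrable_gaussianState_sq hN hω (lam_pos hμ)).const_mul _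
  ne_zero h := (mul_pos hc (gaussianState_pos ω (lam N μ) 0)).ne' (congrFun h 0)
  eigen x := by
    rw [hamiltonian_eq_iff]
    have h := laplacian_gaussianState hN hμ ω x
    have e : (fun x : Config N D => c * gaussianState ω (lam N μ) x)
      = c • gaussianState ω (lam N μ) := rfl
    rw [e, InnerProductSpace.laplacian_smul _ (contDiff_gaussianState _ _).contDiffAt, h]
    simp only [smul_eq_mul, potential, groundEnergy]
    ring

lemma IsEigenfunction.rigidity (hN : 1 ≤ N) {μ ω E : ℝ} (hμ : 0 < 1 + N * μ)
    {Ψ : Config N D → ℝ} (h : IsEigenfunction ω μ E Ψ)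
    (hE : E ≤ groundEnergy N D ω (lam N μ) / 2) :
    E = groundEnergy N D ω (lam N μ) / 2 ∧ ∃ c : ℝ, ∀ x, Ψ x = c * gaussianState ω (lam N μ) x := by
  obtain ⟨h1, h2⟩ := eigenfunction_eq_smul_of_le (V := potential ω μ) (e := 2 * E)
    (e₀ := groundEnergy N D ω (lam N μ))
    (contDiff_gaussianState ω (lam N μ)) (gaussianState_pos ω _) h.contDiff h.memLp h.ne_zero
    (fun x => laplacian_gaussianState hN hμ ω x)
    (fun x => (hamiltonian_eq_iff _ _ _ _ _).1 (h.eigen x)) (by linarith)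
  exact ⟨by linarith, h2⟩

/-- The normalization constant of the ground state. -/
noncomputable def groundNorm (N D : ℕ) (ω l : ℝ) : ℝ :=
  (√(∫ x : Config N D, gaussianState ω l x ^ 2))⁻¹

lemma groundNorm_pos (hN : 1 ≤ N) {ω l : ℝ} (hω : 0 < ω) (hl : 0 < l) :
    0 < groundNorm N D ω l :=
  inv_pos.2 (Real.sqrt_pos.2 (integral_gaussianState_sq_pos hN hω hl))

/-- The ground state is a Gaussian. -/
theorem isGroundState_iff (hN : 1 ≤ N) {μ ω : ℝ} (hμ : 0 < 1 + N * μ) (hω : 0 < ω)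
    (Ψ : Config N D → ℝ) :
    IsGroundState ω μ Ψ
      ↔ Ψ = fun x => groundNorm N D ω (lam N μ) * gaussianState ω (lam N μ) x := by
  have hI := integral_gaussianState_sq_pos (D := D) hN hω (lam_pos hμ)
  constructor
  · intro h
    obtain ⟨E, hE, hmin⟩ := h.lowest
    -- Minimality is applied to the Gaussian itself, which bounds E from above by the Gaussian's
    -- eigenvalue and makes the rigidity statement applicable.
    obtain ⟨-, c, hc⟩ := hE.rigidity hN hμ
      (hmin _ _ (isEigenfunction_gaussianState hN hμ hω one_pos))
    have hc0 : 0 < c := by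
      have := h.pos 0
      rw [hc] at this
      exact (pos_iff_pos_of_mul_pos this).2 (gaussianState_pos _ _ _)
    have hn := h.normalized
    simp_rw [hc, mul_pow] at hn
    rw [integral_const_mul] at hn
    have hc' : c = groundNorm N D ω (lam N μ) := by
      rw [groundNorm, ← Real.sqrt_inv, eq_comm, Real.sqrt_eq_iff_mul_self_eq_of_pos hc0]
      rw [← sq]
      exact eq_inv_of_mul_eq_one_left hn
    rw [← hc']
    exact funext hc
  · rintro rfl
    refine ⟨⟨_, isEigenfunction_gaussianState hN hμ hω (groundNorm_pos hN hω (lam_pos hμ)), ?_⟩,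
      ?_, fun x => mul_pos (groundNorm_pos hN hω (lam_pos hμ)) (gaussianState_pos _ _ _)⟩
    · intro E' Ψ' h'
      by_contra hlt
      push Not at hlt
      exact hlt.ne (h'.rigidity hN hμ hlt.le).1
    · simp_rw [mul_pow]
      rw [integral_const_mul, groundNorm, inv_pow, Real.sq_sqrt hI.le, inv_mul_cancel₀ hI.ne']

end GroundState

end HarmonicDPT

namespace HarmonicDPT

/-! ### Angle cosines, inner products and the domain of the internal coordinates -/

section Gram

variable {N : ℕ}

lemma gram_self (γ : Pair N → ℝ) (i : Fin N) : gram γ i i = 1 := by simp [gram]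

lemma gram_pair (γ : Pair N → ℝ) (p : Pair N) : gram γ p.1.1 p.1.2 = γ p := by
  simp [gram, p.2]

lemma gram_pair' (γ : Pair N → ℝ) (p : Pair N) : gram γ p.1.2 p.1.1 = γ p := by
  simp [gram, p.2, p.2.asymm]

lemma gram_comm (γ : Pair N → ℝ) (i j : Fin N) : gram γ i j = gram γ j i := by
  rcases lt_trichotomy i j with h | h | h
  · exact (gram_pair γ ⟨(i, j), h⟩).trans (gram_pair' γ ⟨(i, j), h⟩).symm
  · rw [h]
  · exact (gram_pair' γ ⟨(j, i), h⟩).trans (gram_pair γ ⟨(j, i), h⟩).symm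

lemma gram_isHermitian (γ : Pair N → ℝ) : (gram γ).IsHermitian := by
  ext i j; simp [gram_comm γ i j]

lemma matrix_ext_pair {M : Matrix (Fin N) (Fin N) ℝ} {γ : Pair N → ℝ} (hs : ∀ i j, M i j = M j i)
    (hd : ∀ i, M i i = 1) (hp : ∀ p : Pair N, M p.1.1 p.1.2 = γ p) : M = gram γ := by
  ext i j
  rcases lt_trichotomy i j with h | h | h
  · exact (hp ⟨(i, j), h⟩).trans (gram_pair γ ⟨(i, j), h⟩).symm
  · rw [h, hd, gram_self]
  · rw [hs, gram_comm]
    exact (hp ⟨(j, i), h⟩).trans (gram_pair γ ⟨(j, i), h⟩).symm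

lemma continuous_gram : Continuous (gram : (Pair N → ℝ) → Matrix (Fin N) (Fin N) ℝ) := by
  refine continuous_matrix fun i j => ?_
  simp only [gram, Matrix.of_apply]
  split_ifs <;> fun_prop

/-- The matrix of inner products of the position vectors. -/
noncomputable def innerMatrix (q : Internal N) : Matrix (Fin N) (Fin N) ℝ :=
  Matrix.of fun i j => q.1 i * gram q.2 i j * q.1 j

lemma innerMatrix_apply (q : Internal N) (i j : Fin N) :
    innerMatrix q i j = q.1 i * gram q.2 i j * q.1 j := rfl

lemma innerMatrix_eq (q : Internal N) :
    innerMatrix q = Matrix.diagonal q.1 * gram q.2 * Matrix.diagonal q.1 := by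
  ext i j; simp [innerMatrix_apply]

/-- The quadratic form `groundForm` as a function of the internal coordinates. -/
noncomputable def internalForm (l : ℝ) (q : Internal N) : ℝ :=
  l * ∑ i, q.1 i ^ 2 + (1 - l) / N * ∑ i, ∑ j, innerMatrix q i j

lemma innerMatrix_internal {D : ℕ} {x : Config N D} (hx : ∀ i, 0 < (internal x).1 i)
    (i j : Fin N) : innerMatrix (internal x) i j = inner ℝ (position x i) (position x j) := by
  have hx' : ∀ i, ‖position x i‖ ≠ 0 := fun i => (hx i).ne'
  have key : ∀ p : Pair N, ‖position x p.1.1‖ * (internal x).2 p * ‖position x p.1.2‖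
      = inner ℝ (position x p.1.1) (position x p.1.2) := by
    intro p
    have := hx' p.1.1
    have := hx' p.1.2
    simp only [internal]
    field_simp
  rw [innerMatrix_apply]
  rcases lt_trichotomy i j with h | h | h
  · have := key ⟨(i, j), h⟩
    rw [← gram_pair (internal x).2] at this
    exact this
  · subst h
    rw [gram_self, real_inner_self_eq_norm_sq]
    simp only [internal]; ring
  · have := key ⟨(j, i), h⟩
    rw [← gram_pair' (internal x).2] at this
    rw [real_inner_comm, ← this]
    simp only [internal]
    ring

lemma internalForm_internal {D : ℕ} {x : Config N D} (hx : ∀ i, 0 < (internal x).1 i) (l : ℝ) :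
    internalForm l (internal x) = groundForm l x := by
  rw [internalForm, groundForm]
  congr 2
  rw [← real_inner_self_eq_norm_sq, sum_inner]
  simp_rw [inner_sum, innerMatrix_internal hx]

/-- For `D ≥ N` every point of the domain is attained by the internal coordinates. -/
lemma exists_internal_eq {D : ℕ} (hD : N ≤ D) {q : Internal N} (hq : q ∈ domain N) :
    ∃ x : Config N D, internal x = q := by
  obtain ⟨hr, hG⟩ := hq
  obtain ⟨B, hB⟩ : ∃ B : Matrix (Fin N) (Fin N) ℝ, gram q.2 = Bᵀ * B := by
    open scoped MatrixOrder in
    obtain ⟨B, hB⟩ := CStarAlgebra.nonneg_iff_eq_star_mul_self.1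
      (Matrix.nonneg_iff_posSemidef.2 hG.posSemidef)
    exact ⟨B, by simpa [Matrix.star_eq_conjTranspose] using hB⟩
  -- The columns of B are N vectors of length N with the prescribed inner products. Padding them
  -- with zeros places them in `D` dimensions, which requires N ≤ D.
  let w : Fin N → Fin D → ℝ := fun i => Function.extend (Fin.castLE hD) (fun k => B k i) 0
  have hw : ∀ i j, ∑ a, w i a * w j a = gram q.2 i j := by
    intro i j
    rw [hB, Matrix.mul_apply]
    symm
    refine Fintype.sum_of_injective (Fin.castLE hD) (Fin.castLE_injective hD) _ _ ?_ ?_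
    · intro a ha
      have : w i a = 0 := Function.extend_apply' _ _ _ fun ⟨k, hk⟩ => ha ⟨k, hk⟩
      rw [this, zero_mul]
    · intro k
      simp [w, (Fin.castLE_injective hD).extend_apply]
  let x : Config N D := WithLp.toLp 2 fun m => q.1 m.1 * w m.1 m.2
  have hin : ∀ i j, inner ℝ (position x i) (position x j) = q.1 i * q.1 j * gram q.2 i j := by
    intro i j
    rw [← hw, Finset.mul_sum]
    simp only [position, x, PiLp.inner_apply, RCLike.inner_apply, conj_trivial]
    exact Finset.sum_congr rfl fun a _ => by ring
  have hnorm : ∀ i, ‖position x i‖ = q.1 i := by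
    intro i
    have := hin i i
    rw [real_inner_self_eq_norm_sq, gram_self, mul_one, ← sq] at this
    exact (pow_left_inj₀ (norm_nonneg _) (hr i).le two_ne_zero).1 this
  refine ⟨x, Prod.ext (funext hnorm) (funext fun p => ?_)⟩
  have h1 := (hr p.1.1).ne'
  have h2 := (hr p.1.2).ne'
  simp only [internal]
  rw [hnorm, hnorm, hin, gram_pair]
  field_simp

/-- Transferred from `groundForm_ge`: N dimensions suffice to realize q by a configuration. -/
lemma internalForm_ge (hN : 1 ≤ N) {l : ℝ} {q : Internal N} (hq : q ∈ domain N) :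
    min l 1 * ∑ i, q.1 i ^ 2 ≤ internalForm l q := by
  obtain ⟨x, rfl⟩ := exists_internal_eq le_rfl hq
  rw [internalForm_internal hq.1]
  have h := groundForm_ge hN (l := l) x
  rwa [EuclideanSpace.real_norm_sq_eq, ← sum_norm_position_sq] at h

/-- The quadratic form at eᵢ + t eⱼ is 1 + 2tγ + t², and t = ±1 give the two bounds. -/
lemma abs_le_one_of_posDef {γ : Pair N → ℝ} (h : (gram γ).PosDef) (p : Pair N) : |γ p| ≤ 1 := by
  have key : ∀ t : ℝ, 0 ≤ 1 + 2 * t * γ p + t ^ 2 := by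
    intro t
    have := h.posSemidef.dotProduct_mulVec_nonneg
      (Pi.single p.1.1 1 + Pi.single p.1.2 t : Fin N → ℝ)
    simp [Matrix.mulVec_add, gram_pair, gram_pair', gram_self, add_dotProduct] at this
    nlinarith
  have h1 := key 1
  have h2 := key (-1)
  rw [abs_le]; constructor <;> linarith

/-- Hadamard's inequality for unit diagonal: log x ≤ x - 1 is summed over the eigenvalues, whose sum
is the trace N. -/
lemma det_gram_le_one {γ : Pair N → ℝ} (h : (gram γ).PosDef) : (gram γ).det ≤ 1 := by
  have htr : ∑ i, h.1.eigenvalues i = N := by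
    have := h.1.trace_eq_sum_eigenvalues
    simp only [RCLike.ofReal_real_eq_id, id] at this
    rw [← this]
    simp [Matrix.trace, gram_self]
  have hdet := h.1.det_eq_prod_eigenvalues
  simp only [RCLike.ofReal_real_eq_id, id] at hdet
  have hle : Real.log (gram γ).det ≤ 0 := by
    rw [hdet, Real.log_prod fun i _ => (h.eigenvalues_pos i).ne']
    calc ∑ i, Real.log (h.1.eigenvalues i) ≤ ∑ i, (h.1.eigenvalues i - 1) :=
          Finset.sum_le_sum fun i _ => Real.log_le_sub_one_of_pos (h.eigenvalues_pos i)
      _ = 0 := by simp [htr]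
  exact (Real.log_nonpos_iff h.det_pos.le).1 hle

/-- Positivity of the form on the compact unit sphere persists for nearby matrices, and scaling
extends it to all nonzero vectors. -/
lemma isOpen_setOf_gram_posDef : IsOpen {γ : Pair N → ℝ | (gram γ).PosDef} := by
  rw [isOpen_iff_mem_nhds]
  intro γ hγ
  have hcont : Continuous fun z : (Pair N → ℝ) × (Fin N → ℝ) => z.2 ⬝ᵥ (gram z.1 *ᵥ z.2) :=
    continuous_snd.dotProduct ((continuous_gram.comp continuous_fst).matrix_mulVec continuous_snd)
  have hev : ∀ᶠ γ' in 𝓝 γ, ∀ v ∈ Metric.sphere (0 : Fin N → ℝ) 1,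
      0 < v ⬝ᵥ (gram γ' *ᵥ v) := by
    refine (isCompact_sphere (0 : Fin N → ℝ) 1).eventually_forall_of_forall_eventually
      fun v hv => ?_
    have hv0 : v ≠ 0 := ne_zero_of_mem_unit_sphere ⟨v, hv⟩
    have hpos : 0 < v ⬝ᵥ (gram γ *ᵥ v) := by simpa using hγ.dotProduct_mulVec_pos hv0
    exact hcont.continuousAt.eventually (lt_mem_nhds hpos)
  filter_upwards [hev] with γ' h'
  refine Matrix.PosDef.of_dotProduct_mulVec_pos (gram_isHermitian γ') fun v hv => ?_
  have hn : 0 < ‖v‖ := norm_pos_iff.2 hv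
  have := h' (‖v‖⁻¹ • v) (by simp [norm_smul, hn.ne'])
  rw [Matrix.mulVec_smul, smul_dotProduct, dotProduct_smul, smul_smul, smul_eq_mul] at this
  simpa using (pos_iff_pos_of_mul_pos this).1 (by positivity)

lemma isOpen_domain : IsOpen (domain N) := by
  have h1 : IsOpen {q : Internal N | ∀ i, 0 < q.1 i} := by
    simp only [Set.ofPred_forall]
    exact isOpen_iInter_of_finite fun i =>
      isOpen_lt continuous_const ((continuous_apply i).comp continuous_fst)
  exact h1.inter (isOpen_setOf_gram_posDef.preimage continuous_snd)

/-- Shows that the open domain is not empty and therefore has positive measure. -/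
lemma one_mem_domain : ((fun _ => 1, fun _ => 0) : Internal N) ∈ domain N := by
  refine ⟨fun _ => one_pos, ?_⟩
  have : gram (fun _ : Pair N => (0 : ℝ)) = 1 := by
    symm
    refine matrix_ext_pair (fun i j => ?_) (fun i => ?_) fun p => ?_
    · simp [Matrix.one_apply, eq_comm]
    · simp
    · simp [p.2.ne]
  simp only [this]
  exact Matrix.PosDef.one

end Gram

/-! ### The Jacobian-weighted wavefunction in internal coordinates -/

section Wave

open MeasureTheory

variable {N : ℕ}

/-- Makes the behaviour of Lebesgue integrals under translation and dilation available on the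
internal coordinates. -/
instance isAddHaarMeasure_internal : (volume : Measure (Internal N)).IsAddHaarMeasure :=
  Measure.prod.instIsAddHaarMeasure (volume : Measure (Fin N → ℝ)) (volume : Measure (Pair N → ℝ))

/-- The unnormalized Jacobian-weighted ground state as a function of the internal coordinates. -/
noncomputable def wave (l : ℝ) (D : ℕ) (ω : ℝ) (q : Internal N) : ℝ :=
  sqrtJacobian N D q * Real.exp (-(ω / 2) * internalForm l q)

lemma continuous_internalForm (l : ℝ) : Continuous (internalForm l : Internal N → ℝ) := by
  have := fun i j => (continuous_gram (N := N)).matrix_elem i j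
  unfold internalForm innerMatrix
  simp only [Matrix.of_apply]
  fun_prop

lemma continuousOn_wave (l : ℝ) (D : ℕ) (ω : ℝ) :
    ContinuousOn (wave l D ω : Internal N → ℝ) (domain N) := by
  have h1 : Continuous fun q : Internal N => (gram q.2).det :=
    (continuous_gram.comp continuous_snd).matrix_det
  refine ContinuousOn.mul (ContinuousOn.mul ?_ ?_) ?_
  · exact h1.continuousOn.rpow_const fun q hq => Or.inl hq.2.det_pos.ne'
  · refine continuousOn_finsetProd _ fun j _ => ?_
    exact ((continuous_apply j).comp continuous_fst).continuousOn.rpow_const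
      fun q hq => Or.inl (hq.1 j).ne'
  · exact (continuous_const.mul (continuous_internalForm l)).rexp.continuousOn

lemma wave_pos (l : ℝ) (D : ℕ) (ω : ℝ) {q : Internal N} (hq : q ∈ domain N) : 0 < wave l D ω q :=
  mul_pos (mul_pos (Real.rpow_pos_of_pos hq.2.det_pos _)
    (Finset.prod_pos fun j _ => Real.rpow_pos_of_pos (hq.1 j) _)) (Real.exp_pos _)

/-- The determinant is at most 1 and its exponent is nonnegative for D ≥ N + 1; the radii are
bounded by ‖q‖. Since the cosines are bounded by 1, ‖q‖² ≤ ∑ rᵢ² + 1, so the exponential is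
dominated by a Gaussian in ‖q‖. -/
lemma integrableOn_wave_sq (hN : 1 ≤ N) {l : ℝ} (hl : 0 < l) {D : ℕ} (hD : N < D) {ω : ℝ}
    (hω : 0 < ω) : IntegrableOn (fun q : Internal N => wave l D ω q ^ 2) (domain N) := by
  set c : ℝ := ω * min l 1 with hcdef
  have hc : 0 < c := mul_pos hω (lt_min hl one_pos)
  set k : ℝ := ((D : ℝ) - 1) * N
  have hD1 : (1 : ℝ) ≤ D := by exact_mod_cast (by omega : 1 ≤ D)
  have hDN : (N : ℝ) + 1 ≤ D := by exact_mod_cast hD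
  have hint := ((integrable_rpow_mul_exp_neg (ν := (volume : Measure (Internal N))) k hc).const_mul
    (Real.exp c)).integrableOn (s := domain N)
  refine hint.mono' (((continuousOn_wave l D ω).pow 2).aestronglyMeasurable
    isOpen_domain.measurableSet) ?_
  filter_upwards [ae_restrict_mem isOpen_domain.measurableSet] with q hq
  rw [Real.norm_of_nonneg (sq_nonneg _)]
  have hdet : ((gram q.2).det ^ (((D : ℝ) - N - 1) / 4)) ^ 2 ≤ 1 := by
    refine pow_le_one₀ (Real.rpow_nonneg hq.2.det_pos.le _) ?_
    exact Real.rpow_le_one hq.2.det_pos.le (det_gram_le_one hq.2) (by linarith)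
  have hr : ∀ j, q.1 j ≤ ‖q‖ := fun j =>
    (le_abs_self _).trans ((norm_le_pi_norm q.1 j).trans (norm_fst_le q))
  have hprod : (∏ j, q.1 j ^ (((D : ℝ) - 1) / 2)) ^ 2 ≤ (1 + ‖q‖) ^ k := by
    rw [← Finset.prod_pow]
    calc ∏ j, (q.1 j ^ (((D : ℝ) - 1) / 2)) ^ 2 ≤ ∏ _j : Fin N, (1 + ‖q‖) ^ ((D : ℝ) - 1) := by
          refine Finset.prod_le_prod (fun j _ => sq_nonneg _) fun j _ => ?_
          rw [← Real.rpow_natCast, ← Real.rpow_mul (hq.1 j).le]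
          have : ((D : ℝ) - 1) / 2 * (2 : ℕ) = (D : ℝ) - 1 := by push_cast; ring
          rw [this]
          exact Real.rpow_le_rpow (hq.1 j).le (by linarith [hr j]) (by linarith)
      _ = (1 + ‖q‖) ^ k := by
          rw [Finset.prod_const, Finset.card_univ, Fintype.card_fin, ← Real.rpow_natCast,
            ← Real.rpow_mul (by positivity)]
  have hnorm : ‖q‖ ^ 2 ≤ ∑ i, q.1 i ^ 2 + 1 := by
    have h2 : ‖q.2‖ ≤ 1 := (pi_norm_le_iff_of_nonneg zero_le_one).2 fun p => by
      simpa using abs_le_one_of_posDef hq.2 p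
    have hs0 : 0 ≤ ∑ i, q.1 i ^ 2 := Finset.sum_nonneg fun _ _ => sq_nonneg _
    have h1 : ‖q.1‖ ≤ √(∑ i, q.1 i ^ 2) := by
      refine (pi_norm_le_iff_of_nonneg (Real.sqrt_nonneg _)).2 fun i => ?_
      rw [Real.norm_eq_abs]
      apply Real.abs_le_sqrt
      exact Finset.single_le_sum (f := fun i => q.1 i ^ 2) (fun _ _ => sq_nonneg _)
        (Finset.mem_univ i)
    have h3 : ‖q‖ ≤ √(∑ i, q.1 i ^ 2 + 1) := by
      rw [Prod.norm_def]
      refine max_le (h1.trans (Real.sqrt_le_sqrt (by linarith))) (h2.trans ?_)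
      rw [Real.one_le_sqrt]; linarith
    calc ‖q‖ ^ 2 ≤ √(∑ i, q.1 i ^ 2 + 1) ^ 2 := by gcongr
      _ = _ := Real.sq_sqrt (by linarith)
  have hexp : Real.exp (-(ω / 2) * internalForm l q) ^ 2
      ≤ Real.exp c * Real.exp (-c * ‖q‖ ^ 2) := by
    rw [← Real.exp_nat_mul, ← Real.exp_add]
    apply Real.exp_le_exp.2
    have h1 := mul_le_mul_of_nonneg_left (internalForm_ge hN (l := l) hq) hω.le
    have h2 := mul_le_mul_of_nonneg_left hnorm hc.le
    push_cast
    rw [hcdef] at h2 ⊢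
    nlinarith
  calc wave l D ω q ^ 2
      = (((gram q.2).det ^ (((D : ℝ) - N - 1) / 4)) ^ 2 * (∏ j, q.1 j ^ (((D : ℝ) - 1) / 2)) ^ 2)
        * Real.exp (-(ω / 2) * internalForm l q) ^ 2 := by
        rw [wave, sqrtJacobian]; ring
    _ ≤ (1 * (1 + ‖q‖) ^ k) * (Real.exp c * Real.exp (-c * ‖q‖ ^ 2)) := by gcongr
    _ = _ := by ring

lemma integral_wave_sq_pos (hN : 1 ≤ N) {l : ℝ} (hl : 0 < l) {D : ℕ} (hD : N < D) {ω : ℝ}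
    (hω : 0 < ω) : 0 < ∫ q in domain N, wave l D ω q ^ 2 := by
  rw [setIntegral_pos_iff_support_of_nonneg_ae (Filter.Eventually.of_forall fun q => sq_nonneg _)
    (integrableOn_wave_sq hN hl hD hω)]
  have : Function.support (fun q : Internal N => wave l D ω q ^ 2) ∩ domain N = domain N :=
    Set.inter_eq_right.2 fun q hq => (pow_pos (wave_pos l D ω hq) 2).ne'
  rw [this]
  exact isOpen_domain.measure_pos _ ⟨_, one_mem_domain⟩

/-- The Jacobian-weighted ground states are the normalized multiples of `wave`. -/
lemma isJacobianWeighted_iff (hN : 1 ≤ N) {μ ω : ℝ} (hμ : 0 < 1 + N * μ) (hω : 0 < ω) {D : ℕ}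
    (hD : N < D) {Ψ : Config N D → ℝ} (hΨ : IsGroundState ω μ Ψ) (ΨJ : Internal N → ℝ) :
    IsJacobianWeighted Ψ ΨJ
      ↔ (∃ c : ℝ, 0 < c ∧ ∀ q ∈ domain N, ΨJ q = c * wave (lam N μ) D ω q)
        ∧ ∫ q in domain N, ΨJ q ^ 2 = 1 := by
  rw [isGroundState_iff hN hμ hω] at hΨ
  have hn := groundNorm_pos (D := D) hN hω (lam_pos hμ)
  unfold IsJacobianWeighted
  refine and_congr_left fun _ => ⟨?_, ?_⟩
  · rintro ⟨c, hc, h⟩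
    refine ⟨c * groundNorm N D ω (lam N μ), mul_pos hc hn, fun q hq => ?_⟩
    -- Every point of the domain comes from a configuration because N ≤ D, so the condition on
    -- configurations determines ΨJ on the whole domain.
    obtain ⟨x, rfl⟩ := exists_internal_eq hD.le hq
    rw [h x hq, hΨ, wave, internalForm_internal hq.1]
    simp only [gaussianState]
    ring
  · rintro ⟨c, hc, h⟩
    refine ⟨c / groundNorm N D ω (lam N μ), div_pos hc hn, fun x hx => ?_⟩
    rw [h _ hx, hΨ, wave, internalForm_internal hx.1]
    simp only [gaussianState]
    field_simp

lemma exists_isJacobianWeighted (hN : 1 ≤ N) {μ ω : ℝ} (hμ : 0 < 1 + N * μ) (hω : 0 < ω) {D : ℕ}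
    (hD : N < D) {Ψ : Config N D → ℝ} (hΨ : IsGroundState ω μ Ψ) :
    ∃ ΨJ : Internal N → ℝ, IsJacobianWeighted Ψ ΨJ := by
  have hI := integral_wave_sq_pos hN (lam_pos hμ) hD hω
  refine ⟨fun q => (√(∫ q in domain N, wave (lam N μ) D ω q ^ 2))⁻¹ * wave (lam N μ) D ω q,
    (isJacobianWeighted_iff hN hμ hω hD hΨ _).2 ⟨⟨_, inv_pos.2 (Real.sqrt_pos.2 hI),
      fun q _ => rfl⟩, ?_⟩⟩
  simp_rw [mul_pow]
  rw [integral_const_mul, inv_pow, Real.sq_sqrt hI.le, inv_mul_cancel₀ hI.ne']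

end Wave

end HarmonicDPT

namespace HarmonicDPT

/-! ### Third-order expansion of log det -/

section LogDet

variable {n : Type*} [Fintype n] [DecidableEq n]

lemma isHermitian_iff_transpose_eq {m : Type*} {A : Matrix m m ℝ} : A.IsHermitian ↔ Aᵀ = A := by
  rw [Matrix.IsHermitian, Matrix.conjTranspose_eq_transpose_of_trivial]

/-- A real symmetric matrix is orthogonally similar to the diagonal matrix of its eigenvalues. -/
lemma exists_orthogonal_diagonalization {C : Matrix n n ℝ} (hC : C.IsHermitian) :
    ∃ (U : Matrix n n ℝ) (c : n → ℝ), U * Uᵀ = 1 ∧ Uᵀ * U = 1 ∧ C = U * Matrix.diagonal c * Uᵀ := by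
  refine ⟨hC.eigenvectorUnitary, hC.eigenvalues, ?_, ?_, ?_⟩
  · have := Unitary.coe_mul_star_self hC.eigenvectorUnitary
    rwa [Unitary.coe_star, Matrix.star_eq_conjTranspose,
      Matrix.conjTranspose_eq_transpose_of_trivial] at this
  · have := Unitary.coe_star_mul_self hC.eigenvectorUnitary
    rwa [Matrix.star_eq_conjTranspose, Matrix.conjTranspose_eq_transpose_of_trivial] at this
  · have := hC.spectral_theorem
    rw [Unitary.conjStarAlgAut_apply, Matrix.star_eq_conjTranspose,
      Matrix.conjTranspose_eq_transpose_of_trivial] at this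
    exact this

/-- The Taylor remainder is at most |x|⁴ / (1 - |x|), and 1 / (1 - |x|) ≤ 2 on the given range. -/
lemma abs_log_one_add_sub_le {x : ℝ} (hx : |x| ≤ 1 / 2) :
    |Real.log (1 + x) - (x - x ^ 2 / 2 + x ^ 3 / 3)| ≤ 2 * x ^ 4 := by
  have h := Real.abs_log_sub_add_sum_range_le (x := -x) (by rw [abs_neg]; linarith) 3
  rw [abs_neg] at h
  have h1 : |x| ^ (3 + 1) / (1 - |x|) ≤ 2 * x ^ 4 := by
    rw [div_le_iff₀ (by linarith)]
    have : |x| ^ 4 = x ^ 4 := by rw [show (4 : ℕ) = 2 * 2 from rfl, pow_mul, pow_mul, sq_abs]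
    norm_num
    rw [this]
    have : 0 ≤ x ^ 4 := by positivity
    nlinarith
  refine le_trans (le_of_eq ?_) (h.trans h1)
  simp [Finset.sum_range_succ]
  ring_nf

lemma abs_log_one_add_sub_self_le {x : ℝ} (hx : |x| ≤ 1 / 2) :
    |Real.log (1 + x) - x| ≤ 2 * x ^ 2 := by
  have h := Real.abs_log_sub_add_sum_range_le (x := -x) (by rw [abs_neg]; linarith) 1
  rw [abs_neg] at h
  have h1 : |x| ^ (1 + 1) / (1 - |x|) ≤ 2 * x ^ 2 := by
    rw [div_le_iff₀ (by linarith), one_add_one_eq_two, sq_abs]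
    nlinarith [sq_nonneg x]
  refine le_trans (le_of_eq ?_) (h.trans h1)
  simp
  ring_nf

/-- Third-order expansion of the logarithm of the determinant at the identity. -/
lemma log_det_one_add {C : Matrix n n ℝ} (hC : C.IsHermitian) (h : (C ^ 2).trace ≤ 1 / 4) :
    (1 + C).PosDef ∧ 0 ≤ (C ^ 2).trace ∧
      |Real.log (1 + C).det - (C.trace - (C ^ 2).trace / 2 + (C ^ 3).trace / 3)|
        ≤ 2 * (C ^ 2).trace ^ 2 ∧
      |Real.log (1 + C).det - C.trace| ≤ 2 * (C ^ 2).trace := by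
  obtain ⟨U, c, hU, hU', rfl⟩ := exists_orthogonal_diagonalization hC
  have hpow : ∀ k : ℕ, (U * Matrix.diagonal c * Uᵀ) ^ k
      = U * Matrix.diagonal (fun i => c i ^ k) * Uᵀ := by
    intro k
    induction k with
    | zero => simp [hU]
    | succ k ih =>
      rw [pow_succ, ih]
      calc U * Matrix.diagonal (fun i => c i ^ k) * Uᵀ * (U * Matrix.diagonal c * Uᵀ)
          = U * Matrix.diagonal (fun i => c i ^ k) * (Uᵀ * U) * Matrix.diagonal c * Uᵀ := by
            simp only [Matrix.mul_assoc]
        _ = _ := by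
            rw [hU', Matrix.mul_one, Matrix.mul_assoc U, Matrix.diagonal_mul_diagonal]
            simp only [pow_succ]
  have htr : ∀ k : ℕ, ((U * Matrix.diagonal c * Uᵀ) ^ k).trace = ∑ i, c i ^ k := by
    intro k
    rw [hpow, Matrix.trace_mul_comm, ← Matrix.mul_assoc, hU', Matrix.one_mul,
      Matrix.trace_diagonal]
  have htr1 : (U * Matrix.diagonal c * Uᵀ).trace = ∑ i, c i := by simpa using htr 1
  have hone : 1 + U * Matrix.diagonal c * Uᵀ = U * Matrix.diagonal (fun i => 1 + c i) * Uᵀ := by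
    have : Matrix.diagonal (fun i => 1 + c i) = 1 + Matrix.diagonal c := by
      rw [← Matrix.diagonal_one, Matrix.diagonal_add]
    rw [this, Matrix.mul_add, Matrix.add_mul, Matrix.mul_one, hU]
  have hdet : (1 + U * Matrix.diagonal c * Uᵀ).det = ∏ i, (1 + c i) := by
    have hd : U.det * Uᵀ.det = 1 := by rw [← Matrix.det_mul, hU, Matrix.det_one]
    rw [hone, Matrix.det_mul, Matrix.det_mul, Matrix.det_diagonal, mul_right_comm, hd, one_mul]
  rw [htr] at h
  -- The bound on tr C² forces every eigenvalue into the range of the scalar estimates for log (1 +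
  -- x).
  have hc : ∀ i, |c i| ≤ 1 / 2 := by
    intro i
    have : c i ^ 2 ≤ 1 / 4 :=
      (Finset.single_le_sum (f := fun i => c i ^ 2) (fun _ _ => sq_nonneg _)
        (Finset.mem_univ i)).trans h
    rw [show (1 : ℝ) / 2 = √(1 / 4) by
      rw [show (1 : ℝ) / 4 = (1 / 2) ^ 2 by norm_num, Real.sqrt_sq (by norm_num)]]
    exact Real.abs_le_sqrt this
  have hpos : ∀ i, 0 < 1 + c i := fun i => by linarith [(abs_le.1 (hc i)).1]
  have hlog : Real.log (1 + U * Matrix.diagonal c * Uᵀ).det = ∑ i, Real.log (1 + c i) := by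
    rw [hdet, Real.log_prod fun i _ => (hpos i).ne']
  refine ⟨?_, ?_, ?_, ?_⟩
  · rw [hone]
    have hd : (Matrix.diagonal fun i => 1 + c i).PosDef := Matrix.PosDef.diagonal hpos
    have hu : IsUnit Uᵀ := ⟨⟨Uᵀ, U, hU', hU⟩, rfl⟩
    have := hd.mul_mul_conjTranspose_same (B := U)
      (Matrix.vecMul_injective_iff_isUnit.2 ⟨⟨U, Uᵀ, hU, hU'⟩, rfl⟩)
    rwa [Matrix.conjTranspose_eq_transpose_of_trivial] at this
  · rw [htr]; exact Finset.sum_nonneg fun _ _ => sq_nonneg _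
  · rw [hlog, htr, htr, htr1]
    have e : ∑ i, Real.log (1 + c i) - (∑ i, c i - (∑ i, c i ^ 2) / 2 + (∑ i, c i ^ 3) / 3)
        = ∑ i, (Real.log (1 + c i) - (c i - c i ^ 2 / 2 + c i ^ 3 / 3)) := by
      simp only [Finset.sum_sub_distrib, Finset.sum_add_distrib, Finset.sum_div]
    rw [e]
    calc _ ≤ ∑ i, |Real.log (1 + c i) - (c i - c i ^ 2 / 2 + c i ^ 3 / 3)| :=
          Finset.abs_sum_le_sum_abs _ _
      _ ≤ ∑ i, 2 * c i ^ 4 := Finset.sum_le_sum fun i _ => abs_log_one_add_sub_le (hc i)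
      _ = 2 * ∑ i, (c i ^ 2) ^ 2 := by rw [Finset.mul_sum]; simp only [← pow_mul]
      _ ≤ 2 * (∑ i, c i ^ 2) ^ 2 := by
          gcongr
          exact Finset.sum_sq_le_sq_sum_of_nonneg fun _ _ => sq_nonneg _
  · rw [hlog, htr, htr1, ← Finset.sum_sub_distrib]
    calc _ ≤ ∑ i, |Real.log (1 + c i) - c i| := Finset.abs_sum_le_sum_abs _ _
      _ ≤ ∑ i, 2 * c i ^ 2 := Finset.sum_le_sum fun i _ => abs_log_one_add_sub_self_le (hc i)
      _ = _ := by rw [Finset.mul_sum]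

lemma exists_eq_transpose_mul_self {G : Matrix n n ℝ} (hG : G.PosDef) :
    ∃ B : Matrix n n ℝ, IsUnit B ∧ G = Bᵀ * B := by
  obtain ⟨B, hB⟩ : ∃ B : Matrix n n ℝ, G = Bᵀ * B := by
    open scoped MatrixOrder in
    obtain ⟨B, hB⟩ := CStarAlgebra.nonneg_iff_eq_star_mul_self.1
      (Matrix.nonneg_iff_posSemidef.2 hG.posSemidef)
    exact ⟨B, by simpa [Matrix.star_eq_conjTranspose] using hB⟩
  refine ⟨B, ?_, hB⟩
  rw [Matrix.isUnit_iff_isUnit_det, isUnit_iff_ne_zero]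
  intro h
  have := hG.det_pos
  rw [hB, Matrix.det_mul, h, mul_zero] at this
  exact this.false

/-- Third-order expansion of the logarithm of the determinant at a positive definite matrix. -/
lemma log_det_add {G A : Matrix n n ℝ} (hG : G.PosDef) (hA : A.IsHermitian)
    (h : ((G⁻¹ * A) ^ 2).trace ≤ 1 / 4) :
    (G + A).PosDef ∧ 0 ≤ ((G⁻¹ * A) ^ 2).trace ∧
      |Real.log (G + A).det - Real.log G.det
          - ((G⁻¹ * A).trace - ((G⁻¹ * A) ^ 2).trace / 2 + ((G⁻¹ * A) ^ 3).trace / 3)|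
        ≤ 2 * ((G⁻¹ * A) ^ 2).trace ^ 2 ∧
      |Real.log (G + A).det - Real.log G.det - (G⁻¹ * A).trace|
        ≤ 2 * ((G⁻¹ * A) ^ 2).trace := by
  obtain ⟨B, hBu, rfl⟩ := exists_eq_transpose_mul_self hG
  have hBd : IsUnit B.det := (Matrix.isUnit_iff_isUnit_det B).1 hBu
  have hBtd : IsUnit Bᵀ.det := by rwa [Matrix.det_transpose]
  have hinv : (Bᵀ * B)⁻¹ = B⁻¹ * Bᵀ⁻¹ := Matrix.mul_inv_rev _ _
  -- Reduction to the identity: G + A = Bᵀ (1 + C) B with C symmetric, and G⁻¹ A = B⁻¹ C B is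
  -- similar to C, so the traces of all powers agree.
  set C : Matrix n n ℝ := Bᵀ⁻¹ * A * B⁻¹ with hCdef
  have hCA : C = Bᵀ⁻¹ * (A * B⁻¹) := by rw [hCdef, Matrix.mul_assoc]
  have hM : (Bᵀ * B)⁻¹ * A = B⁻¹ * C * B := by
    rw [hinv, hCdef]
    simp only [Matrix.mul_assoc, Matrix.nonsing_inv_mul B hBd, Matrix.mul_one]
  have hMpow : ∀ k : ℕ, ((Bᵀ * B)⁻¹ * A) ^ k = B⁻¹ * C ^ k * B := by
    intro k
    induction k with
    | zero => simp [Matrix.nonsing_inv_mul B hBd]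
    | succ k ih =>
      rw [pow_succ, ih, hM, pow_succ]
      calc B⁻¹ * C ^ k * B * (B⁻¹ * C * B) = B⁻¹ * C ^ k * (B * B⁻¹) * C * B := by
            simp only [Matrix.mul_assoc]
        _ = _ := by rw [Matrix.mul_nonsing_inv B hBd, Matrix.mul_one, Matrix.mul_assoc B⁻¹]
  have htr : ∀ k : ℕ, (((Bᵀ * B)⁻¹ * A) ^ k).trace = (C ^ k).trace := by
    intro k
    rw [hMpow, Matrix.trace_mul_comm, ← Matrix.mul_assoc, Matrix.mul_nonsing_inv B hBd,
      Matrix.one_mul]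
  have htr1 : ((Bᵀ * B)⁻¹ * A).trace = C.trace := by simpa using htr 1
  have hC : C.IsHermitian := by
    rw [isHermitian_iff_transpose_eq] at hA ⊢
    rw [hCdef, Matrix.transpose_mul, Matrix.transpose_mul, hA, Matrix.transpose_nonsing_inv,
      Matrix.transpose_nonsing_inv, Matrix.transpose_transpose, Matrix.mul_assoc]
  have hadd : Bᵀ * B + A = Bᵀ * (1 + C) * B := by
    have h1 : Bᵀ * C * B = A := by
      rw [hCdef]
      calc Bᵀ * (Bᵀ⁻¹ * A * B⁻¹) * B = (Bᵀ * Bᵀ⁻¹) * A * (B⁻¹ * B) := by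
            simp only [Matrix.mul_assoc]
        _ = A := by
            rw [Matrix.mul_nonsing_inv _ hBtd, Matrix.nonsing_inv_mul _ hBd, Matrix.one_mul,
              Matrix.mul_one]
    rw [Matrix.mul_add, Matrix.add_mul, Matrix.mul_one, h1]
  rw [htr] at h
  obtain ⟨h1, h2, h3, h4⟩ := log_det_one_add hC h
  have hlog : Real.log (Bᵀ * B + A).det - Real.log (Bᵀ * B).det = Real.log (1 + C).det := by
    have e1 : (Bᵀ * B + A).det = (Bᵀ * B).det * (1 + C).det := by
      rw [hadd, Matrix.det_mul, Matrix.det_mul, Matrix.det_mul]; ring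
    rw [e1, Real.log_mul hG.det_pos.ne' h1.det_pos.ne']
    ring
  rw [htr, htr, htr1, hlog]
  refine ⟨?_, h2, h3, h4⟩
  rw [hadd]
  have := h1.conjTranspose_mul_mul_same (B := B) (Matrix.mulVec_injective_iff_isUnit.2 hBu)
  rwa [Matrix.conjTranspose_eq_transpose_of_trivial] at this

end LogDet

/-! ### Algebra of the matrices a + b J -/

section TwoParam

variable {N : ℕ}

/-- The matrix `a + b J` where all entries of `J` are `1`. -/
def twoParam (N : ℕ) (a b : ℝ) : Matrix (Fin N) (Fin N) ℝ :=
  Matrix.of fun i j => (if i = j then a else 0) + b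

lemma twoParam_apply (a b : ℝ) (i j : Fin N) :
    twoParam N a b i j = (if i = j then a else 0) + b := rfl

lemma twoParam_mul (a b c d : ℝ) :
    twoParam N a b * twoParam N c d = twoParam N (a * c) (a * d + b * c + N * (b * d)) := by
  ext i j
  simp only [Matrix.mul_apply, twoParam_apply, add_mul, mul_add, Finset.sum_add_distrib]
  simp
  ring

lemma twoParam_one : twoParam N 1 0 = 1 := by
  ext i j; simp [twoParam_apply, Matrix.one_apply]

lemma smul_twoParam (t a b : ℝ) : t • twoParam N a b = twoParam N (t * a) (t * b) := by
  ext i j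
  simp only [Matrix.smul_apply, twoParam_apply, smul_eq_mul]
  split_ifs <;> ring

lemma twoParam_transpose (a b : ℝ) : (twoParam N a b)ᵀ = twoParam N a b := by
  ext i j; simp [twoParam_apply, eq_comm]

lemma gram_const (γ : ℝ) : gram (fun _ : Pair N => γ) = twoParam N (1 - γ) γ := by
  symm
  refine matrix_ext_pair (fun i j => ?_) (fun i => ?_) fun p => ?_
  · simp [twoParam_apply, eq_comm]
  · simp [twoParam_apply]
  · simp [twoParam_apply, p.2.ne]

lemma sum_sum_twoParam_mul (a b : ℝ) (f : Fin N → Fin N → ℝ) :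
    ∑ i, ∑ j, twoParam N a b i j * f i j = a * ∑ i, f i i + b * ∑ i, ∑ j, f i j := by
  simp [twoParam_apply, add_mul, Finset.sum_add_distrib, Finset.mul_sum]

/-- The form is a ∑ vᵢ² + b (∑ vᵢ)². For b ≥ 0 the second term is harmless; for b < 0 Cauchy–Schwarz
bounds it by the case of a constant vector, where the eigenvalue is a + N b. -/
lemma posDef_twoParam {a b : ℝ} (ha : 0 < a) (hab : 0 < a + N * b) :
    (twoParam N a b).PosDef := by
  refine Matrix.PosDef.of_dotProduct_mulVec_pos
    (isHermitian_iff_transpose_eq.2 (twoParam_transpose a b)) fun v hv => ?_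
  have hsq : 0 < ∑ i, v i ^ 2 := by
    obtain ⟨i, hi⟩ := Function.ne_iff.1 hv
    exact Finset.sum_pos' (fun _ _ => sq_nonneg _)
      ⟨i, Finset.mem_univ i, by have : v i ≠ 0 := hi; positivity⟩
  have hcs : (∑ i, v i) ^ 2 ≤ N * ∑ i, v i ^ 2 := by
    simpa using sq_sum_le_card_mul_sum_sq (s := Finset.univ) (f := v)
  have e : star v ⬝ᵥ (twoParam N a b *ᵥ v) = a * ∑ i, v i ^ 2 + b * (∑ i, v i) ^ 2 := by
    have := sum_sum_twoParam_mul a b fun i j => v i * v j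
    simp only [dotProduct, Matrix.mulVec, Pi.star_apply, star_trivial, Finset.mul_sum] at this ⊢
    rw [sq (∑ i, v i), Finset.sum_mul_sum]
    simp only [Finset.mul_sum]
    rw [← sub_eq_zero] at this ⊢
    rw [← this]
    congr 1
    · exact Finset.sum_congr rfl fun i _ => Finset.sum_congr rfl fun j _ => by ring
    · simp only [sq]
  rw [e]
  rcases le_or_gt 0 b with h | h
  · have := mul_nonneg h (sq_nonneg (∑ i, v i)); have := mul_pos ha hsq; linarith
  · nlinarith [mul_pos hab hsq]

end TwoParam

/-! ### The constants of the large-dimension structure -/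

section Constants

variable {N : ℕ} {l : ℝ}

lemma shift_pos (hN : 1 ≤ N) (hl : 0 < l) : 0 < (N : ℝ) + (l - 1) := by
  have : (1 : ℝ) ≤ N := by exact_mod_cast hN
  linarith

lemma rInf_pos (hN : 1 ≤ N) (hl : 0 < l) : 0 < rInf N l := by
  have : (1 : ℝ) ≤ N := by exact_mod_cast hN
  have := shift_pos hN hl
  exact Real.sqrt_pos.2 (by positivity)

lemma rInf_sq (hN : 1 ≤ N) (hl : 0 < l) : rInf N l ^ 2 = (N + (l - 1)) / (2 * l * N) := by
  have : (1 : ℝ) ≤ N := by exact_mod_cast hN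
  have := shift_pos hN hl
  exact Real.sq_sqrt (by positivity)

lemma one_sub_gammaInf (hN : 1 ≤ N) (hl : 0 < l) : 1 - gammaInf N l = N / (N + (l - 1)) := by
  have := shift_pos hN hl
  rw [gammaInf]; field_simp; ring

lemma one_add_gammaInf (hN : 1 ≤ N) (hl : 0 < l) :
    1 + (N - 1) * gammaInf N l = N * l / (N + (l - 1)) := by
  have := shift_pos hN hl
  rw [gammaInf]; field_simp; ring

/-- The gram matrix of the large-dimension structure. -/
noncomputable def gramInf (N : ℕ) (l : ℝ) : Matrix (Fin N) (Fin N) ℝ :=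
  twoParam N (1 - gammaInf N l) (gammaInf N l)

/-- The coefficient matrix of the ground state. -/
noncomputable def formMatrix (N : ℕ) (l : ℝ) : Matrix (Fin N) (Fin N) ℝ :=
  twoParam N l ((1 - l) / N)

/-- The square root of `formMatrix`. -/
noncomputable def rootMatrix (N : ℕ) (l : ℝ) : Matrix (Fin N) (Fin N) ℝ :=
  twoParam N (√l) ((1 - √l) / N)

lemma rootMatrix_mul_self (hN : 1 ≤ N) (hl : 0 < l) :
    rootMatrix N l * rootMatrix N l = formMatrix N l := by
  have h0 : (N : ℝ) ≠ 0 := by positivity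
  have hs := Real.mul_self_sqrt hl.le
  rw [rootMatrix, twoParam_mul, formMatrix, hs]
  congr 1
  field_simp
  ring_nf
  rw [Real.sq_sqrt hl.le]

lemma rootMatrix_isUnit (hN : 1 ≤ N) (hl : 0 < l) : IsUnit (rootMatrix N l) := by
  have h0 : (N : ℝ) ≠ 0 := by positivity
  have : (rootMatrix N l).PosDef := by
    refine posDef_twoParam (Real.sqrt_pos.2 hl) ?_
    have : √l + N * ((1 - √l) / N) = 1 := by field_simp; ring
    rw [this]; exact one_pos
  exact this.isUnit

lemma gramInf_posDef (hN : 1 ≤ N) (hl : 0 < l) : (gramInf N l).PosDef := by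
  have h1 : (1 : ℝ) ≤ N := by exact_mod_cast hN
  have := shift_pos hN hl
  refine posDef_twoParam ?_ ?_
  · rw [one_sub_gammaInf hN hl]; positivity
  · have e : 1 - gammaInf N l + N * gammaInf N l = 1 + (N - 1) * gammaInf N l := by ring
    rw [e, one_add_gammaInf hN hl]; positivity

/-- The equation S = (2K)⁻¹ for equal radii, where S = r̄∞² G∞. It explains the values of γ∞ and
r̄∞: the first makes G∞ proportional to K⁻¹, the second fixes the factor. -/
lemma gramInf_mul_formMatrix (hN : 1 ≤ N) (hl : 0 < l) :
    gramInf N l * ((2 * rInf N l ^ 2) • formMatrix N l) = 1 := by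
  have h1 : (1 : ℝ) ≤ N := by exact_mod_cast hN
  have := shift_pos hN hl
  rw [gramInf, formMatrix, smul_twoParam, twoParam_mul, ← twoParam_one, one_sub_gammaInf hN hl,
    rInf_sq hN hl, gammaInf]
  congr 1 <;> field_simp <;> ring

lemma gramInf_inv (hN : 1 ≤ N) (hl : 0 < l) :
    (gramInf N l)⁻¹ = (2 * rInf N l ^ 2) • formMatrix N l :=
  Matrix.inv_eq_right_inv (gramInf_mul_formMatrix hN hl)

end Constants

end HarmonicDPT

namespace HarmonicDPT

/-! ### Bounds for homogeneous functions -/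

section Homogeneous

variable {E : Type*} [NormedAddCommGroup E] [NormedSpace ℝ E] [FiniteDimensional ℝ E]

/-- Compactness of the unit sphere gives the constant and homogeneity extends the bound; for y = 0
both sides vanish since k ≠ 0. -/
lemma exists_abs_le_of_homogeneous {f : E → ℝ} (hf : Continuous f) {k : ℕ} (hk : k ≠ 0)
    (hom : ∀ (t : ℝ) (y : E), f (t • y) = t ^ k * f y) :
    ∃ C : ℝ, 0 ≤ C ∧ ∀ y, |f y| ≤ C * ‖y‖ ^ k := by
  have := FiniteDimensional.proper ℝ E
  obtain ⟨C, hC⟩ := (isCompact_sphere (0 : E) 1).exists_bound_of_continuousOn hf.continuousOn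
  refine ⟨max C 0, le_max_right _ _, fun y => ?_⟩
  rcases eq_or_ne y 0 with rfl | hy
  · have := hom 0 0
    rw [zero_smul, zero_pow hk, zero_mul] at this
    simp [this, hk]
  · have hn : ‖y‖ ≠ 0 := norm_ne_zero_iff.2 hy
    have h1 := hC (‖y‖⁻¹ • y) (by simp [norm_smul, hn])
    have h2 := hom ‖y‖ (‖y‖⁻¹ • y)
    rw [smul_smul, mul_inv_cancel₀ hn, one_smul] at h2
    rw [h2, abs_mul, abs_pow, abs_norm, mul_comm]
    gcongr
    exact h1.trans (le_max_left _ _)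

lemma exists_le_of_homogeneous_of_pos {f : E → ℝ} (hf : Continuous f) {k : ℕ} (hk : k ≠ 0)
    (hom : ∀ (t : ℝ) (y : E), f (t • y) = t ^ k * f y) (hpos : ∀ y ≠ 0, 0 < f y) :
    ∃ c : ℝ, 0 < c ∧ ∀ y, c * ‖y‖ ^ k ≤ f y := by
  have := FiniteDimensional.proper ℝ E
  have hsph : ∃ c : ℝ, 0 < c ∧ ∀ y ∈ Metric.sphere (0 : E) 1, c ≤ f y := by
    rcases (Metric.sphere (0 : E) 1).eq_empty_or_nonempty with he | hne
    -- In the trivial space the sphere is empty and any positive constant serves.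
    · exact ⟨1, one_pos, fun y hy => by simp [he] at hy⟩
    · obtain ⟨y₀, hy₀, hmin⟩ := (isCompact_sphere (0 : E) 1).exists_isMinOn hne hf.continuousOn
      exact ⟨f y₀, hpos _ (ne_zero_of_mem_unit_sphere ⟨y₀, hy₀⟩), fun y hy => hmin hy⟩
  obtain ⟨c, hc, h⟩ := hsph
  refine ⟨c, hc, fun y => ?_⟩
  rcases eq_or_ne y 0 with rfl | hy
  · have := hom 0 0
    rw [zero_smul, zero_pow hk, zero_mul] at this
    simp [this, hk]
  · have hn : ‖y‖ ≠ 0 := norm_ne_zero_iff.2 hy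
    have h1 := h (‖y‖⁻¹ • y) (by simp [norm_smul, hn])
    have h2 := hom ‖y‖ (‖y‖⁻¹ • y)
    rw [smul_smul, mul_inv_cancel₀ hn, one_smul] at h2
    rw [h2, mul_comm]
    gcongr

end Homogeneous

/-! ### Symmetric matrices with zero diagonal -/

section OffDiag

variable {N : ℕ}

/-- The symmetric matrix with vanishing diagonal and given off-diagonal entries. -/
noncomputable def offDiag (γ : Pair N → ℝ) : Matrix (Fin N) (Fin N) ℝ := gram γ - 1

lemma offDiag_self (γ : Pair N → ℝ) (i : Fin N) : offDiag γ i i = 0 := by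
  simp [offDiag, gram_self]

lemma offDiag_pair (γ : Pair N → ℝ) (p : Pair N) : offDiag γ p.1.1 p.1.2 = γ p := by
  simp [offDiag, gram_pair, p.2.ne]

lemma offDiag_pair' (γ : Pair N → ℝ) (p : Pair N) : offDiag γ p.1.2 p.1.1 = γ p := by
  simp [offDiag, gram_pair', p.2.ne']

lemma offDiag_comm (γ : Pair N → ℝ) (i j : Fin N) : offDiag γ i j = offDiag γ j i := by
  simp [offDiag, gram_comm γ i j, Matrix.one_apply, eq_comm]

lemma offDiag_isHermitian (γ : Pair N → ℝ) : (offDiag γ).IsHermitian :=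
  (gram_isHermitian γ).sub Matrix.isHermitian_one

lemma offDiag_ext {M : Matrix (Fin N) (Fin N) ℝ} {γ : Pair N → ℝ} (hs : ∀ i j, M i j = M j i)
    (hd : ∀ i, M i i = 0) (hp : ∀ p : Pair N, M p.1.1 p.1.2 = γ p) : M = offDiag γ := by
  rw [offDiag, eq_sub_iff_add_eq]
  refine matrix_ext_pair (fun i j => ?_) (fun i => ?_) fun p => ?_
  · simp [hs i j, Matrix.one_apply, eq_comm]
  · simp [hd]
  · simp [hp, p.2.ne]

lemma offDiag_add (γ γ' : Pair N → ℝ) : offDiag (γ + γ') = offDiag γ + offDiag γ' := by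
  symm
  refine offDiag_ext (fun i j => ?_) (fun i => ?_) fun p => ?_
  · simp [offDiag_comm γ i j, offDiag_comm γ' i j]
  · simp [offDiag_self]
  · simp [offDiag_pair]

lemma offDiag_smul (t : ℝ) (γ : Pair N → ℝ) : offDiag (t • γ) = t • offDiag γ := by
  symm
  refine offDiag_ext (fun i j => ?_) (fun i => ?_) fun p => ?_
  · simp [offDiag_comm γ i j]
  · simp [offDiag_self]
  · simp [offDiag_pair]

lemma gram_add (γ γ' : Pair N → ℝ) : gram (γ + γ') = gram γ + offDiag γ' := by
  have := offDiag_add γ γ'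
  simp only [offDiag] at this ⊢
  rw [sub_eq_iff_eq_add] at this
  rw [this]; abel

lemma continuous_offDiag : Continuous (offDiag : (Pair N → ℝ) → Matrix (Fin N) (Fin N) ℝ) :=
  continuous_gram.sub continuous_const

lemma sum_sum_mul_offDiag (γ : Pair N → ℝ) (F : Fin N → Fin N → ℝ) :
    ∑ i, ∑ j, F i j * offDiag γ i j = ∑ p : Pair N, (F p.1.1 p.1.2 + F p.1.2 p.1.1) * γ p := by
  rw [sum_sum_eq_diag_add_pair]
  simp [offDiag_self, offDiag_pair, offDiag_pair', add_mul]

end OffDiag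

/-! ### Taylor expansion of the exponent about the large-dimension structure -/

section Forms

variable {N : ℕ}

/-- The large-dimension structure. -/
noncomputable def center (N : ℕ) (l : ℝ) : Internal N := (fun _ => rInf N l, fun _ => gammaInf N l)

/-- The part of the logarithm of the wavefunction proportional to the dimension. -/
noncomputable def phase (l : ℝ) (q : Internal N) : ℝ :=
  1 / 4 * Real.log (gram q.2).det + 1 / 2 * ∑ i, Real.log (q.1 i) - 1 / 2 * internalForm l q

/-- The part of the logarithm of the wavefunction independent of the dimension, up to sign. -/
noncomputable def weight (q : Internal N) : ℝ :=
  (N + 1) / 4 * Real.log (gram q.2).det + 1 / 2 * ∑ i, Real.log (q.1 i)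

/-- The frequency is taken to be D, which is the effect of the dimensional scaling. The exponents (D
- N - 1)/4, (D - 1)/2 and D/2 are then affine in D; `phase` collects the slopes and `weight` the
constants. -/
lemma wave_eq_exp (l : ℝ) (D : ℕ) {q : Internal N} (hq : q ∈ domain N) :
    wave l D D q = Real.exp (D * phase l q - weight q) := by
  have hp : ∏ j, q.1 j ^ (((D : ℝ) - 1) / 2)
      = Real.exp (((D : ℝ) - 1) / 2 * ∑ j, Real.log (q.1 j)) := by
    rw [Finset.mul_sum, Real.exp_sum]
    refine Finset.prod_congr rfl fun j _ => ?_
    rw [Real.rpow_def_of_pos (hq.1 j), mul_comm]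
  rw [wave, sqrtJacobian, hp, Real.rpow_def_of_pos hq.2.det_pos, ← Real.exp_add, ← Real.exp_add]
  congr 1
  rw [phase, weight]
  ring

/-- The first-order variation of the matrix of angle cosines, relative to its value at the
large-dimension structure. -/
noncomputable def relOffDiag (N : ℕ) (l : ℝ) (y : Internal N) : Matrix (Fin N) (Fin N) ℝ :=
  (gramInf N l)⁻¹ * offDiag y.2

/-- The quadratic form in the exponent of the leading-order wavefunction. -/
noncomputable def quadForm (N : ℕ) (l : ℝ) (y : Internal N) : ℝ :=
  1 / 8 * (relOffDiag N l y ^ 2).trace + 1 / (4 * rInf N l ^ 2) * ∑ i, y.1 i ^ 2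
    + 1 / 2 * (l * ∑ i, y.1 i ^ 2 + (1 - l) / N * (∑ i, ∑ j, y.1 i * gramInf N l i j * y.1 j
      + 2 * rInf N l * ∑ i, ∑ j, y.1 i * offDiag y.2 i j))

/-- The cubic form of the first-order correction. -/
noncomputable def cubicForm (N : ℕ) (l : ℝ) (y : Internal N) : ℝ :=
  1 / 12 * (relOffDiag N l y ^ 3).trace + 1 / (6 * rInf N l ^ 3) * ∑ i, y.1 i ^ 3
    - 1 / 2 * ((1 - l) / N * ∑ i, ∑ j, y.1 i * offDiag y.2 i j * y.1 j)

/-- The linear form of the first-order correction, up to sign. -/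
noncomputable def linForm (N : ℕ) (l : ℝ) (y : Internal N) : ℝ :=
  (N + 1) / 4 * (relOffDiag N l y).trace + 1 / (2 * rInf N l) * ∑ i, y.1 i

lemma relOffDiag_smul (l t : ℝ) (y : Internal N) :
    relOffDiag N l (t • y) = t • relOffDiag N l y := by
  rw [relOffDiag, relOffDiag, Prod.smul_snd, offDiag_smul, Matrix.mul_smul]

lemma continuous_relOffDiag (l : ℝ) : Continuous (relOffDiag N l) :=
  continuous_const.matrix_mul (continuous_offDiag.comp continuous_snd)

lemma quadForm_smul (l t : ℝ) (y : Internal N) : quadForm N l (t • y) = t ^ 2 * quadForm N l y := by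
  have e : ∀ i, (t • y).1 i = t * y.1 i := fun i => rfl
  have e2 : (t • y).2 = t • y.2 := rfl
  simp only [quadForm, relOffDiag_smul, e, e2, offDiag_smul, smul_pow, Matrix.trace_smul,
    Matrix.smul_apply, smul_eq_mul, mul_pow, ← Finset.mul_sum]
  have h1 : ∑ i, ∑ j, t * y.1 i * gramInf N l i j * (t * y.1 j)
      = t ^ 2 * ∑ i, ∑ j, y.1 i * gramInf N l i j * y.1 j := by
    simp only [Finset.mul_sum]
    exact Finset.sum_congr rfl fun i _ => Finset.sum_congr rfl fun j _ => by ring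
  have h2 : ∑ i, t * y.1 i * (t * ∑ j, offDiag y.2 i j)
      = t ^ 2 * ∑ i, y.1 i * ∑ j, offDiag y.2 i j := by
    simp only [Finset.mul_sum]
    exact Finset.sum_congr rfl fun i _ => Finset.sum_congr rfl fun j _ => by ring
  rw [h1, h2]
  ring

lemma cubicForm_smul (l t : ℝ) (y : Internal N) :
    cubicForm N l (t • y) = t ^ 3 * cubicForm N l y := by
  have e : ∀ i, (t • y).1 i = t * y.1 i := fun i => rfl
  have e2 : (t • y).2 = t • y.2 := rfl
  simp only [cubicForm, relOffDiag_smul, e, e2, offDiag_smul, smul_pow, Matrix.trace_smul,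
    Matrix.smul_apply, smul_eq_mul, mul_pow, ← Finset.mul_sum]
  have h1 : ∑ i, ∑ j, t * y.1 i * (t * offDiag y.2 i j) * (t * y.1 j)
      = t ^ 3 * ∑ i, ∑ j, y.1 i * offDiag y.2 i j * y.1 j := by
    simp only [Finset.mul_sum]
    exact Finset.sum_congr rfl fun i _ => Finset.sum_congr rfl fun j _ => by ring
  rw [h1]
  ring

lemma linForm_smul (l t : ℝ) (y : Internal N) : linForm N l (t • y) = t * linForm N l y := by
  have e : ∀ i, (t • y).1 i = t * y.1 i := fun i => rfl
  simp only [linForm, relOffDiag_smul, e, Matrix.trace_smul, smul_eq_mul, ← Finset.mul_sum]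
  ring

lemma continuous_quadForm (l : ℝ) : Continuous (quadForm N l) := by
  have h1 : Continuous fun y : Internal N => (relOffDiag N l y ^ 2).trace :=
    ((continuous_relOffDiag l).pow 2).matrix_trace
  have h2 := fun i j => (continuous_offDiag (N := N)).matrix_elem i j
  unfold quadForm
  fun_prop

lemma continuous_cubicForm (l : ℝ) : Continuous (cubicForm N l) := by
  have h1 : Continuous fun y : Internal N => (relOffDiag N l y ^ 3).trace :=
    ((continuous_relOffDiag l).pow 3).matrix_trace
  have h2 := fun i j => (continuous_offDiag (N := N)).matrix_elem i j
  unfold cubicForm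
  fun_prop

lemma continuous_linForm (l : ℝ) : Continuous (linForm N l) := by
  have h1 : Continuous fun y : Internal N => (relOffDiag N l y).trace :=
    (continuous_relOffDiag l).matrix_trace
  unfold linForm
  fun_prop

variable {l : ℝ}

lemma relOffDiag_eq (hN : 1 ≤ N) (hl : 0 < l) (y : Internal N) :
    relOffDiag N l y = (2 * rInf N l ^ 2) • (formMatrix N l * offDiag y.2) := by
  rw [relOffDiag, gramInf_inv hN hl, Matrix.smul_mul]

lemma trace_relOffDiag (hN : 1 ≤ N) (hl : 0 < l) (y : Internal N) :
    (relOffDiag N l y).trace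
      = 2 * rInf N l ^ 2 * ((1 - l) / N * ∑ i, ∑ j, offDiag y.2 i j) := by
  rw [relOffDiag_eq hN hl, Matrix.trace_smul, smul_eq_mul]
  congr 1
  have := sum_sum_twoParam_mul l ((1 - l) / N) fun i j => offDiag y.2 i j
  simp only [offDiag_self, Finset.sum_const_zero, mul_zero, zero_add] at this
  rw [← this]
  simp only [Matrix.trace, Matrix.diag, Matrix.mul_apply, formMatrix]
  exact Finset.sum_congr rfl fun i _ => Finset.sum_congr rfl fun j _ => by
    rw [offDiag_comm y.2 j i]

/-- The form is a polynomial of degree three in radii and cosines together, so the expansion is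
exact. Its linear part is written in the terms in which log det and log rᵢ are expanded, so that it
visibly cancels against theirs in `phase`. -/
lemma internalForm_center_add (hN : 1 ≤ N) (hl : 0 < l) (h : Internal N) :
    internalForm l (center N l + h) - internalForm l (center N l)
      = (1 / rInf N l * ∑ i, h.1 i + 1 / 2 * (relOffDiag N l h).trace)
        + (l * ∑ i, h.1 i ^ 2 + (1 - l) / N * (∑ i, ∑ j, h.1 i * gramInf N l i j * h.1 j
          + 2 * rInf N l * ∑ i, ∑ j, h.1 i * offDiag h.2 i j))
        + (1 - l) / N * ∑ i, ∑ j, h.1 i * offDiag h.2 i j * h.1 j := by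
  have hg : gram (center N l + h).2 = gramInf N l + offDiag h.2 := by
    rw [Prod.snd_add, gram_add]; congr 1; exact gram_const _
  have hg0 : gram (center N l).2 = gramInf N l := gram_const _
  have e : ∀ i, (center N l + h).1 i = rInf N l + h.1 i := fun i => rfl
  have e0 : ∀ i, (center N l).1 i = rInf N l := fun i => rfl
  set ρ := rInf N l with hρ
  have hρ0 : ρ ≠ 0 := (rInf_pos hN hl).ne'
  -- Every row of G∞ sums to 1 + (N - 1) γ∞ = 1 / (2ρ²).
  have hG : ∑ i, ∑ j, h.1 i * gramInf N l i j = (1 / (2 * ρ ^ 2)) * ∑ i, h.1 i := by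
    have h1 : ∀ i, ∑ j, gramInf N l i j = 1 / (2 * ρ ^ 2) := by
      intro i
      have := shift_pos hN hl
      have : (0 : ℝ) < N := by positivity
      rw [hρ, rInf_sq hN hl]
      simp only [gramInf, twoParam_apply, Finset.sum_add_distrib]
      simp
      have e := one_add_gammaInf hN hl
      rw [show 1 - gammaInf N l + N * gammaInf N l = 1 + (N - 1) * gammaInf N l by ring, e]
      field_simp
    simp only [← Finset.mul_sum, h1]
    rw [← Finset.sum_mul, mul_comm]
  have hG' : ∑ i, ∑ j, h.1 j * gramInf N l i j = (1 / (2 * ρ ^ 2)) * ∑ i, h.1 i := by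
    rw [← hG, Finset.sum_comm]
    refine Finset.sum_congr rfl fun i _ => Finset.sum_congr rfl fun j _ => ?_
    rw [← hg0, gram_comm]
  have hA' : ∑ i, ∑ j, h.1 j * offDiag h.2 i j = ∑ i, ∑ j, h.1 i * offDiag h.2 i j := by
    rw [Finset.sum_comm]
    refine Finset.sum_congr rfl fun i _ => Finset.sum_congr rfl fun j _ => ?_
    rw [offDiag_comm]
  have hmain : ∑ i, ∑ j, innerMatrix (center N l + h) i j
      = ∑ i, ∑ j, innerMatrix (center N l) i j
        + ρ * (∑ i, ∑ j, h.1 i * gramInf N l i j + ∑ i, ∑ j, h.1 j * gramInf N l i j)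
        + ρ ^ 2 * ∑ i, ∑ j, offDiag h.2 i j + ∑ i, ∑ j, h.1 i * gramInf N l i j * h.1 j
        + ρ * (∑ i, ∑ j, h.1 i * offDiag h.2 i j + ∑ i, ∑ j, h.1 j * offDiag h.2 i j)
        + ∑ i, ∑ j, h.1 i * offDiag h.2 i j * h.1 j := by
    simp only [Finset.mul_sum, ← Finset.sum_add_distrib]
    refine Finset.sum_congr rfl fun i _ => Finset.sum_congr rfl fun j _ => ?_
    simp only [innerMatrix_apply, hg, hg0, e, e0, Matrix.add_apply]
    ring
  have hsq : ∑ i, (center N l + h).1 i ^ 2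
      = ∑ i, (center N l).1 i ^ 2 + 2 * ρ * ∑ i, h.1 i + ∑ i, h.1 i ^ 2 := by
    simp only [Finset.mul_sum, ← Finset.sum_add_distrib]
    refine Finset.sum_congr rfl fun i _ => ?_
    rw [e, e0]; ring
  rw [internalForm, internalForm, hmain, hsq, trace_relOffDiag hN hl, hG, hG', hA', ← hρ]
  have hlin : 2 * l * ρ + (1 - l) / N * (ρ * (1 / (2 * ρ ^ 2) + 1 / (2 * ρ ^ 2))) = 1 / ρ := by
    have hN' : (N : ℝ) ≠ 0 := by positivity
    have h2 := rInf_sq hN hl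
    rw [← hρ] at h2
    have h3 := shift_pos hN hl
    have h4 : 2 * l * N * ρ ^ 2 = N + (l - 1) := by rw [h2]; field_simp
    field_simp
    linarith
  rw [← hlin]
  ring

/-- Expansion of the exponent about the large-dimension structure. -/
lemma exists_expansion (hN : 1 ≤ N) (hl : 0 < l) :
    ∃ C ε : ℝ, 0 < C ∧ 0 < ε ∧ ∀ h : Internal N, ‖h‖ ≤ ε → center N l + h ∈ domain N ∧
      |phase l (center N l + h) - phase l (center N l) - (-quadForm N l h + cubicForm N l h)|
        ≤ C * ‖h‖ ^ 4 ∧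
      |weight (center N l + h) - weight (center N l) - linForm N l h| ≤ C * ‖h‖ ^ 2 := by
  obtain ⟨C₁, hC₁, hb⟩ := exists_abs_le_of_homogeneous
    (f := fun y : Internal N => (relOffDiag N l y ^ 2).trace)
    ((continuous_relOffDiag l).pow 2).matrix_trace two_ne_zero
    (fun t y => by rw [relOffDiag_smul, smul_pow, Matrix.trace_smul, smul_eq_mul])
  have hρ := rInf_pos hN hl
  set ρ := rInf N l with hρdef
  -- The first bound gives |hᵢ / ρ| ≤ 1/2 for the scalar logarithms, the second tr((V A)²) ≤ 1/4 for
  -- the logarithm of the determinant.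
  set ε : ℝ := min (ρ / 2) (1 / (2 * (C₁ + 1))) with hεdef
  have hε : 0 < ε := by positivity
  -- The first two summands serve the estimate of `phase`, the bracket that of `weight`.
  set C : ℝ := C₁ ^ 2 + N * (1 / ρ ^ 4) + ((N + 1) * C₁ + N * (1 / ρ ^ 2)) + 1 with hCdef
  refine ⟨C, ε, by positivity, hε, fun h hh => ?_⟩
  have hg : gram (center N l + h).2 = gramInf N l + offDiag h.2 := by
    rw [Prod.snd_add, gram_add]; congr 1; exact gram_const _
  have hg0 : gram (center N l).2 = gramInf N l := gram_const _
  have e : ∀ i, (center N l + h).1 i = ρ + h.1 i := fun i => rfl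
  have e0 : ∀ i, (center N l).1 i = ρ := fun i => rfl
  have hhi : ∀ i, |h.1 i| ≤ ‖h‖ := fun i => (norm_le_pi_norm h.1 i).trans (norm_fst_le h)
  have hh1 : ‖h‖ ≤ ρ / 2 := hh.trans (min_le_left _ _)
  have hh2 : ‖h‖ ≤ 1 / (2 * (C₁ + 1)) := hh.trans (min_le_right _ _)
  have htr : (relOffDiag N l h ^ 2).trace ≤ C₁ * ‖h‖ ^ 2 := (le_abs_self _).trans (hb h)
  have htr4 : (relOffDiag N l h ^ 2).trace ≤ 1 / 4 := by
    refine htr.trans ?_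
    calc C₁ * ‖h‖ ^ 2 ≤ (C₁ + 1) ^ 2 * (1 / (2 * (C₁ + 1))) ^ 2 := by
          gcongr
          nlinarith
      _ = 1 / 4 := by field_simp; norm_num
  obtain ⟨hpd, htr0, hld4, hld2⟩ := log_det_add (gramInf_posDef hN hl)
    (offDiag_isHermitian h.2) htr4
  rw [← relOffDiag, ← hg, ← hg0] at *
  have hx : ∀ i, |h.1 i / ρ| ≤ 1 / 2 := by
    intro i
    rw [abs_div, abs_of_pos hρ, div_le_iff₀ hρ]
    linarith [hhi i]
  have hrpos : ∀ i, 0 < ρ + h.1 i := fun i => by linarith [(abs_le.1 (hhi i)).1]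
  have hlog : ∀ i, Real.log (ρ + h.1 i) - Real.log ρ = Real.log (1 + h.1 i / ρ) := by
    intro i
    rw [← Real.log_div (hrpos i).ne' hρ.ne']
    congr 1; field_simp
  have hpowle : ∀ (i : Fin N) (k : ℕ), |h.1 i / ρ| ^ k ≤ ‖h‖ ^ k * (1 / ρ ^ k) := by
    intro i k
    rw [abs_div, abs_of_pos hρ, div_pow, div_eq_mul_one_div]
    gcongr
    exact hhi i
  have hlog4 : |∑ i, Real.log (ρ + h.1 i) - ∑ _i : Fin N, Real.log ρ
      - (1 / ρ * ∑ i, h.1 i - 1 / (2 * ρ ^ 2) * ∑ i, h.1 i ^ 2 + 1 / (3 * ρ ^ 3) * ∑ i, h.1 i ^ 3)|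
      ≤ 2 * (N * (‖h‖ ^ 4 * (1 / ρ ^ 4))) := by
    have e1 : ∑ i, Real.log (ρ + h.1 i) - ∑ _i : Fin N, Real.log ρ
      - (1 / ρ * ∑ i, h.1 i - 1 / (2 * ρ ^ 2) * ∑ i, h.1 i ^ 2 + 1 / (3 * ρ ^ 3) * ∑ i, h.1 i ^ 3)
      = ∑ i, (Real.log (1 + h.1 i / ρ)
        - (h.1 i / ρ - (h.1 i / ρ) ^ 2 / 2 + (h.1 i / ρ) ^ 3 / 3)) := by
      simp only [Finset.mul_sum, ← Finset.sum_sub_distrib, ← Finset.sum_add_distrib]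
      refine Finset.sum_congr rfl fun i _ => ?_
      rw [hlog]; field_simp
    rw [e1]
    refine (Finset.abs_sum_le_sum_abs _ _).trans ?_
    calc _ ≤ ∑ _i : Fin N, 2 * (‖h‖ ^ 4 * (1 / ρ ^ 4)) := by
          refine Finset.sum_le_sum fun i _ => (abs_log_one_add_sub_le (hx i)).trans ?_
          have := hpowle i 4
          rw [show |h.1 i / ρ| ^ 4 = (h.1 i / ρ) ^ 4 by
            rw [show (4 : ℕ) = 2 * 2 from rfl, pow_mul, pow_mul, sq_abs]] at this
          linarith
      _ = _ := by simp; ring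
  have hlog2 : |∑ i, Real.log (ρ + h.1 i) - ∑ _i : Fin N, Real.log ρ - 1 / ρ * ∑ i, h.1 i|
      ≤ 2 * (N * (‖h‖ ^ 2 * (1 / ρ ^ 2))) := by
    have e1 : ∑ i, Real.log (ρ + h.1 i) - ∑ _i : Fin N, Real.log ρ - 1 / ρ * ∑ i, h.1 i
      = ∑ i, (Real.log (1 + h.1 i / ρ) - h.1 i / ρ) := by
      simp only [Finset.mul_sum, ← Finset.sum_sub_distrib]
      refine Finset.sum_congr rfl fun i _ => ?_
      rw [hlog]; field_simp
    rw [e1]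
    refine (Finset.abs_sum_le_sum_abs _ _).trans ?_
    calc _ ≤ ∑ _i : Fin N, 2 * (‖h‖ ^ 2 * (1 / ρ ^ 2)) := by
          refine Finset.sum_le_sum fun i _ => (abs_log_one_add_sub_self_le (hx i)).trans ?_
          have := hpowle i 2
          rw [sq_abs] at this
          linarith
      _ = _ := by simp; ring
  refine ⟨⟨hrpos, hpd⟩, ?_, ?_⟩
  · have hpot := internalForm_center_add hN hl h
    set tr1 := (relOffDiag N l h).trace
    set tr2 := (relOffDiag N l h ^ 2).trace
    set tr3 := (relOffDiag N l h ^ 3).trace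
    set X := Real.log (gram (center N l + h).2).det - Real.log (gram (center N l).2).det
      - (tr1 - tr2 / 2 + tr3 / 3)
    set Y := ∑ i, Real.log (ρ + h.1 i) - ∑ _i : Fin N, Real.log ρ
      - (1 / ρ * ∑ i, h.1 i - 1 / (2 * ρ ^ 2) * ∑ i, h.1 i ^ 2 + 1 / (3 * ρ ^ 3) * ∑ i, h.1 i ^ 3)
    -- All terms of first order cancel: the centre is a critical point. Only the remainders of log
    -- det and of the scalar logarithms are left.
    have key : phase l (center N l + h) - phase l (center N l)
        - (-quadForm N l h + cubicForm N l h) = 1 / 4 * X + 1 / 2 * Y := by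
      have : phase l (center N l + h) - phase l (center N l)
        = 1 / 4 * (Real.log (gram (center N l + h).2).det - Real.log (gram (center N l).2).det)
          + 1 / 2 * (∑ i, Real.log (ρ + h.1 i) - ∑ _i : Fin N, Real.log ρ)
          - 1 / 2 * (internalForm l (center N l + h) - internalForm l (center N l)) := by
        simp only [phase, e, e0]; ring
      rw [this, hpot, quadForm, cubicForm]
      simp only [X, Y, tr1, tr2, tr3, ← hρdef]
      field_simp
      ring
    rw [key]
    calc |1 / 4 * X + 1 / 2 * Y| ≤ |1 / 4 * X| + |1 / 2 * Y| := abs_add_le _ _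
      _ = 1 / 4 * |X| + 1 / 2 * |Y| := by simp [abs_mul]
      _ ≤ 1 / 4 * (2 * (C₁ * ‖h‖ ^ 2) ^ 2) + 1 / 2 * (2 * (N * (‖h‖ ^ 4 * (1 / ρ ^ 4)))) := by
          have := hld4.trans (mul_le_mul_of_nonneg_left (pow_le_pow_left₀ htr0 htr 2) zero_le_two)
          gcongr
      _ = (1 / 2 * C₁ ^ 2 + N * (1 / ρ ^ 4)) * ‖h‖ ^ 4 := by ring
      _ ≤ C * ‖h‖ ^ 4 := by
          gcongr
          rw [hCdef]
          have : 0 ≤ (N + 1) * C₁ + N * (1 / ρ ^ 2) := by positivity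
          nlinarith [sq_nonneg C₁]
  · set tr1 := (relOffDiag N l h).trace
    set X := Real.log (gram (center N l + h).2).det - Real.log (gram (center N l).2).det - tr1
    set Y := ∑ i, Real.log (ρ + h.1 i) - ∑ _i : Fin N, Real.log ρ - 1 / ρ * ∑ i, h.1 i
    have key : weight (center N l + h) - weight (center N l) - linForm N l h
        = (N + 1) / 4 * X + 1 / 2 * Y := by
      simp only [weight, e, e0, linForm, X, Y, tr1, ← hρdef]
      field_simp
      ring
    rw [key]
    calc |((N : ℝ) + 1) / 4 * X + 1 / 2 * Y| ≤ |((N : ℝ) + 1) / 4 * X| + |1 / 2 * Y| :=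
          abs_add_le _ _
      _ = (N + 1) / 4 * |X| + 1 / 2 * |Y| := by
          rw [abs_mul, abs_mul, abs_of_pos (by positivity : (0 : ℝ) < (N + 1) / 4),
            abs_of_pos (by norm_num : (0 : ℝ) < 1 / 2)]
      _ ≤ (N + 1) / 4 * (2 * (C₁ * ‖h‖ ^ 2)) + 1 / 2 * (2 * (N * (‖h‖ ^ 2 * (1 / ρ ^ 2)))) := by
          have := hld2.trans (mul_le_mul_of_nonneg_left htr zero_le_two)
          gcongr
      _ = ((N + 1) / 2 * C₁ + N * (1 / ρ ^ 2)) * ‖h‖ ^ 2 := by ring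
      _ ≤ C * ‖h‖ ^ 2 := by
          gcongr
          rw [hCdef]
          have : 0 ≤ C₁ ^ 2 + N * (1 / ρ ^ 4) := by positivity
          have : 0 ≤ ((N : ℝ) + 1) * C₁ := by positivity
          nlinarith

end Forms

end HarmonicDPT

namespace HarmonicDPT

/-! ### Positive definiteness of the quadratic form -/

section Positivity

variable {N : ℕ} {l : ℝ}

/-- The first-order variation of the matrix of inner products at the large-dimension structure. -/
noncomputable def innerVariation (N : ℕ) (l : ℝ) (y : Internal N) : Matrix (Fin N) (Fin N) ℝ :=
  rInf N l ^ 2 • offDiag y.2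
    + rInf N l • (Matrix.diagonal y.1 * gramInf N l + gramInf N l * Matrix.diagonal y.1)

lemma innerVariation_add (y z : Internal N) :
    innerVariation N l (y + z) = innerVariation N l y + innerVariation N l z := by
  have : Matrix.diagonal (y + z).1 = Matrix.diagonal y.1 + Matrix.diagonal z.1 := by
    rw [Matrix.diagonal_add]; rfl
  rw [innerVariation, Prod.snd_add, offDiag_add, this]
  simp only [innerVariation, Matrix.add_mul, Matrix.mul_add, smul_add]
  abel

lemma innerVariation_smul (t : ℝ) (y : Internal N) :
    innerVariation N l (t • y) = t • innerVariation N l y := by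
  have : Matrix.diagonal (t • y).1 = t • Matrix.diagonal y.1 := by
    rw [← Matrix.diagonal_smul]; rfl
  rw [innerVariation, Prod.smul_snd, offDiag_smul, this]
  simp only [innerVariation, Matrix.smul_mul, Matrix.mul_smul, smul_add]
  rw [smul_comm t (rInf N l ^ 2), smul_comm t (rInf N l), smul_comm t (rInf N l)]

lemma innerVariation_transpose (y : Internal N) :
    (innerVariation N l y)ᵀ = innerVariation N l y := by
  have hA := isHermitian_iff_transpose_eq.1 (offDiag_isHermitian y.2)
  simp only [innerVariation, Matrix.transpose_add, Matrix.transpose_smul, Matrix.transpose_mul,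
    Matrix.diagonal_transpose, hA, gramInf, twoParam_transpose]
  rw [add_comm (twoParam _ _ _ * _)]

/-- The diagonal entries of the variation are 2 r̄∞ times the radial displacements; once these
vanish, the off-diagonal entries are r̄∞² times the angular ones. -/
lemma eq_zero_of_innerVariation_eq_zero (hN : 1 ≤ N) (hl : 0 < l) {y : Internal N}
    (h : innerVariation N l y = 0) : y = 0 := by
  have hρ := rInf_pos hN hl
  have h1 : y.1 = 0 := by
    funext i
    have := congrFun (congrFun h i) i
    simp [innerVariation, offDiag_self, gramInf, twoParam_apply, hρ.ne'] at this
    simpa using this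
  have h2 : y.2 = 0 := by
    funext p
    have := congrFun (congrFun h p.1.1) p.1.2
    simpa [innerVariation, h1, offDiag_pair, hρ.ne'] using this
  exact Prod.ext h1 h2

/-- Since log det X - tr X is critical at X = 1, the second order of `phase` depends on S only
through its first variation δS and equals -½ tr((K δS)²). The proof expands this trace with K = V /
(2ρ²), V the inverse of G∞, and compares term by term. -/
lemma quadForm_eq_trace (hN : 1 ≤ N) (hl : 0 < l) (y : Internal N) :
    quadForm N l y = 1 / 2 * ((formMatrix N l * innerVariation N l y) ^ 2).trace := by
  have hρ := rInf_pos hN hl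
  set ρ := rInf N l with hρdef
  set G := gramInf N l with hGdef
  set V := (gramInf N l)⁻¹ with hVdef
  set A := offDiag y.2 with hAdef
  set Y := Matrix.diagonal y.1 with hYdef
  have hA : Aᵀ = A := isHermitian_iff_transpose_eq.1 (offDiag_isHermitian y.2)
  have hG : Gᵀ = G := twoParam_transpose _ _
  have hY : Yᵀ = Y := Matrix.diagonal_transpose _
  have hV : Vᵀ = V := by rw [hVdef, Matrix.transpose_nonsing_inv, ← hGdef, hG]
  have hdet : IsUnit G.det := (Matrix.isUnit_iff_isUnit_det _).1 (gramInf_posDef hN hl).isUnit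
  have hVG : V * G = 1 := Matrix.nonsing_inv_mul _ hdet
  have hGV : G * V = 1 := Matrix.mul_nonsing_inv _ hdet
  have hVK : V = (2 * ρ ^ 2) • formMatrix N l := gramInf_inv hN hl
  have hK : formMatrix N l = (1 / (2 * ρ ^ 2)) • V := by
    rw [hVK, smul_smul, one_div, inv_mul_cancel₀ (by positivity), one_smul]
  have hprod : formMatrix N l * innerVariation N l y
      = (1 / 2 : ℝ) • (V * A + ρ⁻¹ • (V * Y * G + Y)) := by
    rw [hK, innerVariation, Matrix.smul_mul, Matrix.mul_add, Matrix.mul_smul, Matrix.mul_smul,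
      Matrix.mul_add, ← hGdef, ← hAdef, ← hYdef, ← hρdef, ← Matrix.mul_assoc V Y,
      ← Matrix.mul_assoc V G, hVG, Matrix.one_mul]
    have s1 : 1 / (2 * ρ ^ 2) * ρ ^ 2 = 1 / 2 := by field_simp
    have s2 : 1 / (2 * ρ ^ 2) * ρ = 1 / 2 * ρ⁻¹ := by field_simp
    simp only [smul_add, smul_smul, s1, s2]
  have hsq : ((V * A + ρ⁻¹ • (V * Y * G + Y)) ^ 2).trace
      = ((V * A) ^ 2).trace + ρ⁻¹ * (4 * (Y * V * A).trace)
        + ρ⁻¹ ^ 2 * (2 * (Y * Y).trace + 2 * (V * Y * G * Y).trace) := by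
    have c1 : (V * A * (V * Y * G)).trace = (Y * V * A).trace := by
      rw [Matrix.trace_mul_comm, show V * Y * G * (V * A) = V * Y * (G * V) * A by
        simp only [Matrix.mul_assoc], hGV, Matrix.mul_one, ← Matrix.trace_transpose]
      simp only [Matrix.transpose_mul, hA, hY, hV]
      rw [Matrix.trace_mul_comm, Matrix.mul_assoc, ]
    have c2 : (V * A * Y).trace = (Y * V * A).trace := by
      rw [Matrix.trace_mul_comm, Matrix.mul_assoc]
    have c3 : (V * Y * G * (V * A)).trace = (Y * V * A).trace := by
      rw [Matrix.trace_mul_comm, c1]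
    have c4 : (V * Y * G * (V * Y * G)).trace = (Y * Y).trace := by
      rw [show V * Y * G * (V * Y * G) = V * (Y * (G * V) * Y * G) by
        simp only [Matrix.mul_assoc], hGV, Matrix.mul_one, Matrix.trace_mul_comm,
        Matrix.mul_assoc (Y * Y), hGV, Matrix.mul_one]
    have c5 : (Y * (V * Y * G)).trace = (V * Y * G * Y).trace := Matrix.trace_mul_comm _ _
    rw [sq, Matrix.add_mul, Matrix.mul_add, Matrix.mul_add]
    simp only [Matrix.smul_mul, Matrix.mul_smul, Matrix.add_mul, Matrix.mul_add, smul_add,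
      Matrix.trace_add, Matrix.trace_smul, smul_eq_mul, c1, c2, c3, c4, c5, ← Matrix.mul_assoc Y V]
    rw [sq]
    ring
  rw [hprod, smul_pow, Matrix.trace_smul, hsq, smul_eq_mul, quadForm, relOffDiag, ← hVdef,
    ← hAdef, ← hρdef, ← hGdef]
  have t1 : (Y * V * A).trace = 2 * ρ ^ 2 * ((1 - l) / N * ∑ i, ∑ j, y.1 i * A i j) := by
    rw [hVK, Matrix.mul_smul, Matrix.smul_mul, Matrix.trace_smul, smul_eq_mul]
    congr 1
    have := sum_sum_twoParam_mul l ((1 - l) / N) fun i j => y.1 i * A i j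
    simp only [hAdef, offDiag_self, Finset.sum_const_zero, mul_zero, zero_add] at this
    rw [hAdef, ← this, Matrix.mul_assoc]
    refine Finset.sum_congr rfl fun i _ => ?_
    rw [Matrix.diag_apply, hYdef, Matrix.diagonal_mul, Matrix.mul_apply, Finset.mul_sum]
    exact Finset.sum_congr rfl fun j _ => by rw [offDiag_comm y.2 j i, formMatrix]; ring
  have t2 : (Y * Y).trace = ∑ i, y.1 i ^ 2 := by
    rw [hYdef, Matrix.diagonal_mul_diagonal, Matrix.trace_diagonal]
    exact Finset.sum_congr rfl fun i _ => (sq _).symm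
  have t3 : (V * Y * G * Y).trace = 2 * ρ ^ 2 * (l * ∑ i, y.1 i ^ 2
      + (1 - l) / N * ∑ i, ∑ j, y.1 i * G i j * y.1 j) := by
    rw [hVK, Matrix.smul_mul, Matrix.smul_mul, Matrix.smul_mul, Matrix.trace_smul, smul_eq_mul]
    congr 1
    have := sum_sum_twoParam_mul l ((1 - l) / N) fun i j => y.1 i * G i j * y.1 j
    have hd : ∀ i, G i i = 1 := fun i => by simp [hGdef, gramInf, twoParam_apply]
    simp only [hd, mul_one, ← sq] at this
    rw [← this, Matrix.mul_assoc, Matrix.mul_assoc]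
    refine Finset.sum_congr rfl fun i _ => ?_
    rw [Matrix.diag_apply, Matrix.mul_apply]
    refine Finset.sum_congr rfl fun j _ => ?_
    have : G j i = G i j := by conv_lhs => rw [← hG, Matrix.transpose_apply]
    rw [hYdef, Matrix.diagonal_mul, Matrix.mul_diagonal, this, formMatrix]; ring
  rw [t1, t2, t3]
  field_simp
  ring

/-- The symmetrized first-order variation of the inner products. -/
noncomputable def symVariation (N : ℕ) (l : ℝ) (y : Internal N) : Matrix (Fin N) (Fin N) ℝ :=
  rootMatrix N l * innerVariation N l y * rootMatrix N l

/-- With R² = K, cyclicity of the trace replaces K δS by the symmetric matrix R δS R, and the trace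
of the square of a symmetric matrix is the sum of the squares of its entries. -/
lemma quadForm_eq_sum_sq (hN : 1 ≤ N) (hl : 0 < l) (y : Internal N) :
    quadForm N l y = 1 / 2 * ∑ i, ∑ j, symVariation N l y i j ^ 2 := by
  set R := rootMatrix N l with hR
  set S := innerVariation N l y with hS
  set Z := symVariation N l y with hZdef
  have hRt : Rᵀ = R := twoParam_transpose _ _
  have hZ : Zᵀ = Z := by
    rw [hZdef, symVariation, Matrix.transpose_mul, Matrix.transpose_mul, ← hR, hRt,
      innerVariation_transpose, Matrix.mul_assoc]
  rw [quadForm_eq_trace hN hl, ← rootMatrix_mul_self hN hl, ← hR, ← hS]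
  congr 1
  have h1 : ((R * R * S) ^ 2).trace = (Z * Z).trace := by
    rw [hZdef, symVariation, ← hR, ← hS, sq,
      show R * R * S * (R * R * S) = R * (R * S * R * (R * S)) by simp only [Matrix.mul_assoc],
      Matrix.trace_mul_comm]
    simp only [Matrix.mul_assoc]
  rw [h1, Matrix.trace]
  simp only [Matrix.diag, Matrix.mul_apply]
  refine Finset.sum_congr rfl fun i _ => Finset.sum_congr rfl fun j _ => ?_
  have : Z j i = Z i j := by conv_lhs => rw [← hZ, Matrix.transpose_apply]
  rw [this, sq]

lemma quadForm_pos (hN : 1 ≤ N) (hl : 0 < l) {y : Internal N} (hy : y ≠ 0) :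
    0 < quadForm N l y := by
  rw [quadForm_eq_sum_sq hN hl]
  have h0 : 0 ≤ ∑ i, ∑ j, symVariation N l y i j ^ 2 :=
    Finset.sum_nonneg fun _ _ => Finset.sum_nonneg fun _ _ => sq_nonneg _
  refine mul_pos (by norm_num) (lt_of_le_of_ne h0 fun h => hy ?_)
  have hz : symVariation N l y = 0 := by
    ext i j
    have h1 := (Finset.sum_eq_zero_iff_of_nonneg
      fun _ _ => Finset.sum_nonneg fun _ _ => sq_nonneg _).1 h.symm i (Finset.mem_univ i)
    have h2 := (Finset.sum_eq_zero_iff_of_nonneg fun _ _ => sq_nonneg _).1 h1 j (Finset.mem_univ j)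
    simpa using h2
  have hu := rootMatrix_isUnit hN hl
  rw [symVariation] at hz
  have h1 := (hu.mul_left_eq_zero).1 hz
  exact eq_zero_of_innerVariation_eq_zero hN hl ((hu.mul_right_eq_zero).1 h1)

/-- The displacement with the given radial and angular components. -/
def ofSum (v : Fin N ⊕ Pair N → ℝ) : Internal N := (fun i => v (Sum.inl i), fun p => v (Sum.inr p))

lemma ofSum_elim (y : Internal N) : ofSum (Sum.elim y.1 y.2) = y := rfl

/-- The symmetrized variation as a linear map. -/
noncomputable def symVariationMap (N : ℕ) (l : ℝ) :
    (Fin N ⊕ Pair N → ℝ) →ₗ[ℝ] (Fin N × Fin N → ℝ) where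
  toFun v m := symVariation N l (ofSum v) m.1 m.2
  map_add' v w := by
    funext m
    have : ofSum (v + w) = ofSum v + ofSum w := rfl
    simp [this, symVariation, innerVariation_add, Matrix.mul_add, Matrix.add_mul]
  map_smul' t v := by
    funext m
    have : ofSum (t • v) = t • ofSum v := rfl
    simp [this, symVariation, innerVariation_smul]

/-- The matrix of the quadratic form `quadForm`. -/
noncomputable def omegaMatrix (N : ℕ) (l : ℝ) :
    Matrix (Fin N ⊕ Pair N) (Fin N ⊕ Pair N) ℝ :=
  (1 / 2 : ℝ) • ((LinearMap.toMatrix' (symVariationMap N l))ᵀ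
    * LinearMap.toMatrix' (symVariationMap N l))

lemma dotProduct_omegaMatrix (hN : 1 ≤ N) (hl : 0 < l) (v : Fin N ⊕ Pair N → ℝ) :
    v ⬝ᵥ (omegaMatrix N l *ᵥ v) = quadForm N l (ofSum v) := by
  rw [quadForm_eq_sum_sq hN hl, omegaMatrix, Matrix.smul_mulVec, dotProduct_smul,
    ← Matrix.mulVec_mulVec, Matrix.dotProduct_mulVec, Matrix.vecMul_transpose,
    LinearMap.toMatrix'_mulVec, smul_eq_mul, dotProduct, Fintype.sum_prod_type]
  simp [symVariationMap, sq]

lemma omegaMatrix_posDef (hN : 1 ≤ N) (hl : 0 < l) : (omegaMatrix N l).PosDef := by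
  refine Matrix.PosDef.of_dotProduct_mulVec_pos ?_ fun v hv => ?_
  · rw [isHermitian_iff_transpose_eq, omegaMatrix, Matrix.transpose_smul, Matrix.transpose_mul,
      Matrix.transpose_transpose]
  · rw [star_trivial, dotProduct_omegaMatrix hN hl]
    refine quadForm_pos hN hl fun h => hv ?_
    funext k
    rcases k with i | p
    · exact congrFun (congrArg Prod.fst h) i
    · exact congrFun (congrArg Prod.snd h) p

end Positivity

end HarmonicDPT

namespace HarmonicDPT

/-! ### The strict maximum of the phase -/

section Gap

variable {N : ℕ} {l : ℝ}

/-- The matrix of inner products relative to its value at the large-dimension structure. -/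
noncomputable def relInner (N : ℕ) (l : ℝ) (q : Internal N) : Matrix (Fin N) (Fin N) ℝ :=
  (2 : ℝ) • (rootMatrix N l * innerMatrix q * rootMatrix N l)

lemma det_innerMatrix (q : Internal N) :
    (innerMatrix q).det = (gram q.2).det * (∏ i, q.1 i) ^ 2 := by
  rw [innerMatrix_eq, Matrix.det_mul, Matrix.det_mul, Matrix.det_diagonal]; ring

lemma innerMatrix_posDef {q : Internal N} (hq : q ∈ domain N) : (innerMatrix q).PosDef := by
  rw [innerMatrix_eq]
  have hu : IsUnit (Matrix.diagonal q.1) := by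
    rw [Matrix.isUnit_iff_isUnit_det, Matrix.det_diagonal, isUnit_iff_ne_zero]
    exact Finset.prod_ne_zero_iff.2 fun i _ => (hq.1 i).ne'
  have := hq.2.conjTranspose_mul_mul_same (B := Matrix.diagonal q.1)
    (Matrix.mulVec_injective_iff_isUnit.2 hu)
  rwa [Matrix.conjTranspose_eq_transpose_of_trivial, Matrix.diagonal_transpose] at this

lemma relInner_posDef (hN : 1 ≤ N) (hl : 0 < l) {q : Internal N} (hq : q ∈ domain N) :
    (relInner N l q).PosDef := by
  have := (innerMatrix_posDef hq).conjTranspose_mul_mul_same (B := rootMatrix N l)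
    (Matrix.mulVec_injective_iff_isUnit.2 (rootMatrix_isUnit hN hl))
  rw [Matrix.conjTranspose_eq_transpose_of_trivial, rootMatrix, twoParam_transpose] at this
  exact this.smul (by norm_num)

lemma center_mem_domain (hN : 1 ≤ N) (hl : 0 < l) : center N l ∈ domain N :=
  ⟨fun _ => rInf_pos hN hl, by
    have : gram (center N l).2 = gramInf N l := gram_const _
    rw [this]; exact gramInf_posDef hN hl⟩

lemma relInner_eq_one_of_mul_eq_one (hN : 1 ≤ N) (hl : 0 < l) {q : Internal N}
    (h : (2 : ℝ) • (formMatrix N l * innerMatrix q) = 1) : relInner N l q = 1 := by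
  have hu := rootMatrix_isUnit hN hl
  apply hu.mul_left_cancel
  rw [relInner, Matrix.mul_smul, Matrix.mul_one, ← Matrix.mul_assoc, ← Matrix.mul_assoc,
    rootMatrix_mul_self hN hl, ← Matrix.smul_mul, h, Matrix.one_mul]

lemma relInner_center (hN : 1 ≤ N) (hl : 0 < l) : relInner N l (center N l) = 1 := by
  refine relInner_eq_one_of_mul_eq_one hN hl ?_
  have hS : innerMatrix (center N l) = rInf N l ^ 2 • gramInf N l := by
    ext i j
    have : gram (center N l).2 = gramInf N l := gram_const _
    rw [innerMatrix_apply, this, Matrix.smul_apply, smul_eq_mul]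
    simp only [center]; ring
  have h := gramInf_mul_formMatrix hN hl
  have h2 := mul_eq_one_comm.1 h
  rw [hS, Matrix.mul_smul, smul_smul, ← Matrix.smul_mul, h2]

/-- The determinant of X is a constant times Γ ∏ rᵢ², and its trace is twice `internalForm`. So
`phase` is (log det X - tr X)/4 up to a constant, and X = 1 at the centre. -/
lemma phase_center_sub (hN : 1 ≤ N) (hl : 0 < l) {q : Internal N} (hq : q ∈ domain N) :
    phase l (center N l) - phase l q
      = 1 / 4 * ((relInner N l q).trace - N - Real.log (relInner N l q).det) := by
  have key : ∀ q ∈ domain N, phase l q = 1 / 4 * Real.log (relInner N l q).det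
      - 1 / 4 * (relInner N l q).trace
      - 1 / 4 * Real.log ((2 : ℝ) ^ N * ((rootMatrix N l).det * (rootMatrix N l).det)) := by
    intro q hq
    have hR : (rootMatrix N l).det ≠ 0 :=
      isUnit_iff_ne_zero.1 ((Matrix.isUnit_iff_isUnit_det _).1 (rootMatrix_isUnit hN hl))
    have hprod : ∏ i, q.1 i ≠ 0 := Finset.prod_ne_zero_iff.2 fun i _ => (hq.1 i).ne'
    have hdet : Real.log (relInner N l q).det
        = Real.log ((2 : ℝ) ^ N * ((rootMatrix N l).det * (rootMatrix N l).det))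
          + (Real.log (gram q.2).det + 2 * ∑ i, Real.log (q.1 i)) := by
      have : (relInner N l q).det = ((2 : ℝ) ^ N * ((rootMatrix N l).det * (rootMatrix N l).det))
          * ((gram q.2).det * (∏ i, q.1 i) ^ 2) := by
        rw [relInner, Matrix.det_smul, Matrix.det_mul, Matrix.det_mul, det_innerMatrix,
          Fintype.card_fin]
        ring
      rw [this, Real.log_mul (by positivity) (mul_ne_zero hq.2.det_pos.ne' (pow_ne_zero 2 hprod)),
        Real.log_mul hq.2.det_pos.ne' (pow_ne_zero 2 hprod), Real.log_pow,
        Real.log_prod fun i _ => (hq.1 i).ne']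
      push_cast; ring
    have htr : (relInner N l q).trace = 2 * internalForm l q := by
      rw [relInner, Matrix.trace_smul, Matrix.trace_mul_comm, ← Matrix.mul_assoc,
        rootMatrix_mul_self hN hl, smul_eq_mul, internalForm]
      congr 1
      have := sum_sum_twoParam_mul l ((1 - l) / N) fun i j => innerMatrix q i j
      have hd : ∀ i, innerMatrix q i i = q.1 i ^ 2 := fun i => by
        rw [innerMatrix_apply, gram_self]; ring
      simp only [hd] at this
      rw [← this]
      refine Finset.sum_congr rfl fun i _ => ?_
      rw [Matrix.diag_apply, Matrix.mul_apply]
      refine Finset.sum_congr rfl fun j _ => ?_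
      rw [innerMatrix_apply, innerMatrix_apply, gram_comm, formMatrix]; ring
    rw [hdet, htr, phase]
    ring
  rw [key q hq, key _ (center_mem_domain hN hl), relInner_center hN hl]
  simp
  ring

/-- Twice the inequality log √x ≤ √x - 1. The square root makes one bound do for all x > 0: the left
side is quadratic near 1 and of order x at infinity. -/
lemma sq_sqrt_sub_one_le {x : ℝ} (hx : 0 < x) : (√x - 1) ^ 2 ≤ x - 1 - Real.log x := by
  have h1 : Real.log x = 2 * Real.log √x := by
    rw [← Real.log_rpow (Real.sqrt_pos.2 hx)]
    norm_num [Real.sq_sqrt hx.le]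
  have h2 := Real.log_le_sub_one_of_pos (Real.sqrt_pos.2 hx)
  nlinarith [Real.sq_sqrt hx.le]

/-- A positive definite matrix for which `tr X - N - log det X` is small is close to `1`. -/
lemma sq_sub_one_le_of_posDef {X : Matrix (Fin N) (Fin N) ℝ} (hX : X.PosDef) :
    0 ≤ X.trace - N - Real.log X.det ∧ ∀ i j, (X i j - (1 : Matrix (Fin N) (Fin N) ℝ) i j) ^ 2
      ≤ N * ((X.trace - N - Real.log X.det) * (√(X.trace - N - Real.log X.det) + 2) ^ 2) := by
  obtain ⟨U, x, hU, hU', hXU⟩ := exists_orthogonal_diagonalization hX.1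
  have hx : ∀ i, 0 < x i := by
    have h1 : Uᵀ * X * U = Matrix.diagonal x := by
      rw [hXU]
      calc Uᵀ * (U * Matrix.diagonal x * Uᵀ) * U = (Uᵀ * U) * Matrix.diagonal x * (Uᵀ * U) := by
            simp only [Matrix.mul_assoc]
        _ = _ := by rw [hU', Matrix.one_mul, Matrix.mul_one]
    have h2 := hX.conjTranspose_mul_mul_same (B := U)
      (Matrix.mulVec_injective_iff_isUnit.2 ⟨⟨U, Uᵀ, hU, hU'⟩, rfl⟩)
    rw [Matrix.conjTranspose_eq_transpose_of_trivial, h1] at h2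
    exact Matrix.posDef_diagonal_iff.1 h2
  have htr : X.trace = ∑ i, x i := by
    rw [hXU, Matrix.trace_mul_comm, ← Matrix.mul_assoc, hU', Matrix.one_mul, Matrix.trace_diagonal]
  have hdet : Real.log X.det = ∑ i, Real.log (x i) := by
    have hd : U.det * Uᵀ.det = 1 := by rw [← Matrix.det_mul, hU, Matrix.det_one]
    rw [hXU, Matrix.det_mul, Matrix.det_mul, Matrix.det_diagonal, mul_right_comm, hd, one_mul,
      Real.log_prod fun i _ => (hx i).ne']
  have hg : X.trace - N - Real.log X.det = ∑ i, (x i - 1 - Real.log (x i)) := by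
    rw [htr, hdet, Finset.sum_sub_distrib, Finset.sum_sub_distrib]; simp
  rw [hg]
  have hnn : ∀ i ∈ Finset.univ, 0 ≤ x i - 1 - Real.log (x i) := fun i _ =>
    (sq_nonneg _).trans (sq_sqrt_sub_one_le (hx i))
  set g := ∑ i, (x i - 1 - Real.log (x i)) with hgdef
  have hg0 : 0 ≤ g := Finset.sum_nonneg hnn
  refine ⟨hg0, fun i j => ?_⟩
  -- From x - 1 = (√x - 1)(√x + 1) with |√x - 1| ≤ √g, which also gives √x + 1 ≤ √g + 2.
  have hxi : ∀ i, (x i - 1) ^ 2 ≤ g * (√g + 2) ^ 2 := by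
    intro i
    have h1 : (√(x i) - 1) ^ 2 ≤ g :=
      (sq_sqrt_sub_one_le (hx i)).trans (Finset.single_le_sum hnn (Finset.mem_univ i))
    have h2 : |√(x i) - 1| ≤ √g := Real.abs_le_sqrt h1
    have h3 : 0 ≤ √(x i) + 1 := by positivity
    have h4 : √(x i) + 1 ≤ √g + 2 := by linarith [(abs_le.1 h2).2]
    have h5 : x i - 1 = (√(x i) - 1) * (√(x i) + 1) := by nlinarith [Real.sq_sqrt (hx i).le]
    rw [h5, mul_pow]
    gcongr
  have hE : X - 1 = U * Matrix.diagonal (fun i => x i - 1) * Uᵀ := by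
    have : Matrix.diagonal (fun i => x i - 1) = Matrix.diagonal x - 1 := by
      rw [← Matrix.diagonal_one, Matrix.diagonal_sub]
    rw [this, Matrix.mul_sub, Matrix.sub_mul, Matrix.mul_one, hU, ← hXU]
  have hEt : (X - 1)ᵀ = X - 1 := by
    rw [hE]; simp only [Matrix.transpose_mul, Matrix.transpose_transpose,
      Matrix.diagonal_transpose, Matrix.mul_assoc]
  -- The Frobenius norm is invariant under orthogonal conjugation, so the entries of X - 1 are
  -- controlled by its eigenvalues.
  have htr2 : ∑ i, ∑ j, (X i j - (1 : Matrix (Fin N) (Fin N) ℝ) i j) ^ 2 = ∑ i, (x i - 1) ^ 2 := by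
    have h1 : ((X - 1) * (X - 1)ᵀ).trace = ∑ i, (x i - 1) ^ 2 := by
      rw [hEt, hE, show U * Matrix.diagonal (fun i => x i - 1) * Uᵀ
        * (U * Matrix.diagonal (fun i => x i - 1) * Uᵀ)
        = U * (Matrix.diagonal (fun i => x i - 1) * (Uᵀ * U) * Matrix.diagonal (fun i => x i - 1)
          * Uᵀ) by simp only [Matrix.mul_assoc], hU', Matrix.mul_one, Matrix.trace_mul_comm,
        Matrix.mul_assoc _ Uᵀ, hU', Matrix.mul_one, Matrix.diagonal_mul_diagonal,
        Matrix.trace_diagonal]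
      exact Finset.sum_congr rfl fun i _ => (sq _).symm
    rw [← h1, Matrix.trace]
    simp only [Matrix.diag_apply, Matrix.mul_apply, Matrix.transpose_apply, Matrix.sub_apply, sq]
  calc (X i j - (1 : Matrix (Fin N) (Fin N) ℝ) i j) ^ 2
      ≤ ∑ j, (X i j - (1 : Matrix (Fin N) (Fin N) ℝ) i j) ^ 2 :=
        Finset.single_le_sum (f := fun j => (X i j - (1 : Matrix (Fin N) (Fin N) ℝ) i j) ^ 2)
          (fun _ _ => sq_nonneg _) (Finset.mem_univ j)
    _ ≤ ∑ i, ∑ j, (X i j - (1 : Matrix (Fin N) (Fin N) ℝ) i j) ^ 2 :=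
        Finset.single_le_sum
          (f := fun i => ∑ j, (X i j - (1 : Matrix (Fin N) (Fin N) ℝ) i j) ^ 2)
          (fun _ _ => Finset.sum_nonneg fun _ _ => sq_nonneg _) (Finset.mem_univ i)
    _ = ∑ i, (x i - 1) ^ 2 := htr2
    _ ≤ ∑ _i : Fin N, g * (√g + 2) ^ 2 := Finset.sum_le_sum fun i _ => hxi i
    _ = _ := by simp

lemma phase_le_center (hN : 1 ≤ N) (hl : 0 < l) {q : Internal N} (hq : q ∈ domain N) :
    phase l q ≤ phase l (center N l) := by
  have h1 := phase_center_sub hN hl hq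
  have h2 := (sq_sub_one_le_of_posDef (relInner_posDef hN hl hq)).1
  linarith

/-- As the phase approaches its maximum, X tends to 1 and S to its limiting value, and rᵢ = √Sᵢᵢ,
γᵢⱼ = Sᵢⱼ / (rᵢ rⱼ) depend continuously on S there. Stated with filters, it covers large radii and
the boundary of the domain without a compactness argument. -/
lemma tendsto_center (hN : 1 ≤ N) (hl : 0 < l) :
    Filter.comap (fun q => phase l (center N l) - phase l q) (𝓝 0) ⊓ Filter.principal (domain N)
      ≤ 𝓝 (center N l) := by
  set L := Filter.comap (fun q => phase l (center N l) - phase l q) (𝓝 0)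
    ⊓ Filter.principal (domain N) with hL
  have hdom : ∀ᶠ q in L, q ∈ domain N := Filter.mem_inf_of_right (Filter.mem_principal_self _)
  have hg : Filter.Tendsto
      (fun q => (relInner N l q).trace - N - Real.log (relInner N l q).det) L (𝓝 0) := by
    have h1 : Filter.Tendsto (fun q => 4 * (phase l (center N l) - phase l q)) L (𝓝 (4 * 0)) :=
      (Filter.tendsto_comap.mono_left inf_le_left).const_mul 4
    rw [mul_zero] at h1
    refine h1.congr' ?_
    filter_upwards [hdom] with q hq
    rw [phase_center_sub hN hl hq]; ring
  have hX : Filter.Tendsto (relInner N l) L (𝓝 1) := by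
    refine tendsto_pi_nhds.2 fun i => tendsto_pi_nhds.2 fun j => ?_
    rw [tendsto_iff_norm_sub_tendsto_zero]
    have hb : Filter.Tendsto (fun q => √(N * (((relInner N l q).trace - N
        - Real.log (relInner N l q).det) * (√((relInner N l q).trace - N
        - Real.log (relInner N l q).det) + 2) ^ 2))) L (𝓝 0) := by
      have hc : Continuous fun t : ℝ => √(N * (t * (√t + 2) ^ 2)) := by fun_prop
      have := (hc.tendsto 0).comp hg
      simpa [Function.comp_def] using this
    refine squeeze_zero' (Filter.Eventually.of_forall fun q => norm_nonneg _) ?_ hb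
    filter_upwards [hdom] with q hq
    exact Real.abs_le_sqrt ((sq_sub_one_le_of_posDef (relInner_posDef hN hl hq)).2 i j)
  have hdet : IsUnit (rootMatrix N l).det :=
    (Matrix.isUnit_iff_isUnit_det _).1 (rootMatrix_isUnit hN hl)
  have hback : ∀ q, (1 / 2 : ℝ) • ((rootMatrix N l)⁻¹ * relInner N l q * (rootMatrix N l)⁻¹)
      = innerMatrix q := by
    intro q
    rw [relInner, Matrix.mul_smul, Matrix.smul_mul, smul_smul,
      show (rootMatrix N l)⁻¹ * (rootMatrix N l * innerMatrix q * rootMatrix N l)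
        * (rootMatrix N l)⁻¹ = ((rootMatrix N l)⁻¹ * rootMatrix N l) * innerMatrix q
        * (rootMatrix N l * (rootMatrix N l)⁻¹) by simp only [Matrix.mul_assoc],
      Matrix.nonsing_inv_mul _ hdet, Matrix.mul_nonsing_inv _ hdet, Matrix.one_mul, Matrix.mul_one]
    norm_num
  have hS : Filter.Tendsto innerMatrix L (𝓝 (innerMatrix (center N l))) := by
    have hc : Continuous fun X : Matrix (Fin N) (Fin N) ℝ =>
        (1 / 2 : ℝ) • ((rootMatrix N l)⁻¹ * X * (rootMatrix N l)⁻¹) := by fun_prop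
    have := (hc.tendsto 1).comp hX
    rw [← relInner_center hN hl, hback] at this
    exact this.congr fun q => hback q
  have hSij : ∀ i j, Filter.Tendsto (fun q => innerMatrix q i j) L
      (𝓝 (innerMatrix (center N l) i j)) := fun i j =>
    (tendsto_pi_nhds.1 (tendsto_pi_nhds.1 hS i) j)
  have hsqrt : ∀ q ∈ domain N, ∀ i, √(innerMatrix q i i) = q.1 i := by
    intro q hq i
    rw [innerMatrix_apply, gram_self, mul_one, Real.sqrt_mul_self (hq.1 i).le]
  have hr : ∀ i, Filter.Tendsto (fun q : Internal N => q.1 i) L (𝓝 ((center N l).1 i)) := by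
    intro i
    have := (hSij i i).sqrt
    rw [hsqrt _ (center_mem_domain hN hl)] at this
    refine this.congr' ?_
    filter_upwards [hdom] with q hq using hsqrt q hq i
  have hγ : ∀ p, Filter.Tendsto (fun q : Internal N => q.2 p) L (𝓝 ((center N l).2 p)) := by
    intro p
    have hdiv : ∀ q ∈ domain N, innerMatrix q p.1.1 p.1.2 / (q.1 p.1.1 * q.1 p.1.2) = q.2 p := by
      intro q hq
      have := (hq.1 p.1.1).ne'
      have := (hq.1 p.1.2).ne'
      rw [innerMatrix_apply, gram_pair]; field_simp
    have hc := center_mem_domain hN hl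
    have := (hSij p.1.1 p.1.2).div ((hr p.1.1).mul (hr p.1.2))
      (mul_ne_zero (hc.1 _).ne' (hc.1 _).ne')
    rw [hdiv _ hc] at this
    refine this.congr' ?_
    filter_upwards [hdom] with q hq using hdiv q hq
  have h1 : Filter.Tendsto id L (𝓝 (center N l)) := by
    rw [nhds_prod_eq]
    exact (tendsto_pi_nhds.2 hr).prodMk (tendsto_pi_nhds.2 hγ)
  exact h1

/-- Outside of a neighbourhood of the large-dimension structure the exponent is bounded away from
its maximum. -/
lemma exists_phase_gap (hN : 1 ≤ N) (hl : 0 < l) {ε : ℝ} (hε : 0 < ε) :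
    ∃ η : ℝ, 0 < η ∧ ∀ q ∈ domain N, ε ≤ ‖q - center N l‖ →
      phase l q ≤ phase l (center N l) - η := by
  have h := tendsto_center hN hl (Metric.ball_mem_nhds (center N l) hε)
  rw [Filter.mem_inf_principal, Filter.mem_comap] at h
  obtain ⟨t, ht, hsub⟩ := h
  obtain ⟨η, hη, hball⟩ := Metric.mem_nhds_iff.1 ht
  refine ⟨η, hη, fun q hq hn => ?_⟩
  by_contra hlt
  push Not at hlt
  have h1 : phase l (center N l) - phase l q ∈ t := by
    apply hball
    rw [Metric.mem_ball, Real.dist_eq, sub_zero, abs_lt]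
    constructor <;> linarith [phase_le_center hN hl hq]
  have h2 : q ∈ Metric.ball (center N l) ε := hsub h1 hq
  rw [Metric.mem_ball, dist_eq_norm] at h2
  linarith

lemma eq_center_of_phase_eq (hN : 1 ≤ N) (hl : 0 < l) {q : Internal N} (hq : q ∈ domain N)
    (h : phase l q = phase l (center N l)) : q = center N l := by
  by_contra hne
  obtain ⟨η, hη, hgap⟩ := exists_phase_gap hN hl (norm_pos_iff.2 (sub_ne_zero.2 hne))
  linarith [hgap q hq le_rfl]

end Gap

/-! ### Uniqueness of the critical point -/

section Critical

variable {N : ℕ} {l : ℝ}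

lemma differentiable_gram_entry (i j : Fin N) :
    Differentiable ℝ fun q : Internal N => gram q.2 i j := by
  simp only [gram, Matrix.of_apply]
  split_ifs <;> fun_prop

lemma differentiable_det_gram : Differentiable ℝ fun q : Internal N => (gram q.2).det := by
  simp only [Matrix.det_apply]
  have := differentiable_gram_entry (N := N)
  fun_prop

lemma differentiableAt_phase (l : ℝ) {q : Internal N} (hq : q ∈ domain N) :
    DifferentiableAt ℝ (phase l) q := by
  have h1 : DifferentiableAt ℝ (fun q : Internal N => Real.log (gram q.2).det) q :=
    (differentiable_det_gram q).log hq.2.det_pos.ne'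
  have h2 : ∀ i, DifferentiableAt ℝ (fun q : Internal N => Real.log (q.1 i)) q := fun i =>
    DifferentiableAt.log (by fun_prop) (hq.1 i).ne'
  have h3 := differentiable_gram_entry (N := N)
  have h4 : Differentiable ℝ (internalForm l : Internal N → ℝ) := by
    unfold internalForm innerMatrix
    simp only [Matrix.of_apply]
    fun_prop
  have h4' := h4 q
  unfold phase
  fun_prop

lemma differentiableAt_weight {q : Internal N} (hq : q ∈ domain N) :
    DifferentiableAt ℝ weight q := by
  have h1 : DifferentiableAt ℝ (fun q : Internal N => Real.log (gram q.2).det) q :=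
    (differentiable_det_gram q).log hq.2.det_pos.ne'
  have h2 : ∀ i, DifferentiableAt ℝ (fun q : Internal N => Real.log (q.1 i)) q := fun i =>
    DifferentiableAt.log (by fun_prop) (hq.1 i).ne'
  unfold weight
  fun_prop

lemma fderiv_phase_center (hN : 1 ≤ N) (hl : 0 < l) : fderiv ℝ (phase l) (center N l) = 0 := by
  apply IsLocalMax.fderiv_eq_zero
  filter_upwards [isOpen_domain.mem_nhds (center_mem_domain hN hl)] with q hq
  exact phase_le_center hN hl hq

/-- The remainder in the first-order part of `log_det_add` is quadratic in t. -/
lemma hasDerivAt_log_det {G A : Matrix (Fin N) (Fin N) ℝ} (hG : G.PosDef) (hA : A.IsHermitian) :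
    HasDerivAt (fun t : ℝ => Real.log (G + t • A).det) (G⁻¹ * A).trace 0 := by
  rw [hasDerivAt_iff_isLittleO]
  refine Asymptotics.IsBigO.trans_isLittleO (g := fun t : ℝ => t ^ 2) ?_ ?_
  · refine Asymptotics.IsBigO.of_bound (2 * |((G⁻¹ * A) ^ 2).trace|) ?_
    have hev : ∀ᶠ t : ℝ in 𝓝 0, t ^ 2 * ((G⁻¹ * A) ^ 2).trace ≤ 1 / 4 := by
      have hc : Continuous fun t : ℝ => t ^ 2 * ((G⁻¹ * A) ^ 2).trace := by fun_prop
      have := hc.tendsto 0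
      simp only [ne_eq, OfNat.ofNat_ne_zero, not_false_eq_true, zero_pow, zero_mul] at this
      exact (this.eventually (gt_mem_nhds (by norm_num : (0 : ℝ) < 1 / 4))).mono fun t h => h.le
    filter_upwards [hev] with t ht
    have htr : ((G⁻¹ * t • A) ^ 2).trace = t ^ 2 * ((G⁻¹ * A) ^ 2).trace := by
      rw [Matrix.mul_smul, smul_pow, Matrix.trace_smul, smul_eq_mul]
    have hAt : (t • A).IsHermitian := by
      rw [isHermitian_iff_transpose_eq] at hA ⊢
      rw [Matrix.transpose_smul, hA]
    have h := (log_det_add hG hAt (htr.trans_le ht)).2.2.2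
    rw [htr, Matrix.mul_smul, Matrix.trace_smul, smul_eq_mul] at h
    rw [zero_smul, add_zero, sub_zero, smul_eq_mul, Real.norm_eq_abs, Real.norm_eq_abs,
      abs_of_nonneg (sq_nonneg t)]
    refine h.trans ?_
    nlinarith [le_abs_self ((G⁻¹ * A) ^ 2).trace, sq_nonneg t]
  · simp only [sub_zero]
    exact Asymptotics.isLittleO_pow_id one_lt_two

lemma fderiv_phase_apply {q : Internal N} (hq : q ∈ domain N) (v : Internal N) :
    fderiv ℝ (phase l) q v = 1 / 4 * ((gram q.2)⁻¹ * offDiag v.2).trace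
      + 1 / 2 * ∑ i, v.1 i / q.1 i
      - 1 / 2 * (l * ∑ i, 2 * (q.1 i * v.1 i) + (1 - l) / N * ∑ i, ∑ j,
        (v.1 i * gram q.2 i j * q.1 j + q.1 i * offDiag v.2 i j * q.1 j
          + q.1 i * gram q.2 i j * v.1 j)) := by
  have hline : HasDerivAt (fun t : ℝ => q + t • v) v 0 := by
    simpa using ((hasDerivAt_id (0 : ℝ)).smul_const v).const_add q
  have h1 : HasDerivAt (fun t : ℝ => phase l (q + t • v)) (fderiv ℝ (phase l) q v) 0 := by
    have hd : HasFDerivAt (phase l) (fderiv ℝ (phase l) q) (q + (0 : ℝ) • v) := by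
      simpa using (differentiableAt_phase l hq).hasFDerivAt
    exact hd.comp_hasDerivAt (0 : ℝ) hline
  have hr : ∀ i, HasDerivAt (fun t : ℝ => q.1 i + t * v.1 i) (v.1 i) 0 := fun i => by
    simpa using ((hasDerivAt_id (0 : ℝ)).mul_const (v.1 i)).const_add (q.1 i)
  have hg : ∀ i j, HasDerivAt (fun t : ℝ => gram q.2 i j + t * offDiag v.2 i j)
      (offDiag v.2 i j) 0 := fun i j => by
    simpa using ((hasDerivAt_id (0 : ℝ)).mul_const (offDiag v.2 i j)).const_add (gram q.2 i j)
  have hlogr : ∀ i, HasDerivAt (fun t : ℝ => Real.log (q.1 i + t * v.1 i)) (v.1 i / q.1 i) 0 :=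
    fun i => by simpa using (hr i).log (by simpa using (hq.1 i).ne')
  have hS : ∀ i j, HasDerivAt (fun t : ℝ => (q.1 i + t * v.1 i)
      * (gram q.2 i j + t * offDiag v.2 i j) * (q.1 j + t * v.1 j))
      (v.1 i * gram q.2 i j * q.1 j + q.1 i * offDiag v.2 i j * q.1 j
          + q.1 i * gram q.2 i j * v.1 j) 0 := fun i j => by
    have := ((hr i).fun_mul (hg i j)).fun_mul (hr j)
    simp only [zero_mul, add_zero] at this
    exact this.congr_deriv (by ring)
  have hsq : ∀ i, HasDerivAt (fun t : ℝ => (q.1 i + t * v.1 i) ^ 2) (2 * (q.1 i * v.1 i)) 0 :=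
    fun i => by
      have := (hr i).fun_pow 2
      simp only [zero_mul, add_zero] at this
      exact this.congr_deriv (by push_cast; ring)
  have h2 := (((hasDerivAt_log_det hq.2 (offDiag_isHermitian v.2)).const_mul (1 / 4)).fun_add
    ((HasDerivAt.fun_sum (u := Finset.univ) fun i _ => hlogr i).const_mul (1 / 2))).fun_sub
    ((((HasDerivAt.fun_sum (u := Finset.univ) fun i _ => hsq i).const_mul l).fun_add
      ((HasDerivAt.fun_sum (u := Finset.univ) fun i _ =>
        HasDerivAt.fun_sum (u := Finset.univ) fun j _ => hS i j).const_mul ((1 - l) / N))).const_mul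
        (1 / 2))
  refine h1.unique (h2.congr_of_eventuallyEq (Filter.Eventually.of_forall fun t => ?_))
  have e : ∀ i, (q + t • v).1 i = q.1 i + t * v.1 i := fun i => rfl
  have e2 : gram (q + t • v).2 = gram q.2 + t • offDiag v.2 := by
    rw [Prod.snd_add, Prod.smul_snd, gram_add, offDiag_smul]
  simp only [phase, internalForm, innerMatrix_apply, e, e2, Matrix.add_apply, Matrix.smul_apply,
    smul_eq_mul]

/-- Let V = G⁻¹ and b = (1 - l)/N. The angular derivatives give Vᵢⱼ = 2b rᵢ rⱼ for i ≠ j. The radial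
derivatives, combined with the diagonal of V G = 1, give Vᵢᵢ = 2(l + b) rᵢ². Together V = 2 diag(r)
K diag(r), which says X = 1; the phase then has its maximal value, attained only at the centre. -/
lemma eq_center_of_fderiv_phase_eq_zero (hN : 1 ≤ N) (hl : 0 < l) {q : Internal N}
    (hq : q ∈ domain N) (h : fderiv ℝ (phase l) q = 0) : q = center N l := by
  set b := (1 - l) / N with hb
  set G := gram q.2 with hG
  set V := G⁻¹ with hV
  have hdet : IsUnit G.det := (Matrix.isUnit_iff_isUnit_det _).1 hq.2.isUnit
  have hVG : V * G = 1 := Matrix.nonsing_inv_mul _ hdet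
  have hGt : ∀ i j, G i j = G j i := fun i j => gram_comm _ i j
  have hVt : ∀ i j, V i j = V j i := by
    intro i j
    have : Vᵀ = V := by
      rw [hV, Matrix.transpose_nonsing_inv]
      congr 1
      exact isHermitian_iff_transpose_eq.1 (gram_isHermitian q.2)
    conv_lhs => rw [← this, Matrix.transpose_apply]
  have hoff : ∀ i j, i ≠ j → V i j = 2 * b * (q.1 i * q.1 j) := by
    have key : ∀ p : Pair N, V p.1.1 p.1.2 = 2 * b * (q.1 p.1.1 * q.1 p.1.2) := by
      intro p
      have h1 := fderiv_phase_apply (l := l) hq ((0, Pi.single p 1) : Internal N)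
      rw [h] at h1
      have h2 : (V * offDiag (Pi.single p 1 : Pair N → ℝ)).trace = 2 * V p.1.1 p.1.2 := by
        have := sum_sum_mul_offDiag (Pi.single p 1 : Pair N → ℝ) fun i j => V i j
        simp only [Pi.single_apply, mul_ite, mul_one, mul_zero, Finset.sum_ite_eq',
          Finset.mem_univ, if_true] at this
        rw [two_mul]
        nth_rewrite 2 [hVt]
        rw [← this, Matrix.trace]
        refine Finset.sum_congr rfl fun i _ => ?_
        rw [Matrix.diag_apply, Matrix.mul_apply]
        exact Finset.sum_congr rfl fun j _ => by rw [offDiag_comm]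
      have h3 := sum_sum_mul_offDiag (Pi.single p 1 : Pair N → ℝ) fun i j => q.1 i * q.1 j
      simp only [Pi.single_apply, mul_ite, mul_one, mul_zero, Finset.sum_ite_eq',
        Finset.mem_univ, if_true] at h3
      have h4 : ∑ i, ∑ j, q.1 i * offDiag (Pi.single p 1 : Pair N → ℝ) i j * q.1 j
          = 2 * (q.1 p.1.1 * q.1 p.1.2) := by
        rw [two_mul]
        nth_rewrite 2 [mul_comm (q.1 p.1.1)]
        rw [← h3]
        exact Finset.sum_congr rfl fun i _ => Finset.sum_congr rfl fun j _ => by ring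
      simp only [Pi.zero_apply, zero_mul, mul_zero, zero_div, Finset.sum_const_zero, zero_add,
        add_zero, _root_.zero_apply, h4] at h1
      rw [← hG, ← hV, h2, ← hb] at h1
      linarith
    intro i j hij
    rcases lt_or_gt_of_ne hij with hlt | hlt
    · exact key ⟨(i, j), hlt⟩
    · rw [hVt, mul_comm (q.1 i)]; exact key ⟨(j, i), hlt⟩
  have hrow : ∀ i, 2 * l * q.1 i ^ 2 + 2 * b * ∑ j, q.1 i * G i j * q.1 j = 1 := by
    intro i
    have h1 := fderiv_phase_apply (l := l) hq ((Pi.single i 1, 0) : Internal N)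
    rw [h] at h1
    have h0 : offDiag (0 : Pair N → ℝ) = 0 := by
      have := offDiag_smul 0 (0 : Pair N → ℝ)
      simpa using this
    have e1 : ∑ x, ∑ j, (Pi.single i (1 : ℝ) : Fin N → ℝ) x * G x j * q.1 j
        = ∑ j, G i j * q.1 j := by
      rw [Finset.sum_comm]
      refine Finset.sum_congr rfl fun j _ => ?_
      simp [Pi.single_apply]
    have e2 : ∑ x, ∑ j, q.1 x * G x j * (Pi.single i (1 : ℝ) : Fin N → ℝ) j
        = ∑ j, G i j * q.1 j := by
      refine Finset.sum_congr rfl fun j _ => ?_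
      simp [Pi.single_apply, hGt j i, mul_comm]
    have e3 : ∑ x, (Pi.single i (1 : ℝ) : Fin N → ℝ) x / q.1 x = 1 / q.1 i := by
      rw [Finset.sum_eq_single i] <;> simp +contextual
    have e4 : ∑ x, 2 * (q.1 x * (Pi.single i (1 : ℝ) : Fin N → ℝ) x) = 2 * q.1 i := by
      rw [Finset.sum_eq_single i] <;> simp +contextual
    simp only [h0, Matrix.trace_zero, Matrix.zero_apply, mul_zero, zero_mul,
      add_zero, zero_add, _root_.zero_apply, Finset.sum_add_distrib, e3, e4] at h1
    rw [← hG, e1, e2, ← hb] at h1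
    have hri := (hq.1 i).ne'
    have e5 : ∑ j, q.1 i * G i j * q.1 j = q.1 i * ∑ j, G i j * q.1 j := by
      rw [Finset.mul_sum]; exact Finset.sum_congr rfl fun j _ => by ring
    rw [e5]
    field_simp at h1
    linarith
  have hdiag : ∀ i, V i i = 2 * (l + b) * q.1 i ^ 2 := by
    intro i
    have h1 := congrFun (congrFun hVG i) i
    rw [Matrix.mul_apply, Matrix.one_apply_eq] at h1
    -- Outside j = i the entries of V are those of the rank-one matrix 2b rᵢ rⱼ; the `if` term
    -- corrects the diagonal. The sum over j is then evaluated by `hrow`.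
    have h2 : ∀ j, V i j * G j i = 2 * b * (q.1 i * G i j * q.1 j)
        + if i = j then V i i - 2 * b * q.1 i ^ 2 else 0 := by
      intro j
      rcases eq_or_ne i j with rfl | hij
      · have : G i i = 1 := gram_self _ i
        simp [this]; ring
      · rw [hoff i j hij, hGt j i]; simp [hij]; ring
    simp only [h2, Finset.sum_add_distrib, ← Finset.mul_sum, Finset.sum_ite_eq, Finset.mem_univ,
      if_true] at h1
    linarith [hrow i]
  have hVeq : V = (2 : ℝ) • (Matrix.diagonal q.1 * formMatrix N l * Matrix.diagonal q.1) := by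
    ext i j
    rw [Matrix.smul_apply, Matrix.mul_diagonal, Matrix.diagonal_mul, formMatrix, twoParam_apply,
      smul_eq_mul, ← hb]
    rcases eq_or_ne i j with rfl | hij
    · rw [hdiag]; simp; ring
    · rw [hoff i j hij]; simp [hij]; ring
  have hone : relInner N l q = 1 := by
    refine relInner_eq_one_of_mul_eq_one hN hl ?_
    have hu : IsUnit (Matrix.diagonal q.1) := by
      rw [Matrix.isUnit_iff_isUnit_det, Matrix.det_diagonal, isUnit_iff_ne_zero]
      exact Finset.prod_ne_zero_iff.2 fun i _ => (hq.1 i).ne'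
    apply hu.mul_left_cancel
    rw [Matrix.mul_one, innerMatrix_eq, Matrix.mul_smul]
    calc (2 : ℝ) • (Matrix.diagonal q.1 * (formMatrix N l
          * (Matrix.diagonal q.1 * gram q.2 * Matrix.diagonal q.1)))
        = ((2 : ℝ) • (Matrix.diagonal q.1 * formMatrix N l * Matrix.diagonal q.1)) * G
          * Matrix.diagonal q.1 := by
          rw [← hG]; simp only [Matrix.mul_assoc, Matrix.smul_mul]
      _ = _ := by rw [← hVeq, hVG, Matrix.one_mul]
  apply eq_center_of_phase_eq hN hl hq
  have := phase_center_sub hN hl hq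
  rw [hone] at this
  simp at this
  linarith

end Critical

end HarmonicDPT

namespace HarmonicDPT

/-! ### Isomorphism invariants of multigraphs -/

section Invariants

variable {V W : Type*}

/-- The number of ordered pairs of entries of a multiset that are related by `R`. -/
def pairCount {α : Type*} (R : α → α → Prop) [DecidableRel R] (M : Multiset α) : ℕ :=
  (M.map fun x => M.countP (R x)).sum

lemma pairCount_map {α β : Type*} (R : α → α → Prop) [DecidableRel R] (S : β → β → Prop)
    [DecidableRel S] (F : α → β) (M : Multiset α)
    (h : ∀ x ∈ M, ∀ y ∈ M, S (F x) (F y) ↔ R x y) : pairCount S (M.map F) = pairCount R M := by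
  unfold pairCount
  rw [Multiset.map_map]
  congr 1
  refine Multiset.map_congr rfl fun x hx => ?_
  rw [Function.comp_apply, Multiset.countP_map, ← Multiset.countP_eq_card_filter]
  exact Multiset.countP_congr rfl fun y hy => by simp [h x hx y hy]

lemma sym2_map_injOn {f : V → W} {s : Set V} (hf : Set.InjOn f s) {ε ε' : Sym2 V}
    (h : ∀ v ∈ ε, v ∈ s) (h' : ∀ v ∈ ε', v ∈ s) : Sym2.map f ε = Sym2.map f ε' ↔ ε = ε' := by
  refine ⟨fun heq => ?_, fun heq => by rw [heq]⟩
  induction ε with | h a b =>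
  induction ε' with | h c d =>
  simp only [Sym2.map_mk, Sym2.eq_iff] at heq ⊢
  have ha := h a (by simp)
  have hb := h b (by simp)
  have hc := h' c (by simp)
  have hd := h' d (by simp)
  rcases heq with ⟨h1, h2⟩ | ⟨h1, h2⟩
  · exact Or.inl ⟨hf ha hc h1, hf hb hd h2⟩
  · exact Or.inr ⟨hf ha hd h1, hf hb hc h2⟩

variable [DecidableEq V] [DecidableEq W]

/-- Two unordered pairs have a common element. -/
def Meets (ε ε' : Sym2 V) : Prop := ∃ v ∈ ε.toFinset, v ∈ ε'.toFinset

instance : DecidableRel (Meets (V := V)) := fun ε ε' => by unfold Meets; infer_instance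

/-- The vertices of a graph given by its edges. -/
def vertices (M : Multiset (Sym2 V)) : Finset V := M.toFinset.biUnion Sym2.toFinset

/-- Isomorphism invariants of a graph: the numbers of pairs of equal edges, of pairs of edges with
a common vertex, and of vertices. -/
def graphInvariant (M : Multiset (Sym2 V)) : ℕ × ℕ × ℕ :=
  (pairCount Eq M, pairCount Meets M, (vertices M).card)

/-- An injective renaming of vertices preserves equality and incidence of edges and the number of
vertices. These computable numbers tell apart the graphs of each block, which reduces
non-isomorphism to a finite check. -/
lemma graphInvariant_map {f : V → W} {M : Multiset (Sym2 V)}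
    (hf : Set.InjOn f {v | ∃ ε ∈ M, v ∈ ε}) :
    graphInvariant (M.map (Sym2.map f)) = graphInvariant M := by
  have hs : ∀ ε ∈ M, ∀ v ∈ ε, v ∈ {v | ∃ ε ∈ M, v ∈ ε} := fun ε hε v hv => ⟨ε, hε, hv⟩
  refine Prod.ext ?_ (Prod.ext ?_ ?_)
  · exact pairCount_map _ _ _ _ fun x hx y hy => sym2_map_injOn hf (hs x hx) (hs y hy)
  · refine pairCount_map _ _ _ _ fun x hx y hy => ?_
    simp only [Meets, Sym2.mem_toFinset, Sym2.mem_map]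
    constructor
    · rintro ⟨_, ⟨a, ha, rfl⟩, b, hb, hab⟩
      have := hf (hs y hy b hb) (hs x hx a ha) hab
      exact ⟨a, ha, this ▸ hb⟩
    · rintro ⟨v, hv, hv'⟩
      exact ⟨f v, ⟨v, hv, rfl⟩, v, hv', rfl⟩
  · have : vertices (M.map (Sym2.map f)) = (vertices M).image f := by
      ext w
      simp only [vertices, Finset.mem_biUnion, Multiset.mem_toFinset, Multiset.mem_map,
        Sym2.mem_toFinset, Finset.mem_image]
      constructor
      · rintro ⟨_, ⟨ε, hε, rfl⟩, hw⟩
        obtain ⟨v, hv, rfl⟩ := Sym2.mem_map.1 hw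
        exact ⟨v, ⟨ε, hε, hv⟩, rfl⟩
      · rintro ⟨v, ⟨ε, hε, hv⟩, rfl⟩
        exact ⟨_, ⟨ε, hε, rfl⟩, Sym2.mem_map.2 ⟨v, hv, rfl⟩⟩
    simp only [graphInvariant, this]
    refine Finset.card_image_of_injOn fun a ha b hb hab => ?_
    simp only [vertices, Finset.coe_biUnion, Set.mem_iUnion, Finset.mem_coe,
      Multiset.mem_toFinset, Sym2.mem_toFinset] at ha hb
    obtain ⟨ε, hε, h1⟩ := ha
    obtain ⟨ε', hε', h2⟩ := hb
    exact hf ⟨ε, hε, h1⟩ ⟨ε', hε', h2⟩ hab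

end Invariants

/-! ### Tensor elements and their graphs -/

section Labels

variable {N a b : ℕ}

lemma Graph.Labels.invariant_eq {G : Graph} {e : Fin a → Pair N} {k : Fin b → Fin N}
    (h : G.Labels e k) : graphInvariant (elementGraph e k) = graphInvariant G.allEdges := by
  obtain ⟨f, hf, he⟩ := h
  rw [← he, graphInvariant_map hf]

/-- The graphs in `B` are told apart by `graphInvariant`. -/
def Graph.Separated (B : Finset Graph) : Prop :=
  ∀ G ∈ B, ∀ G' ∈ B, graphInvariant G.allEdges = graphInvariant G'.allEdges → G = G'

instance (B : Finset Graph) : Decidable (Graph.Separated B) := by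
  unfold Graph.Separated; infer_instance

-- Two graphs labelling the same tensor element have equal invariants, so at most one graph of `B`
-- contributes.
open Classical in
lemma sum_mul_labels {B : Finset Graph} (hB : Graph.Separated B) (c : Graph → ℝ)
    {e : Fin a → Pair N} {k : Fin b → Fin N} {G : Graph} (hG : G ∈ B) (h : G.Labels e k) :
    ∑ G' ∈ B, c G' * (if G'.Labels e k then 1 else 0) = c G := by
  rw [Finset.sum_eq_single_of_mem G hG]
  · simp [h]
  · intro G' hG' hne
    have : ¬ G'.Labels e k := fun h' =>
      hne (hB G' hG' G hG (h'.invariant_eq.symm.trans h.invariant_eq))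
    simp [this]

/-- A list of distinct particles labels the vertices of a graph. -/
lemma labels_of_list {G : Graph} {e : Fin a → Pair N} {k : Fin b → Fin N} (vs : List (Fin N))
    (hnd : vs.Nodup) (d : Fin N) (hlen : ∀ v ∈ vertices G.allEdges, v < vs.length)
    (h : G.allEdges.map (Sym2.map fun m => vs.getD m d) = elementGraph e k) : G.Labels e k := by
  refine ⟨fun m => vs.getD m d, ?_, h⟩
  rintro u ⟨ε, hε, hu⟩ v ⟨ε', hε', hv⟩ huv
  have h1 : u < vs.length := hlen u (by
    simp only [vertices, Finset.mem_biUnion, Multiset.mem_toFinset, Sym2.mem_toFinset]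
    exact ⟨ε, hε, hu⟩)
  have h2 : v < vs.length := hlen v (by
    simp only [vertices, Finset.mem_biUnion, Multiset.mem_toFinset, Sym2.mem_toFinset]
    exact ⟨ε', hε', hv⟩)
  simp only [List.getD_eq_getElem?_getD, List.getElem?_eq_getElem h1, List.getElem?_eq_getElem h2,
    Option.getD_some] at huv
  exact (hnd.getElem_inj_iff).1 huv

lemma sum_fin_succ_arrow {α : Type*} [Fintype α] {n : ℕ} (f : (Fin (n + 1) → α) → ℝ) :
    ∑ e, f e = ∑ p, ∑ e : Fin n → α, f (Fin.cons p e) := by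
  rw [← Fintype.sum_prod_type']
  exact (Fintype.sum_equiv (Fin.consEquiv fun _ => α) _ _ fun _ => rfl).symm

lemma sum_fin_zero_arrow {α : Type*} [Fintype α] (f : (Fin 0 → α) → ℝ) : ∑ e, f e = f ![] := by
  rw [Fintype.sum_unique]; exact congrArg f (Subsingleton.elim _ _)

lemma elementGraph_eq (e : Fin a → Pair N) (k : Fin b → Fin N) :
    elementGraph e k = (List.ofFn fun s => s((e s).1.1, (e s).1.2) : Multiset (Sym2 (Fin N)))
      + (List.ofFn fun t => s(k t, k t) : Multiset (Sym2 (Fin N))) := by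
  rw [elementGraph, Fin.univ_val_map, Fin.univ_val_map]

-- Replaces the lengths of the edge and loop lists by fixed numbers, so that all graphs of a block
-- share one index type.
open Classical in
lemma Graph.contract_eq {G : Graph} (ha : G.edges.length = a) (hb : G.loops.length = b)
    (y : Internal N) : G.contract y = ∑ e : Fin a → Pair N, ∑ k : Fin b → Fin N,
      (if G.Labels e k then 1 else 0) * (∏ s, y.2 (e s)) * ∏ t, y.1 (k t) := by
  subst ha hb
  rfl

/-- If every tensor element is labelled by one of the graphs of `B`, which are told apart by their
invariants, the coefficients of these graphs are the entries of the tensor. -/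
lemma sum_mul_contract {B : Finset Graph} (hB : Graph.Separated B)
    (hab : ∀ G ∈ B, G.edges.length = a ∧ G.loops.length = b) (c : Graph → ℝ)
    (T : (Fin a → Pair N) → (Fin b → Fin N) → ℝ)
    (hT : ∀ e k, ∃ G ∈ B, G.Labels e k ∧ c G = T e k) (y : Internal N) :
    ∑ G ∈ B, c G * G.contract y = ∑ e : Fin a → Pair N, ∑ k : Fin b → Fin N,
      T e k * (∏ s, y.2 (e s)) * ∏ t, y.1 (k t) := by
  classical
  have h1 : ∀ G ∈ B, c G * G.contract y = ∑ e : Fin a → Pair N, ∑ k : Fin b → Fin N,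
      (c G * if G.Labels e k then 1 else 0) * ((∏ s, y.2 (e s)) * ∏ t, y.1 (k t)) := by
    intro G hG
    rw [Graph.contract_eq (hab G hG).1 (hab G hG).2, Finset.mul_sum]
    refine Finset.sum_congr rfl fun e _ => ?_
    rw [Finset.mul_sum]
    refine Finset.sum_congr rfl fun k _ => by split_ifs <;> ring
  rw [Finset.sum_congr rfl h1, Finset.sum_comm]
  refine Finset.sum_congr rfl fun e _ => ?_
  rw [Finset.sum_comm]
  refine Finset.sum_congr rfl fun k _ => ?_
  obtain ⟨G, hG, hl, hc⟩ := hT e k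
  rw [← Finset.sum_mul, sum_mul_labels hB c hG hl, hc, mul_assoc]

end Labels

/-! ### Coefficient tensors as sums over orientations of edges -/

section OrientedSums

variable {V : Type*}

/-- The sum of a function over the two orientations of an edge. -/
noncomputable def osum (E : Sym2 V) (F : V → V → ℝ) : ℝ :=
  Sym2.lift ⟨fun a b => F a b + F b a, fun _ _ => add_comm _ _⟩ E

@[simp]
lemma osum_mk (a b : V) (F : V → V → ℝ) : osum s(a, b) F = F a b + F b a := rfl

/-- The coefficient tensor of `tr (V A V A)`. -/
noncomputable def osumTwo (W : V → V → ℝ) (E₁ E₂ : Sym2 V) : ℝ :=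
  osum E₁ fun a b => osum E₂ fun c d => W d a * W b c

/-- The coefficient tensor of `tr (V A V A V A)`. -/
noncomputable def osumThree (W : V → V → ℝ) (E₁ E₂ E₃ : Sym2 V) : ℝ :=
  osum E₁ fun a b => osum E₂ fun c d => osum E₃ fun e f => W f a * W b c * W d e

variable {W : V → V → ℝ}

/-- Transposing a product of symmetric matrices under the trace reverses the cyclic order of its
factors. Together with the cyclic rotation this gives invariance under all permutations of the three
edges. -/
lemma osumThree_swap (hW : ∀ i j, W i j = W j i) (E₁ E₂ E₃ : Sym2 V) :
    osumThree W E₁ E₂ E₃ = osumThree W E₂ E₁ E₃ := by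
  induction E₁ with | h a b =>
  induction E₂ with | h c d =>
  induction E₃ with | h e f =>
  simp only [osumThree, osum_mk, hW e, hW f, hW c a, hW c b, hW d a, hW d b]
  ring

lemma osumThree_rotate (hW : ∀ i j, W i j = W j i) (E₁ E₂ E₃ : Sym2 V) :
    osumThree W E₁ E₂ E₃ = osumThree W E₂ E₃ E₁ := by
  induction E₁ with | h a b =>
  induction E₂ with | h c d =>
  induction E₃ with | h e f =>
  simp only [osumThree, osum_mk, hW e, hW f]
  ring

end OrientedSums

end HarmonicDPT

namespace HarmonicDPT

/-! ### Classification of two and three edges -/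

section EdgeCases

variable {V : Type*}

/-- Two edges share two, one or no end points; interchanging the ends of an edge brings each
coincidence to the standard form. -/
lemma edge_cases [DecidableEq V] {E₁ E₂ : Sym2 V} (h₁ : ¬ E₁.IsDiag) (h₂ : ¬ E₂.IsDiag)
    {P : Sym2 V → Sym2 V → Prop} (heq : ∀ a b, [a, b].Nodup → P s(a, b) s(a, b))
    (hpath : ∀ a b c, [a, b, c].Nodup → P s(a, b) s(b, c))
    (hdisj : ∀ a b c d, [a, b, c, d].Nodup → P s(a, b) s(c, d)) : P E₁ E₂ := by
  induction E₁ with | h a b =>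
  induction E₂ with | h c d =>
  rw [Sym2.mk_isDiag_iff] at h₁ h₂
  by_cases hbc : b = c
  · subst hbc
    by_cases had : a = d
    · subst had; rw [Sym2.eq_swap]; exact heq _ _ (by simpa using h₂)
    · exact hpath a b d (by simp [*])
  by_cases hbd : b = d
  · subst hbd
    by_cases hac : a = c
    · subst hac; exact heq _ _ (by simpa using h₁)
    · rw [Sym2.eq_swap (a := c)]; exact hpath a b c (by simp [*])
  by_cases hac : a = c
  · subst hac
    rw [Sym2.eq_swap]; exact hpath b a d (by simp [*, Ne.symm h₁])
  by_cases had : a = d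
  · subst had
    rw [Sym2.eq_swap, Sym2.eq_swap (a := c)]; exact hpath b a c (by simp [*, Ne.symm h₁])
  · exact hdisj a b c d (by simp [*])

/-- A property of three edges that does not depend on their order holds if it holds for the
multigraphs with three edges. -/
lemma three_edges_cases [DecidableEq V] {P : Sym2 V → Sym2 V → Sym2 V → Prop}
    (hswap : ∀ E₁ E₂ E₃, P E₁ E₂ E₃ → P E₂ E₁ E₃) (hrot : ∀ E₁ E₂ E₃, P E₁ E₂ E₃ → P E₂ E₃ E₁)
    (ha : ∀ a b, [a, b].Nodup → P s(a, b) s(a, b) s(a, b))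
    (hb : ∀ a b c, [a, b, c].Nodup → P s(a, b) s(b, c) s(a, c))
    (hc : ∀ a b c, [a, b, c].Nodup → P s(a, b) s(a, b) s(b, c))
    (hd : ∀ a b c d, [a, b, c, d].Nodup → P s(a, b) s(a, c) s(a, d))
    (he : ∀ a b c d, [a, b, c, d].Nodup → P s(a, b) s(b, c) s(c, d))
    (hf : ∀ a b c d, [a, b, c, d].Nodup → P s(a, b) s(a, b) s(c, d))
    (hg : ∀ a b c d e, [a, b, c, d, e].Nodup → P s(a, b) s(b, c) s(d, e))
    (hh : ∀ a b c d e f, [a, b, c, d, e, f].Nodup → P s(a, b) s(c, d) s(e, f))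
    {E₁ E₂ E₃ : Sym2 V} (h₁ : ¬ E₁.IsDiag) (h₂ : ¬ E₂.IsDiag) (h₃ : ¬ E₃.IsDiag) :
    P E₁ E₂ E₃ := by
  have hdouble : ∀ {E E' : Sym2 V}, ¬ E.IsDiag → ¬ E'.IsDiag → P E E E' := fun h h' =>
    edge_cases (P := fun E E' => P E E E') h h' ha hc hf
  -- For a path followed by a third edge the cases are: the third edge contains the middle vertex
  -- (double edge or star), otherwise an end (triangle or longer path), otherwise no vertex of the
  -- path.
  have hpath : ∀ {E : Sym2 V}, ¬ E.IsDiag → ∀ a b c, [a, b, c].Nodup → P s(a, b) s(b, c) E := by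
    intro E hE a b c hnd
    have hab : ¬ s(a, b).IsDiag := by
      rw [Sym2.mk_isDiag_iff]; rintro rfl; simp at hnd
    have hbc : ¬ s(b, c).IsDiag := by
      rw [Sym2.mk_isDiag_iff]; rintro rfl; simp at hnd
    simp only [List.nodup_cons, List.mem_cons, List.not_mem_nil, or_false, not_or,
      not_false_iff, List.nodup_nil, and_true] at hnd
    obtain ⟨⟨nab, nac⟩, nbc⟩ := hnd
    by_cases hbE : b ∈ E
    · obtain ⟨d, rfl⟩ := Sym2.mem_iff_exists.1 hbE
      rw [Sym2.mk_isDiag_iff] at hE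
      by_cases hda : d = a
      · subst hda
        rw [Sym2.eq_swap (a := b) (b := d)]
        exact hrot _ _ _ (hdouble hab hbc)
      by_cases hdc : d = c
      · subst hdc
        exact hrot _ _ _ (hrot _ _ _ (hdouble hbc hab))
      · rw [Sym2.eq_swap]
        exact hd b a c d (by simp [*, Ne.symm nab, Ne.symm hda, Ne.symm hdc])
    by_cases haE : a ∈ E
    · obtain ⟨d, rfl⟩ := Sym2.mem_iff_exists.1 haE
      rw [Sym2.mk_isDiag_iff] at hE
      simp only [Sym2.mem_iff, not_or] at hbE
      by_cases hdc : d = c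
      · subst hdc; exact hb a b d (by simp [*])
      · rw [Sym2.eq_swap (a := a) (b := d)]
        exact hrot _ _ _ (he d a b c (by simp [*, Ne.symm hE, Ne.symm hbE.2]))
    by_cases hcE : c ∈ E
    · obtain ⟨d, rfl⟩ := Sym2.mem_iff_exists.1 hcE
      rw [Sym2.mk_isDiag_iff] at hE
      simp only [Sym2.mem_iff, not_or] at hbE haE
      exact he a b c d (by simp [*])
    · induction E with | h d e =>
      rw [Sym2.mk_isDiag_iff] at hE
      simp only [Sym2.mem_iff, not_or] at hbE haE hcE
      exact hg a b c d e (by simp [*])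
  refine edge_cases (P := fun E₁ E₂ => P E₁ E₂ E₃) h₁ h₂ (fun a b h => ?_) (hpath h₃)
    fun a b c d h => ?_
  · exact hdouble (by rw [Sym2.mk_isDiag_iff]; rintro rfl; simp at h) h₃
  · simp only [List.nodup_cons, List.mem_cons, List.not_mem_nil, or_false, not_or,
      not_false_iff, List.nodup_nil, and_true] at h
    obtain ⟨⟨nab, nac, nad⟩, ⟨nbc, nbd⟩, ncd⟩ := h
    induction E₃ with | h e f =>
    rw [Sym2.mk_isDiag_iff] at h₃
    -- an end of the third edge on one of the first two gives a path of two edges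
    have side : ∀ {a b c d e f : V}, a ≠ b → c ≠ d → e ≠ f → b ≠ c → b ≠ d → b = e →
        P s(a, b) s(e, f) s(c, d) := by
      intro a b c d e f nab ncd nef nbc nbd hbe
      subst hbe
      by_cases haf : a = f
      · subst haf
        rw [Sym2.eq_swap (a := b)]
        exact hdouble (by rwa [Sym2.mk_isDiag_iff]) (by rwa [Sym2.mk_isDiag_iff])
      · exact hpath (by rwa [Sym2.mk_isDiag_iff]) a b f (by simp [*])
    have mv : ∀ {E₁ E₂ E₃ : Sym2 V}, P E₁ E₃ E₂ → P E₁ E₂ E₃ := fun h =>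
      hswap _ _ _ (hrot _ _ _ (hrot _ _ _ h))
    by_cases hbe : b = e
    · exact mv (side nab ncd h₃ nbc nbd hbe)
    by_cases hbf : b = f
    · rw [Sym2.eq_swap (a := e)]
      exact mv (side nab ncd (Ne.symm h₃) nbc nbd hbf)
    by_cases hae : a = e
    · rw [Sym2.eq_swap (a := a)]
      exact mv (side (Ne.symm nab) ncd h₃ nac nad hae)
    by_cases haf : a = f
    · rw [Sym2.eq_swap (a := a), Sym2.eq_swap (a := e)]
      exact mv (side (Ne.symm nab) ncd (Ne.symm h₃) nac nad haf)
    by_cases hde : d = e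
    · exact hrot _ _ _ (hrot _ _ _ (side ncd nab h₃ (Ne.symm nad) (Ne.symm nbd) hde))
    by_cases hdf : d = f
    · rw [Sym2.eq_swap (a := e)]
      exact hrot _ _ _ (hrot _ _ _ (side ncd nab (Ne.symm h₃) (Ne.symm nad) (Ne.symm nbd) hdf))
    by_cases hce : c = e
    · rw [Sym2.eq_swap (a := c)]
      exact hrot _ _ _ (hrot _ _ _ (side (Ne.symm ncd) nab h₃ (Ne.symm nac) (Ne.symm nbc) hce))
    by_cases hcf : c = f
    · rw [Sym2.eq_swap (a := c), Sym2.eq_swap (a := e)]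
      exact hrot _ _ _ (hrot _ _ _
        (side (Ne.symm ncd) nab (Ne.symm h₃) (Ne.symm nac) (Ne.symm nbc) hcf))
    · exact hh a b c d e f (by simp [*])

end EdgeCases

/-! ### Tensor entries as functions of the graph -/

section Tensors

variable {N : ℕ}

/-- `M` is the graph `G` with its vertices renamed to distinct particles. -/
def Graph.Realizes (G : Graph) (M : Multiset (Sym2 (Fin N))) : Prop :=
  ∃ (vs : List (Fin N)) (d : Fin N), vs.Nodup ∧ (vertices G.allEdges).card = vs.length ∧
    G.allEdges.map (Sym2.map fun m => vs.getD m d) = M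

/-- The vertices in the table are numbered consecutively from 0, so a list with as many particles as
vertices labels all of them. -/
lemma Graph.lt_card_vertices :
    ∀ G : Graph, ∀ v ∈ vertices G.allEdges, v < (vertices G.allEdges).card := by
  decide

lemma Graph.Realizes.labels {a b : ℕ} {G : Graph} {e : Fin a → Pair N} {k : Fin b → Fin N}
    (h : G.Realizes (elementGraph e k)) : G.Labels e k := by
  obtain ⟨vs, d, hnd, hlen, heq⟩ := h
  exact labels_of_list vs hnd d (hlen ▸ G.lt_card_vertices) heq

lemma pair_not_isDiag (p : Pair N) : ¬ s(p.1.1, p.1.2).IsDiag := by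
  rw [Sym2.mk_isDiag_iff]; exact p.2.ne

variable {W : Fin N → Fin N → ℝ} {d n : ℝ} {c : Graph → ℝ}

/-- With one diagonal value d and one off-diagonal value n, an entry depends only on which end
points coincide. The factor 1/8 is that of the trace in `quadForm`. -/
lemma exists_labels_two_edges (hd : ∀ i, W i i = d) (hn : ∀ i j, i ≠ j → W i j = n)
    (ha : c .gga = (2 * n ^ 2 + 2 * d ^ 2) / 8) (hb : c .ggb = (2 * d * n + 2 * n ^ 2) / 8)
    (hc : c .ggc = 4 * n ^ 2 / 8) (e : Fin 2 → Pair N) (k : Fin 0 → Fin N) :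
    ∃ G ∈ ({.gga, .ggb, .ggc} : Finset Graph), G.Labels e k ∧
      c G = 1 / 8 * osumTwo W s((e 0).1.1, (e 0).1.2) s((e 1).1.1, (e 1).1.2) := by
  have key : ∀ {E₁ E₂ : Sym2 (Fin N)}, ¬ E₁.IsDiag → ¬ E₂.IsDiag →
      ∃ G ∈ ({.gga, .ggb, .ggc} : Finset Graph), G.Realizes (E₁ ::ₘ E₂ ::ₘ 0) ∧
      c G = 1 / 8 * osumTwo W E₁ E₂ := by
    intro E₁ E₂ h₁ h₂
    refine edge_cases (P := fun E₁ E₂ => ∃ G ∈ ({.gga, .ggb, .ggc} : Finset Graph),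
      G.Realizes (E₁ ::ₘ E₂ ::ₘ 0) ∧ c G = 1 / 8 * osumTwo W E₁ E₂) h₁ h₂
      (fun x y h => ⟨.gga, by decide, ⟨[x, y], x, h, rfl, rfl⟩, ?_⟩)
      (fun x y z h => ⟨.ggb, by decide, ⟨[x, y, z], x, h, rfl, rfl⟩, ?_⟩)
      (fun x y z w h => ⟨.ggc, by decide, ⟨[x, y, z, w], x, h, rfl, rfl⟩, ?_⟩) <;>
    · simp only [List.nodup_cons, List.mem_cons, List.not_mem_nil, or_false, not_or,
        not_false_iff, List.nodup_nil, and_true] at h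
      have h' : ∀ i j : Fin N, i ≠ j → W j i = n := fun i j hij => hn j i hij.symm
      simp only [osumTwo, osum_mk, ne_eq, not_false_iff, *]
      ring
  obtain ⟨G, hG, hr, hc'⟩ := key (pair_not_isDiag (e 0)) (pair_not_isDiag (e 1))
  refine ⟨G, hG, Graph.Realizes.labels ?_, hc'⟩
  rw [elementGraph_eq]
  exact hr

/-- The multigraphs with three edges and without loops. -/
def threeEdgeGraphs : Finset Graph := {.ggga, .gggb, .gggc, .gggd, .ggge, .gggf, .gggg, .gggh}

/-- The graph with three given edges is one of `threeEdgeGraphs`, and its coefficient is an entry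
of the tensor of `tr (V A V A V A)`. -/
def IsThreeEdgeEntry (W : Fin N → Fin N → ℝ) (c : Graph → ℝ) (E₁ E₂ E₃ : Sym2 (Fin N)) : Prop :=
  ∃ G ∈ threeEdgeGraphs, G.Realizes (E₁ ::ₘ E₂ ::ₘ E₃ ::ₘ 0) ∧
    c G = 1 / 6 * osumThree W E₁ E₂ E₃

lemma isThreeEdgeEntry_of_nodup {E₁ E₂ E₃ : Sym2 (Fin N)} (G : Graph) (hG : G ∈ threeEdgeGraphs)
    {vs : List (Fin N)} (x : Fin N) (h : vs.Nodup)
    (hlen : (vertices G.allEdges).card = vs.length)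
    (hE : G.allEdges.map (Sym2.map fun m => vs.getD m x) = E₁ ::ₘ E₂ ::ₘ E₃ ::ₘ 0)
    (hc : c G = 1 / 6 * osumThree W E₁ E₂ E₃) : IsThreeEdgeEntry W c E₁ E₂ E₃ :=
  ⟨G, hG, ⟨vs, x, h, hlen, hE⟩, hc⟩

/-- As for two edges. The factor 1/6 is twice the coefficient 1/12 of the trace in `cubicForm`,
because the correction enters as ½ √δ Δ. -/
lemma exists_labels_three_edges (hd : ∀ i, W i i = d) (hn : ∀ i j, i ≠ j → W i j = n)
    (ha : c .ggga = (2 * n ^ 3 + 6 * d ^ 2 * n) / 6)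
    (hb : c .gggb = (3 * d * n ^ 2 + d ^ 3 + 4 * n ^ 3) / 6)
    (hc : c .gggc = (4 * d * n ^ 2 + 2 * n ^ 3 + 2 * d ^ 2 * n) / 6)
    (hdd : c .gggd = (2 * n ^ 3 + 6 * d * n ^ 2) / 6)
    (he : c .ggge = (d ^ 2 * n + 2 * d * n ^ 2 + 5 * n ^ 3) / 6)
    (hf : c .gggf = (4 * n ^ 3 + 4 * d * n ^ 2) / 6)
    (hg : c .gggg = (2 * d * n ^ 2 + 6 * n ^ 3) / 6) (hh : c .gggh = 8 * n ^ 3 / 6)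
    (e : Fin 3 → Pair N) (k : Fin 0 → Fin N) :
    ∃ G ∈ threeEdgeGraphs,
      G.Labels e k ∧ c G = 1 / 6 * osumThree W s((e 0).1.1, (e 0).1.2) s((e 1).1.1, (e 1).1.2)
        s((e 2).1.1, (e 2).1.2) := by
  have hsymm : ∀ i j, W i j = W j i := fun i j => by
    by_cases h : i = j
    · rw [h]
    · rw [hn i j h, hn j i (Ne.symm h)]
  have h' : ∀ i j : Fin N, i ≠ j → W j i = n := fun i j hij => hn j i hij.symm
  have key : IsThreeEdgeEntry W c s((e 0).1.1, (e 0).1.2) s((e 1).1.1, (e 1).1.2)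
      s((e 2).1.1, (e 2).1.2) := by
    refine three_edges_cases (P := IsThreeEdgeEntry W c) ?_ ?_ ?_ ?_ ?_ ?_ ?_ ?_ ?_ ?_
      (pair_not_isDiag (e 0)) (pair_not_isDiag (e 1)) (pair_not_isDiag (e 2))
    · intro E₁ E₂ E₃
      simp only [IsThreeEdgeEntry]
      rw [osumThree_swap hsymm E₂ E₁ E₃, Multiset.cons_swap E₂ E₁]; exact id
    · intro E₁ E₂ E₃
      simp only [IsThreeEdgeEntry]
      rw [← osumThree_rotate hsymm E₁ E₂ E₃, Multiset.cons_swap E₃ E₁, Multiset.cons_swap E₂ E₁]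
      exact id
    · intro x y h
      refine isThreeEdgeEntry_of_nodup .ggga (by decide) x h rfl rfl ?_
      simp only [List.nodup_cons, List.mem_cons, List.not_mem_nil, or_false,
        not_false_iff, List.nodup_nil, and_true] at h
      simp only [osumThree, osum_mk, ne_eq, not_false_iff, hd, hn, h', h, ha]
      ring
    · intro x y z h
      refine isThreeEdgeEntry_of_nodup .gggb (by decide) x h rfl rfl ?_
      simp only [List.nodup_cons, List.mem_cons, List.not_mem_nil, or_false, not_or,
        not_false_iff, List.nodup_nil, and_true] at h
      simp only [osumThree, osum_mk, ne_eq, not_false_iff, hd, hn, h', h, hb]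
      ring
    · intro x y z h
      refine isThreeEdgeEntry_of_nodup .gggc (by decide) x h rfl rfl ?_
      simp only [List.nodup_cons, List.mem_cons, List.not_mem_nil, or_false, not_or,
        not_false_iff, List.nodup_nil, and_true] at h
      simp only [osumThree, osum_mk, ne_eq, not_false_iff, hd, hn, h', h, hc]
      ring
    · intro x y z w h
      refine isThreeEdgeEntry_of_nodup .gggd (by decide) x h rfl rfl ?_
      simp only [List.nodup_cons, List.mem_cons, List.not_mem_nil, or_false, not_or,
        not_false_iff, List.nodup_nil, and_true] at h
      simp only [osumThree, osum_mk, ne_eq, not_false_iff, hd, hn, h', h, hdd]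
      ring
    · intro x y z w h
      refine isThreeEdgeEntry_of_nodup .ggge (by decide) x h rfl rfl ?_
      simp only [List.nodup_cons, List.mem_cons, List.not_mem_nil, or_false, not_or,
        not_false_iff, List.nodup_nil, and_true] at h
      simp only [osumThree, osum_mk, ne_eq, not_false_iff, hd, hn, h', h, he]
      ring
    · intro x y z w h
      refine isThreeEdgeEntry_of_nodup .gggf (by decide) x h rfl rfl ?_
      simp only [List.nodup_cons, List.mem_cons, List.not_mem_nil, or_false, not_or,
        not_false_iff, List.nodup_nil, and_true] at h
      simp only [osumThree, osum_mk, ne_eq, not_false_iff, hd, hn, h', h, hf]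
      ring
    · intro x y z w u h
      refine isThreeEdgeEntry_of_nodup .gggg (by decide) x h rfl rfl ?_
      simp only [List.nodup_cons, List.mem_cons, List.not_mem_nil, or_false, not_or,
        not_false_iff, List.nodup_nil, and_true] at h
      simp only [osumThree, osum_mk, ne_eq, not_false_iff, hd, hn, h', h, hg]
      ring
    · intro x y z w u v h
      refine isThreeEdgeEntry_of_nodup .gggh (by decide) x h rfl rfl ?_
      simp only [List.nodup_cons, List.mem_cons, List.not_mem_nil, or_false, not_or,
        not_false_iff, List.nodup_nil, and_true] at h
      simp only [osumThree, osum_mk, ne_eq, not_false_iff, hn, h', h, hh]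
      ring
  obtain ⟨G, hG, hr, hc'⟩ := key
  refine ⟨G, hG, Graph.Realizes.labels ?_, hc'⟩
  rw [elementGraph_eq]
  exact hr

lemma exists_labels_one_edge (e : Fin 1 → Pair N) (k : Fin 0 → Fin N) : Graph.g.Labels e k := by
  refine Graph.Realizes.labels ⟨[(e 0).1.1, (e 0).1.2], (e 0).1.1, ?_, rfl, ?_⟩
  · simpa using (e 0).2.ne
  · rw [elementGraph_eq]; rfl

lemma exists_labels_one_loop (e : Fin 0 → Pair N) (k : Fin 1 → Fin N) : Graph.r.Labels e k := by
  refine Graph.Realizes.labels ⟨[k 0], k 0, by simp, rfl, ?_⟩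
  rw [elementGraph_eq]; rfl

lemma exists_labels_two_loops (e : Fin 0 → Pair N) (k : Fin 2 → Fin N) :
    ∃ G ∈ ({.rra, .rrb} : Finset Graph), G.Labels e k ∧
      c G = if k 0 = k 1 then c .rra else c .rrb := by
  by_cases h : k 0 = k 1
  · refine ⟨.rra, by decide, Graph.Realizes.labels ⟨[k 0], k 0, by simp, rfl, ?_⟩, by simp [h]⟩
    rw [elementGraph_eq]
    change (s(k 0, k 0) ::ₘ s(k 0, k 0) ::ₘ 0) = s(k 0, k 0) ::ₘ s(k 1, k 1) ::ₘ 0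
    rw [h]
  · refine ⟨.rrb, by decide, Graph.Realizes.labels ⟨[k 0, k 1], k 0, by simpa using h, rfl, ?_⟩,
      by simp [h]⟩
    rw [elementGraph_eq]; rfl

/-- The orientation sum runs over the two ends of the edge and picks the one that carries the loop.
-/
lemma exists_labels_edge_loop (hc : c .grb = 0) (e : Fin 1 → Pair N) (k : Fin 1 → Fin N) :
    ∃ G ∈ ({.gra, .grb} : Finset Graph), G.Labels e k ∧
      c G = osum s((e 0).1.1, (e 0).1.2) fun x _ => if k 0 = x then c .gra else 0 := by
  have hne : (e 0).1.1 ≠ (e 0).1.2 := (e 0).2.ne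
  by_cases h : k 0 = (e 0).1.1
  · refine ⟨.gra, by decide, Graph.Realizes.labels
      ⟨[(e 0).1.1, (e 0).1.2], k 0, by simpa using hne, rfl, ?_⟩, by simp [h, hne]⟩
    rw [elementGraph_eq]
    change (s((e 0).1.1, (e 0).1.2) ::ₘ s((e 0).1.1, (e 0).1.1) ::ₘ 0)
      = s((e 0).1.1, (e 0).1.2) ::ₘ s(k 0, k 0) ::ₘ 0
    rw [h]
  by_cases h' : k 0 = (e 0).1.2
  · refine ⟨.gra, by decide, Graph.Realizes.labels
      ⟨[(e 0).1.2, (e 0).1.1], k 0, by simpa using hne.symm, rfl, ?_⟩,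
      by simp [h', hne.symm]⟩
    rw [elementGraph_eq]
    change (s((e 0).1.2, (e 0).1.1) ::ₘ s((e 0).1.2, (e 0).1.2) ::ₘ 0)
      = s((e 0).1.1, (e 0).1.2) ::ₘ s(k 0, k 0) ::ₘ 0
    rw [h', Sym2.eq_swap]
  · refine ⟨.grb, by decide, Graph.Realizes.labels
      ⟨[(e 0).1.1, (e 0).1.2, k 0], k 0, by simp [hne, Ne.symm h, Ne.symm h'], rfl, ?_⟩,
      by simp [h, h', hc]⟩
    rw [elementGraph_eq]; rfl

lemma exists_labels_three_loops (hb : c .rrrb = 0) (hc : c .rrrc = 0) (e : Fin 0 → Pair N)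
    (k : Fin 3 → Fin N) :
    ∃ G ∈ ({.rrra, .rrrb, .rrrc} : Finset Graph), G.Labels e k ∧
      c G = if k 0 = k 1 ∧ k 1 = k 2 then c .rrra else 0 := by
  have two : ∀ {x y : Fin N}, x ≠ y → Graph.rrrb.Realizes (s(x, x) ::ₘ s(x, x) ::ₘ s(y, y) ::ₘ 0) :=
    fun {x y} h => ⟨[x, y], x, by simpa using h, rfl, rfl⟩
  have hk : elementGraph e k = s(k 0, k 0) ::ₘ s(k 1, k 1) ::ₘ s(k 2, k 2) ::ₘ 0 := by
    rw [elementGraph_eq]; rfl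
  by_cases h01 : k 0 = k 1
  · by_cases h12 : k 1 = k 2
    · refine ⟨.rrra, by decide, Graph.Realizes.labels ⟨[k 0], k 0, by simp, rfl, ?_⟩,
        by simp [h01, h12]⟩
      rw [hk, ← h12, ← h01]; rfl
    · refine ⟨.rrrb, by decide, Graph.Realizes.labels ?_, by simp [h12, hb]⟩
      rw [hk, h01]; exact two h12
  by_cases h12 : k 1 = k 2
  · refine ⟨.rrrb, by decide, Graph.Realizes.labels ?_, by simp [h01, hb]⟩
    rw [hk, ← h12, Multiset.cons_swap, Multiset.cons_swap (s(k 0, k 0))]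
    exact two (Ne.symm h01)
  by_cases h02 : k 0 = k 2
  · refine ⟨.rrrb, by decide, Graph.Realizes.labels ?_, by simp [h01, hb]⟩
    rw [hk, ← h02, Multiset.cons_swap (s(k 1, k 1))]
    exact two h01
  · refine ⟨.rrrc, by decide, Graph.Realizes.labels
      ⟨[k 0, k 1, k 2], k 0, by simp [*], rfl, ?_⟩, by simp [h01, hc]⟩
    rw [hk]; rfl

lemma exists_labels_edge_two_loops (ha : c .grra = 0) (hc : c .grrc = 0) (hd : c .grrd = 0)
    (he : c .grre = 0) (e : Fin 1 → Pair N) (k : Fin 2 → Fin N) :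
    ∃ G ∈ ({.grra, .grrb, .grrc, .grrd, .grre} : Finset Graph), G.Labels e k ∧
      c G = osum s((e 0).1.1, (e 0).1.2) fun x y => if k 0 = x ∧ k 1 = y then c .grrb else 0 := by
  have hE : ¬ s((e 0).1.1, (e 0).1.2).IsDiag := pair_not_isDiag (e 0)
  have hk : elementGraph e k = s((e 0).1.1, (e 0).1.2) ::ₘ s(k 0, k 0) ::ₘ s(k 1, k 1) ::ₘ 0 := by
    rw [elementGraph_eq]; rfl
  suffices key : ∀ {E : Sym2 (Fin N)} {u v : Fin N}, ¬ E.IsDiag →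
      ∃ G ∈ ({.grra, .grrb, .grrc, .grrd, .grre} : Finset Graph),
        G.Realizes (E ::ₘ s(u, u) ::ₘ s(v, v) ::ₘ 0) ∧
        c G = osum E fun x y => if u = x ∧ v = y then c .grrb else 0 by
    obtain ⟨G, hG, hr, hcG⟩ := key (u := k 0) (v := k 1) hE
    exact ⟨G, hG, Graph.Realizes.labels (hk ▸ hr), hcG⟩
  intro E u v hE
  by_cases huE : u ∈ E
  · obtain ⟨w, rfl⟩ := Sym2.mem_iff_exists.1 huE
    rw [Sym2.mk_isDiag_iff] at hE
    by_cases hvu : v = u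
    · subst hvu
      exact ⟨.grra, by decide, ⟨[v, w], v, by simpa using hE, rfl, rfl⟩,
        by simp [ha, hE]⟩
    by_cases hvw : v = w
    · subst hvw
      exact ⟨.grrb, by decide, ⟨[u, v], v, by simpa using hE, rfl, rfl⟩,
        by simp [hE]⟩
    · exact ⟨.grrc, by decide, ⟨[u, w, v], v, by simp [*, Ne.symm hvu, Ne.symm hvw], rfl, rfl⟩,
        by simp [hvu, hvw, hc]⟩
  by_cases hvE : v ∈ E
  · obtain ⟨w, rfl⟩ := Sym2.mem_iff_exists.1 hvE
    rw [Sym2.mk_isDiag_iff] at hE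
    simp only [Sym2.mem_iff, not_or] at huE
    rw [Multiset.cons_swap (s(u, u))]
    exact ⟨.grrc, by decide, ⟨[v, w, u], v, by simp [*, Ne.symm huE.1, Ne.symm huE.2], rfl, rfl⟩,
        by simp [huE, hc]⟩
  · induction E with | h x y =>
    rw [Sym2.mk_isDiag_iff] at hE
    simp only [Sym2.mem_iff, not_or] at huE hvE
    by_cases huv : u = v
    · subst huv
      exact ⟨.grrd, by decide, ⟨[x, y, u], u, by simp [*, Ne.symm huE.1, Ne.symm huE.2], rfl, rfl⟩,
        by simp [huE, hd]⟩
    · exact ⟨.grre, by decide, ⟨[x, y, u, v], u, by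
        simp [*, Ne.symm huE.1, Ne.symm huE.2, Ne.symm hvE.1, Ne.symm hvE.2], rfl, rfl⟩,
        by simp [huE, he]⟩

end Tensors

end HarmonicDPT

namespace HarmonicDPT

/-! ### The coefficients in terms of the inverse matrix of angle cosines -/

section Coefficients

variable {N : ℕ} {l : ℝ}

/-- The diagonal element of the inverse of the matrix of angle cosines at the large-dimension
structure. -/
noncomputable def invDiag (N : ℕ) (l : ℝ) : ℝ := 2 * rInf N l ^ 2 * (l + (1 - l) / N)

/-- The off-diagonal elements of the inverse of the matrix of angle cosines at the large-dimension
structure. -/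
noncomputable def invOff (N : ℕ) (l : ℝ) : ℝ := 2 * rInf N l ^ 2 * ((1 - l) / N)

lemma gramInf_inv_apply_self (hN : 1 ≤ N) (hl : 0 < l) (i : Fin N) :
    (gramInf N l)⁻¹ i i = invDiag N l := by
  simp [gramInf_inv hN hl, formMatrix, twoParam_apply, invDiag]

lemma gramInf_inv_apply_ne (hN : 1 ≤ N) (hl : 0 < l) {i j : Fin N} (h : i ≠ j) :
    (gramInf N l)⁻¹ i j = invOff N l := by
  simp [gramInf_inv hN hl, formMatrix, twoParam_apply, invOff, h]

/-- 1 - γ∞, 1 + (N - 1) γ∞ and r̄∞² are rational in N and l with nonvanishing denominators, so after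
substitution these are identities of rational functions. The same holds for the coefficients below.
-/
lemma coeff_two_edges (hN : 1 ≤ N) (hl : 0 < l) :
    coeff N l .gga = (2 * invOff N l ^ 2 + 2 * invDiag N l ^ 2) / 8 ∧
    coeff N l .ggb = (2 * invDiag N l * invOff N l + 2 * invOff N l ^ 2) / 8 ∧
    coeff N l .ggc = 4 * invOff N l ^ 2 / 8 := by
  have hN' : (0 : ℝ) < N := by exact_mod_cast hN
  have hs := (shift_pos hN hl).ne'
  simp only [coeff, coeffAux, cH, cI, cJ, one_sub_gammaInf hN hl, one_add_gammaInf hN hl, invDiag,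
    invOff, rInf_sq hN hl]
  rw [gammaInf]
  refine ⟨?_, ?_, ?_⟩ <;> field_simp <;> ring

lemma coeff_three_edges (hN : 1 ≤ N) (hl : 0 < l) :
    coeff N l .ggga = (2 * invOff N l ^ 3 + 6 * invDiag N l ^ 2 * invOff N l) / 6 ∧
    coeff N l .gggb = (3 * invDiag N l * invOff N l ^ 2 + invDiag N l ^ 3
      + 4 * invOff N l ^ 3) / 6 ∧
    coeff N l .gggc = (4 * invDiag N l * invOff N l ^ 2 + 2 * invOff N l ^ 3
      + 2 * invDiag N l ^ 2 * invOff N l) / 6 ∧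
    coeff N l .gggd = (2 * invOff N l ^ 3 + 6 * invDiag N l * invOff N l ^ 2) / 6 := by
  have hN' : (0 : ℝ) < N := by exact_mod_cast hN
  have hs := (shift_pos hN hl).ne'
  simp only [coeff, coeffAux, cA, cB, cC, cD, cE, cF, one_sub_gammaInf hN hl,
    one_add_gammaInf hN hl, invDiag, invOff, rInf_sq hN hl]
  rw [gammaInf]
  refine ⟨?_, ?_, ?_, ?_⟩ <;> field_simp <;> ring

lemma coeff_three_edges' (hN : 1 ≤ N) (hl : 0 < l) :
    coeff N l .ggge = (invDiag N l ^ 2 * invOff N l + 2 * invDiag N l * invOff N l ^ 2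
      + 5 * invOff N l ^ 3) / 6 ∧
    coeff N l .gggf = (4 * invOff N l ^ 3 + 4 * invDiag N l * invOff N l ^ 2) / 6 ∧
    coeff N l .gggg = (2 * invDiag N l * invOff N l ^ 2 + 6 * invOff N l ^ 3) / 6 ∧
    coeff N l .gggh = 8 * invOff N l ^ 3 / 6 := by
  have hN' : (0 : ℝ) < N := by exact_mod_cast hN
  have hs := (shift_pos hN hl).ne'
  simp only [coeff, coeffAux, cA, cB, cC, cD, cE, cG, one_sub_gammaInf hN hl,
    one_add_gammaInf hN hl, invDiag, invOff, rInf_sq hN hl]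
  rw [gammaInf]
  refine ⟨?_, ?_, ?_, ?_⟩ <;> field_simp <;> ring

/-- The right-hand side is the coefficient in -2 `linForm`, since tr(V A) is 2 `invOff` times the
sum of the angular displacements. -/
lemma coeff_one_edge (hN : 1 ≤ N) (hl : 0 < l) :
    coeff N l .g = -((N + 1) / 2 * (2 * invOff N l)) := by
  have hN' : (0 : ℝ) < N := by exact_mod_cast hN
  have hs := (shift_pos hN hl).ne'
  simp only [coeff, coeffAux, cA, one_sub_gammaInf hN hl, one_add_gammaInf hN hl, invOff,
    rInf_sq hN hl]
  rw [gammaInf]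
  field_simp
  ring

/-- The right-hand side is the coefficient of a squared radial displacement in `quadForm`; its last
summand comes from the unit diagonal of G∞. -/
lemma coeff_two_loops (hN : 1 ≤ N) (hl : 0 < l) :
    coeff N l .rra = 1 / (4 * rInf N l ^ 2) + l / 2 + (1 - l) / N / 2 := by
  have hN' : (0 : ℝ) < N := by exact_mod_cast hN
  have hs := (shift_pos hN hl).ne'
  simp only [coeff, coeffAux, rInf_sq hN hl, lamEff]
  rw [show (N : ℝ) + l - 1 = N + (l - 1) by ring]
  field_simp
  ring

end Coefficients

/-! ### Traces as sums over pairs -/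

section Traces

variable {N : ℕ} (γ : Pair N → ℝ) (W : Matrix (Fin N) (Fin N) ℝ)

lemma sum_sum_mul_offDiag_eq_osum (F : Fin N → Fin N → ℝ) :
    ∑ i, ∑ j, F i j * offDiag γ i j = ∑ p : Pair N, osum s(p.1.1, p.1.2) F * γ p := by
  rw [sum_sum_mul_offDiag]; rfl

lemma trace_mul_offDiag :
    (W * offDiag γ).trace = ∑ p : Pair N, osum s(p.1.1, p.1.2) (fun a b => W b a) * γ p := by
  rw [← sum_sum_mul_offDiag_eq_osum, Finset.sum_comm]
  simp [Matrix.trace, Matrix.mul_apply]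

lemma mul_offDiag_mul_apply (X : Matrix (Fin N) (Fin N) ℝ) (b a : Fin N) :
    (W * offDiag γ * X) b a
      = ∑ p : Pair N, osum s(p.1.1, p.1.2) (fun c d => W b c * X d a) * γ p := by
  rw [← sum_sum_mul_offDiag_eq_osum, Finset.sum_comm]
  simp only [Matrix.mul_apply, Finset.sum_mul]
  exact Finset.sum_congr rfl fun _ _ => Finset.sum_congr rfl fun _ _ => by ring

lemma osum_sum_mul {V ι : Type*} [Fintype ι] (E : Sym2 V) (F : V → V → ι → ℝ) (z : ι → ℝ) :
    osum E (fun a b => ∑ q, F a b q * z q) = ∑ q, osum E (fun a b => F a b q) * z q := by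
  induction E with | h a b =>
  simp [add_mul, Finset.sum_add_distrib]

lemma mul_osum {V : Type*} (E : Sym2 V) (F : V → V → ℝ) (t : ℝ) :
    t * osum E F = osum E (fun a b => t * F a b) := by
  induction E with | h a b =>
  simp [mul_add]

lemma trace_mul_offDiag_sq : ((W * offDiag γ) ^ 2).trace = ∑ p : Pair N, ∑ q : Pair N,
    osumTwo W s(p.1.1, p.1.2) s(q.1.1, q.1.2) * (γ p * γ q) := by
  rw [pow_two, ← mul_assoc, trace_mul_offDiag]
  refine Finset.sum_congr rfl fun p _ => ?_
  simp only [mul_offDiag_mul_apply]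
  rw [osum_sum_mul, Finset.sum_mul]
  refine Finset.sum_congr rfl fun q _ => ?_
  simp only [osumTwo, mul_comm (W _ _) (W _ _)]
  ring

lemma trace_mul_offDiag_cube : ((W * offDiag γ) ^ 3).trace = ∑ p : Pair N, ∑ q : Pair N,
    ∑ r : Pair N, osumThree W s(p.1.1, p.1.2) s(q.1.1, q.1.2) s(r.1.1, r.1.2)
      * (γ p * (γ q * γ r)) := by
  -- Bracketed so that the last factor is expanded by `trace_mul_offDiag` and the other two, outer
  -- and inner, by `mul_offDiag_mul_apply`.
  have h : (W * offDiag γ) ^ 3 = W * offDiag γ * (W * offDiag γ * W) * offDiag γ := by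
    noncomm_ring
  rw [h, trace_mul_offDiag]
  refine Finset.sum_congr rfl fun p _ => ?_
  simp only [mul_offDiag_mul_apply]
  rw [osum_sum_mul, Finset.sum_mul]
  refine Finset.sum_congr rfl fun q _ => ?_
  simp only [Finset.mul_sum, ← mul_assoc, osum_sum_mul, Finset.sum_mul]
  refine Finset.sum_congr rfl fun r _ => ?_
  simp only [mul_osum, osumThree]
  have : ∀ a b c d e f : Fin N, W b c * (W d e * W f a) = W f a * W b c * W d e :=
    fun a b c d e f => by ring
  simp only [this]
  ring

end Traces

/-! ### The graph sums are the Taylor forms -/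

section Sums

variable {N : ℕ} {l : ℝ}

lemma sum_sum_ite_add_mul (s t : ℝ) (z : Fin N → ℝ) :
    ∑ i, ∑ j, ((if i = j then s else 0) * (z i * z j) + t * (z i * z j))
      = s * ∑ i, z i ^ 2 + t * ∑ i, ∑ j, z i * z j := by
  simp [Finset.sum_add_distrib, Finset.mul_sum, pow_two]

/-- The diagrams of rank two give the quadratic form. -/
lemma sum_coeff_mul_contract_rank_two (hN : 1 ≤ N) (hl : 0 < l) (y : Internal N) :
    ∑ G : Graph with G.rank = 2, coeff N l G * G.contract y = quadForm N l y := by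
  -- Grouped by the numbers of edges and loops: each block is one tensor with fixed index types.
  have hset : (Finset.univ.filter fun G : Graph => G.rank = 2)
      = {.rra, .rrb} ∪ ({.gra, .grb} ∪ {.gga, .ggb, .ggc}) := by decide
  obtain ⟨ha, hb, hc⟩ := coeff_two_edges hN hl
  rw [hset, Finset.sum_union (by decide), Finset.sum_union (by decide),
    sum_mul_contract (a := 0) (b := 2) (by decide) (by decide) _ _ exists_labels_two_loops,
    sum_mul_contract (a := 1) (b := 1) (by decide) (by decide) _ _
      (exists_labels_edge_loop (c := coeff N l) rfl),
    sum_mul_contract (a := 2) (b := 0) (by decide) (by decide) _ _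
      (exists_labels_two_edges (gramInf_inv_apply_self hN hl)
        (fun _ _ => gramInf_inv_apply_ne hN hl) ha hb hc)]
  simp only [sum_fin_succ_arrow, sum_fin_zero_arrow, Fin.prod_univ_succ, Finset.univ_eq_empty,
    Finset.prod_empty, Fin.cons_zero, Fin.cons_one, Fin.cons_succ, mul_one]
  have h1 : ∑ i, ∑ j, (if i = j then coeff N l .rra else coeff N l .rrb) * (y.1 i * y.1 j)
      = (coeff N l .rra - coeff N l .rrb) * ∑ i, y.1 i ^ 2
        + coeff N l .rrb * ∑ i, ∑ j, y.1 i * y.1 j := by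
    rw [← sum_sum_ite_add_mul]
    refine Finset.sum_congr rfl fun i _ => Finset.sum_congr rfl fun j _ => ?_
    split_ifs <;> ring
  have h2 : ∀ p : Pair N, ∑ i, (osum s(p.1.1, p.1.2) fun x _ => if i = x then coeff N l .gra else 0)
      * y.2 p * y.1 i = coeff N l .gra * ((y.1 p.1.1 + y.1 p.1.2) * y.2 p) := by
    intro p
    simp [add_mul, Finset.sum_add_distrib]
    ring
  have h3 : ∑ i, ∑ j, y.1 i * gramInf N l i j * y.1 j
      = (1 - gammaInf N l) * ∑ i, y.1 i ^ 2 + gammaInf N l * ∑ i, ∑ j, y.1 i * y.1 j := by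
    rw [← sum_sum_ite_add_mul]
    refine Finset.sum_congr rfl fun i _ => Finset.sum_congr rfl fun j _ => ?_
    rw [gramInf, twoParam_apply]
    ring
  simp only [mul_assoc (1 / 8 : ℝ), ← Finset.mul_sum]
  rw [h1, Finset.sum_congr rfl fun p _ => h2 p, ← Finset.mul_sum, quadForm, relOffDiag,
    trace_mul_offDiag_sq, h3, sum_sum_mul_offDiag y.2 fun i _ => y.1 i, coeff_two_loops hN hl,
    coeff, coeff, coeffAux, coeffAux]
  ring

/-- The diagrams of rank one and three give the first-order correction. -/
lemma sum_coeff_mul_contract_rank_one_three (hN : 1 ≤ N) (hl : 0 < l) (y : Internal N) :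
    ∑ G : Graph with G.rank = 1 ∨ G.rank = 3, coeff N l G * G.contract y
      = 2 * (cubicForm N l y - linForm N l y) := by
  have hset : (Finset.univ.filter fun G : Graph => G.rank = 1 ∨ G.rank = 3)
      = {.r} ∪ ({.g} ∪ ({.rrra, .rrrb, .rrrc} ∪ ({.grra, .grrb, .grrc, .grrd, .grre} ∪
        ({.ggra, .ggrb, .ggrc, .ggrd, .ggre, .ggrf, .ggrg} ∪ threeEdgeGraphs)))) := by decide
  obtain ⟨ha, hb, hc, hd⟩ := coeff_three_edges hN hl
  obtain ⟨he, hf, hg, hh⟩ := coeff_three_edges' hN hl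
  -- No terms with two angular and one radial displacement arise: log det does not involve the
  -- radii, and `internalForm` is linear in the cosines.
  have hzero : ∑ G ∈ ({.ggra, .ggrb, .ggrc, .ggrd, .ggre, .ggrf, .ggrg} : Finset Graph),
      coeff N l G * G.contract y = 0 := by
    refine Finset.sum_eq_zero fun G hG => ?_
    simp only [Finset.mem_insert, Finset.mem_singleton] at hG
    rcases hG with rfl | rfl | rfl | rfl | rfl | rfl | rfl <;> exact zero_mul _
  rw [hset, Finset.sum_union (by decide), Finset.sum_union (by decide),
    Finset.sum_union (by decide), Finset.sum_union (by decide), Finset.sum_union (by decide), hzero,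
    sum_mul_contract (a := 0) (b := 1) (by decide) (by decide) (coeff N l)
      (fun _ _ => coeff N l .r)
      fun e k => ⟨.r, by decide, exists_labels_one_loop e k, rfl⟩,
    sum_mul_contract (a := 1) (b := 0) (by decide) (by decide) (coeff N l)
      (fun _ _ => coeff N l .g)
      fun e k => ⟨.g, by decide, exists_labels_one_edge e k, rfl⟩,
    sum_mul_contract (a := 0) (b := 3) (by decide) (by decide) _ _
      (exists_labels_three_loops (c := coeff N l) rfl rfl),
    sum_mul_contract (a := 1) (b := 2) (by decide) (by decide) _ _
      (exists_labels_edge_two_loops (c := coeff N l) rfl rfl rfl rfl),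
    sum_mul_contract (a := 3) (b := 0) (by decide) (by decide) _ _
      (exists_labels_three_edges (gramInf_inv_apply_self hN hl)
        (fun _ _ => gramInf_inv_apply_ne hN hl) ha hb hc hd he hf hg hh)]
  simp only [sum_fin_succ_arrow, sum_fin_zero_arrow, Fin.prod_univ_succ, Finset.univ_eq_empty,
    Finset.prod_empty, Fin.cons_zero, Fin.cons_one, Fin.cons_succ, mul_one]
  have hcons : ∀ {α : Type} (u v w : α),
      (Fin.cons u (Fin.cons v (Fin.cons w ![])) : Fin 3 → α) 2 = w :=
    fun _ _ _ => rfl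
  simp only [hcons]
  have h1 : ∑ i, ∑ j, ∑ k, (if i = j ∧ j = k then coeff N l .rrra else 0)
      * (y.1 i * (y.1 j * y.1 k)) = coeff N l .rrra * ∑ i, y.1 i ^ 3 := by
    simp only [ite_and, ite_mul, zero_mul, Finset.sum_ite_eq, Finset.mem_univ, if_true,
      Finset.sum_ite_irrel, Finset.sum_const_zero, Finset.mul_sum]
    exact Finset.sum_congr rfl fun i _ => by ring
  have h2 : ∀ p : Pair N, ∑ i, ∑ j, (osum s(p.1.1, p.1.2) fun x z => if i = x ∧ j = z then
      coeff N l .grrb else 0) * y.2 p * (y.1 i * y.1 j)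
      = coeff N l .grrb * ((y.1 p.1.1 * y.1 p.1.2 + y.1 p.1.2 * y.1 p.1.1) * y.2 p) := by
    intro p
    simp only [osum_mk, add_mul, Finset.sum_add_distrib, ite_and, ite_mul, zero_mul,
      Finset.sum_ite_irrel, Finset.sum_ite_eq', Finset.mem_univ, if_true, Finset.sum_const_zero]
    ring
  have h3 : (relOffDiag N l y).trace = 2 * invOff N l * ∑ p : Pair N, y.2 p := by
    rw [relOffDiag, trace_mul_offDiag, Finset.mul_sum]
    refine Finset.sum_congr rfl fun p _ => ?_
    rw [osum_mk, gramInf_inv_apply_ne hN hl p.2.ne, gramInf_inv_apply_ne hN hl p.2.ne']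
    ring
  have h4 : ∑ i, ∑ j, y.1 i * offDiag y.2 i j * y.1 j
      = ∑ p : Pair N, (y.1 p.1.1 * y.1 p.1.2 + y.1 p.1.2 * y.1 p.1.1) * y.2 p := by
    rw [← sum_sum_mul_offDiag y.2 fun i j => y.1 i * y.1 j]
    exact Finset.sum_congr rfl fun i _ => Finset.sum_congr rfl fun j _ => by ring
  simp only [mul_assoc (1 / 6 : ℝ), ← Finset.mul_sum]
  rw [h1, Finset.sum_congr rfl fun p _ => h2 p, ← Finset.mul_sum, cubicForm, linForm, h3, h4,
    relOffDiag, trace_mul_offDiag_cube, coeff_one_edge hN hl, coeff, coeff, coeff, coeffAux,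
    coeffAux, coeffAux]
  ring

end Sums

end HarmonicDPT

namespace HarmonicDPT

/-! ### Exponentials of perturbed quadratic forms -/

section Pointwise

lemma abs_exp_sub_one_sub_id_le_mul_exp (t : ℝ) : |Real.exp t - 1 - t| ≤ t ^ 2 * Real.exp |t| := by
  have h := Complex.norm_exp_sub_sum_le_norm_mul_exp (t : ℂ) 2
  simp only [Finset.sum_range_succ, Finset.sum_range_zero, pow_zero, pow_one, Nat.factorial_zero,
    Nat.factorial_one, Nat.cast_one, div_one, zero_add, Complex.norm_real, Real.norm_eq_abs,
    sq_abs] at h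
  rw [show Complex.exp t - (1 + t) = ((Real.exp t - 1 - t : ℝ) : ℂ) by push_cast; ring,
    Complex.norm_real, Real.norm_eq_abs] at h
  exact h

/-- Expansion of the exponential of a perturbed quadratic form. -/
lemma abs_exp_perturbed_sub_le {c a C ρ s n Q A R : ℝ} (ha : 0 ≤ a) (hC : 0 ≤ C)
    (hs : 0 ≤ s) (hs1 : s ≤ 1) (hn : 0 ≤ n) (hρ1 : ρ ≤ 1) (hρ : (a + C) * ρ ≤ c / 2)
    (hsn : s * n ≤ ρ) (hQ : c * n ^ 2 ≤ Q) (hA : |A| ≤ a * (n ^ 3 + n))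
    (hR : |R| ≤ C * (s ^ 2 * (n ^ 4 + n ^ 2))) :
    |Real.exp (-Q + s * A + R) - Real.exp (-Q) * (1 + s * A)|
      ≤ s ^ 2 * ((4 * (a + C) ^ 2 * Real.exp (c / 2) + 2 * C)
        * ((1 + n) ^ 8 * Real.exp (-(c / 2) * n ^ 2))) := by
  -- Two bounds for t are used. The bound |t| ≤ const · s (1 + n)⁴ makes t² of order s². The bound
  -- |t| ≤ c/2 + (c/2) n², where s n ≤ ρ enters, lets e^|t| consume only half of the Gaussian decay.
  set t := s * A + R with ht
  have hρ0 : 0 ≤ ρ := (mul_nonneg hs hn).trans hsn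
  have hn1 : 1 ≤ 1 + n := by linarith
  have e1 : n ^ 3 + n ≤ 2 * (1 + n) ^ 4 := by
    nlinarith [pow_nonneg hn 2, pow_nonneg hn 3, pow_nonneg hn 4]
  have e2 : n ^ 4 + n ^ 2 ≤ 2 * (1 + n) ^ 4 := by
    nlinarith [pow_nonneg hn 2, pow_nonneg hn 3, pow_nonneg hn 4]
  have e3 : (1 + n) ^ 4 ≤ (1 + n) ^ 8 := pow_le_pow_right₀ hn1 (by norm_num)
  have hss : s ^ 2 ≤ s := by nlinarith
  have htA : |t| ≤ s * (a * (n ^ 3 + n)) + C * (s ^ 2 * (n ^ 4 + n ^ 2)) := by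
    calc |t| ≤ |s * A| + |R| := abs_add_le _ _
      _ = s * |A| + |R| := by rw [abs_mul, abs_of_nonneg hs]
      _ ≤ _ := add_le_add (mul_le_mul_of_nonneg_left hA hs) hR
  have ht1 : |t| ≤ 2 * (a + C) * s * (1 + n) ^ 4 := by
    refine htA.trans ?_
    have h1 : s * (a * (n ^ 3 + n)) ≤ s * (a * (2 * (1 + n) ^ 4)) := by gcongr
    have h2 : C * (s ^ 2 * (n ^ 4 + n ^ 2)) ≤ C * (s * (2 * (1 + n) ^ 4)) := by gcongr
    linarith
  have ht2 : |t| ≤ c / 2 + c / 2 * n ^ 2 := by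
    have h1 : s * (a * (n ^ 3 + n)) = a * (s * n) * (n ^ 2 + 1) := by ring
    have h2 : C * (s ^ 2 * (n ^ 4 + n ^ 2)) = C * (s * n) ^ 2 * (n ^ 2 + 1) := by ring
    have h3 : (s * n) ^ 2 ≤ ρ := by
      have : 0 ≤ s * n := mul_nonneg hs hn
      nlinarith
    have hn2 : 0 ≤ n ^ 2 + 1 := by positivity
    calc |t| ≤ a * (s * n) * (n ^ 2 + 1) + C * (s * n) ^ 2 * (n ^ 2 + 1) := by
          rw [← h1, ← h2]; exact htA
      _ ≤ a * ρ * (n ^ 2 + 1) + C * ρ * (n ^ 2 + 1) := by gcongr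
      _ = (a + C) * ρ * (n ^ 2 + 1) := by ring
      _ ≤ c / 2 * (n ^ 2 + 1) := by gcongr
      _ = c / 2 + c / 2 * n ^ 2 := by ring
  have hsq : t ^ 2 ≤ s ^ 2 * (4 * (a + C) ^ 2 * (1 + n) ^ 8) := by
    calc t ^ 2 = |t| ^ 2 := (sq_abs t).symm
      _ ≤ (2 * (a + C) * s * (1 + n) ^ 4) ^ 2 := by gcongr
      _ = _ := by ring
  have hRb : |R| ≤ s ^ 2 * (2 * C * (1 + n) ^ 8) := by
    refine hR.trans ?_
    calc C * (s ^ 2 * (n ^ 4 + n ^ 2)) ≤ C * (s ^ 2 * (2 * (1 + n) ^ 8)) := by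
          gcongr; linarith
      _ = _ := by ring
  have hmain : Real.exp (-Q + s * A + R) - Real.exp (-Q) * (1 + s * A)
      = Real.exp (-Q) * ((Real.exp t - 1 - t) + R) := by
    rw [show -Q + s * A + R = -Q + t by rw [ht]; ring, Real.exp_add, ht]; ring
  rw [hmain, abs_mul, abs_of_pos (Real.exp_pos _)]
  have hE : Real.exp (-Q) ≤ Real.exp (-(c / 2) * n ^ 2) * Real.exp (-(c / 2 * n ^ 2)) := by
    rw [← Real.exp_add]; exact Real.exp_le_exp.2 (by linarith)
  have hc2 : 0 ≤ c / 2 := (mul_nonneg (add_nonneg ha hC) hρ0).trans hρ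
  have hinner : |Real.exp t - 1 - t + R| ≤ s ^ 2 * (1 + n) ^ 8 *
      ((4 * (a + C) ^ 2 * Real.exp (c / 2) + 2 * C) * Real.exp (c / 2 * n ^ 2)) := by
    have h1 : |Real.exp t - 1 - t| ≤ s ^ 2 * (4 * (a + C) ^ 2 * (1 + n) ^ 8)
        * (Real.exp (c / 2) * Real.exp (c / 2 * n ^ 2)) := by
      refine (abs_exp_sub_one_sub_id_le_mul_exp t).trans ?_
      rw [← Real.exp_add]
      gcongr
    have h2 : |R| ≤ s ^ 2 * (2 * C * (1 + n) ^ 8) * Real.exp (c / 2 * n ^ 2) := by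
      refine hRb.trans (le_mul_of_one_le_right (by positivity) (Real.one_le_exp (by positivity)))
    calc _ ≤ _ := abs_add_le _ _
      _ ≤ _ := add_le_add h1 h2
      _ = _ := by ring
  calc Real.exp (-Q) * |Real.exp t - 1 - t + R|
      ≤ (Real.exp (-(c / 2) * n ^ 2) * Real.exp (-(c / 2 * n ^ 2))) * (s ^ 2 * (1 + n) ^ 8 *
      ((4 * (a + C) ^ 2 * Real.exp (c / 2) + 2 * C) * Real.exp (c / 2 * n ^ 2))) := by gcongr
    _ = s ^ 2 * ((4 * (a + C) ^ 2 * Real.exp (c / 2) + 2 * C)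
        * ((1 + n) ^ 8 * Real.exp (-(c / 2) * n ^ 2)))
        * (Real.exp (-(c / 2 * n ^ 2)) * Real.exp (c / 2 * n ^ 2)) := by ring
    _ = _ := by rw [← Real.exp_add, neg_add_cancel, Real.exp_zero, mul_one]

end Pointwise

/-! ### Expansion of powers of the wavefunction near the centre -/

section RelativeWave

variable {N : ℕ} {l : ℝ}

/-- Half of the coefficient of the first-order correction of the wavefunction. -/
noncomputable def correction (N : ℕ) (l : ℝ) (y : Internal N) : ℝ :=
  cubicForm N l y - linForm N l y

lemma continuous_correction (l : ℝ) : Continuous (correction N l) :=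
  (continuous_cubicForm l).sub (continuous_linForm l)

/-- Oddness of the correction is what removes the term of order √δ from the normalization integral.
-/
lemma correction_neg (l : ℝ) (y : Internal N) : correction N l (-y) = -correction N l y := by
  have h1 := cubicForm_smul l (-1) y
  have h2 := linForm_smul l (-1) y
  rw [neg_one_smul] at h1 h2
  rw [correction, correction, h1, h2]; ring

lemma exists_abs_correction_le (l : ℝ) :
    ∃ a, 0 ≤ a ∧ ∀ y, |correction N l y| ≤ a * (‖y‖ ^ 3 + ‖y‖) := by
  obtain ⟨a₁, h₁, ha₁⟩ := exists_abs_le_of_homogeneous (continuous_cubicForm (N := N) l)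
    three_ne_zero (cubicForm_smul l)
  obtain ⟨a₂, h₂, ha₂⟩ := exists_abs_le_of_homogeneous (continuous_linForm (N := N) l)
    one_ne_zero (fun t y => by rw [linForm_smul, pow_one])
  refine ⟨a₁ + a₂, by positivity, fun y => ?_⟩
  calc |correction N l y| ≤ |cubicForm N l y| + |linForm N l y| := abs_sub _ _
    _ ≤ a₁ * ‖y‖ ^ 3 + a₂ * ‖y‖ ^ 1 := add_le_add (ha₁ y) (ha₂ y)
    _ ≤ (a₁ + a₂) * (‖y‖ ^ 3 + ‖y‖) := by
      have : 0 ≤ a₁ * ‖y‖ + a₂ * ‖y‖ ^ 3 := by positivity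
      nlinarith

lemma exists_le_quadForm (hN : 1 ≤ N) (hl : 0 < l) :
    ∃ c, 0 < c ∧ ∀ y, c * ‖y‖ ^ 2 ≤ quadForm N l y :=
  exists_le_of_homogeneous_of_pos (continuous_quadForm l) two_ne_zero (quadForm_smul l)
    fun _ hy => quadForm_pos hN hl hy

/-- The wavefunction relative to its value at the large-dimension structure. -/
noncomputable def relWave (l : ℝ) (D : ℕ) (q : Internal N) : ℝ :=
  wave l D D q / wave l D D (center N l)

lemma relWave_eq (hN : 1 ≤ N) (hl : 0 < l) (D : ℕ) {q : Internal N} (hq : q ∈ domain N) :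
    relWave l D q = Real.exp (D * (phase l q - phase l (center N l))
      - (weight q - weight (center N l))) := by
  rw [relWave, wave_eq_exp l D hq, wave_eq_exp l D (center_mem_domain hN hl), ← Real.exp_sub]
  congr 1; ring

/-- The expansion of powers of the wavefunction near the large-dimension structure. -/
lemma exists_relWave_pow_expansion (hN : 1 ≤ N) (hl : 0 < l) {k : ℕ} (hk : 0 < k) :
    ∃ c M ρ, 0 < c ∧ 0 ≤ M ∧ 0 < ρ ∧ (∀ y, c * ‖y‖ ^ 2 ≤ k * quadForm N l y) ∧
      ∀ D : ℕ, 1 ≤ D → ∀ y : Internal N, √(1 / (D : ℝ)) * ‖y‖ ≤ ρ →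
        center N l + √(1 / (D : ℝ)) • y ∈ domain N ∧
        |relWave l D (center N l + √(1 / (D : ℝ)) • y) ^ k
            - Real.exp (-(k * quadForm N l y)) * (1 + √(1 / (D : ℝ)) * (k * correction N l y))|
          ≤ 1 / D * (M * ((1 + ‖y‖) ^ 8 * Real.exp (-(c / 2) * ‖y‖ ^ 2))) := by
  obtain ⟨c, hc, hcQ⟩ := exists_le_quadForm (N := N) hN hl
  obtain ⟨a, ha, haT⟩ := exists_abs_correction_le (N := N) l
  obtain ⟨C, ε, hC, hε, hexp⟩ := exists_expansion (N := N) hN hl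
  have hk' : (0 : ℝ) < k := by exact_mod_cast hk
  -- Keeps the displacement within the range of the Taylor expansion and meets the smallness
  -- condition of `abs_exp_perturbed_sub_le`, with all constants multiplied by the power k. The
  -- power is 2 for the normalization and 1 for the wavefunction itself.
  set ρ := min (min ε 1) (k * c / 2 / (k * a + k * C)) with hρdef
  have hden : 0 < k * a + k * C := by positivity
  have hρ : 0 < ρ := lt_min (lt_min hε one_pos) (by positivity)
  refine ⟨k * c, 4 * (k * a + k * C) ^ 2 * Real.exp (k * c / 2) + 2 * (k * C), ρ, by positivity,
    by positivity, hρ, fun y => by rw [mul_assoc]; gcongr; exact hcQ y, fun D hD y hy => ?_⟩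
  have hD' : (1 : ℝ) ≤ D := by exact_mod_cast hD
  set s := √(1 / (D : ℝ)) with hs
  have hs0 : 0 ≤ s := Real.sqrt_nonneg _
  have hs2 : s ^ 2 = 1 / D := Real.sq_sqrt (by positivity)
  have hs1 : s ≤ 1 := by
    rw [hs, Real.sqrt_le_one]
    exact (div_le_one (by linarith)).2 hD'
  have hDs : (D : ℝ) * s ^ 2 = 1 := by rw [hs2]; field_simp
  have hnorm : ‖s • y‖ = s * ‖y‖ := by rw [norm_smul, Real.norm_of_nonneg hs0]
  obtain ⟨hmem, he1, he2⟩ := hexp (s • y) (by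
    rw [hnorm]; exact hy.trans ((min_le_left _ _).trans (min_le_left _ _)))
  refine ⟨hmem, ?_⟩
  rw [relWave_eq hN hl D hmem, ← Real.exp_nat_mul]
  rw [hnorm, quadForm_smul, cubicForm_smul] at he1
  rw [hnorm, linForm_smul] at he2
  set e₁ := phase l (center N l + s • y) - phase l (center N l)
    - (-(s ^ 2 * quadForm N l y) + s ^ 3 * cubicForm N l y) with he₁
  set e₂ := weight (center N l + s • y) - weight (center N l) - s * linForm N l y with he₂
  -- Since D s² = 1, the factor D turns the second order of `phase` into the Gaussian exponent and
  -- leaves one power of s for the third order, the same as for the first order of `weight`.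
  have hexpo : k * (D * (phase l (center N l + s • y) - phase l (center N l))
      - (weight (center N l + s • y) - weight (center N l)))
      = -(k * quadForm N l y) + s * (k * correction N l y) + k * (D * e₁ - e₂) := by
    have h1 : phase l (center N l + s • y) - phase l (center N l)
      = e₁ + (-(s ^ 2 * quadForm N l y) + s ^ 3 * cubicForm N l y) := by rw [he₁]; ring
    have h2 : weight (center N l + s • y) - weight (center N l) = e₂ + s * linForm N l y := by
      rw [he₂]; ring
    rw [h1, h2, correction]
    linear_combination (-k * quadForm N l y + k * s * cubicForm N l y) * hDs
  rw [hexpo, ← hs2]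
  refine abs_exp_perturbed_sub_le (ρ := ρ) (by positivity) (by positivity) hs0 hs1 (norm_nonneg y)
    ((min_le_left _ _).trans (min_le_right _ _)) ?_ hy ?_ ?_ ?_
  · calc _ ≤ (k * a + k * C) * (k * c / 2 / (k * a + k * C)) := by
          gcongr; exact min_le_right _ _
      _ = _ := by field_simp
  · rw [mul_assoc]; gcongr; exact hcQ y
  · rw [abs_mul, abs_of_pos hk', mul_assoc]; gcongr; exact haT y
  · rw [abs_mul, abs_of_pos hk', mul_assoc]
    gcongr
    calc |D * e₁ - e₂| ≤ |D * e₁| + |e₂| := abs_sub _ _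
      _ = D * |e₁| + |e₂| := by rw [abs_mul, abs_of_pos (by linarith : (0 : ℝ) < D)]
      _ ≤ D * (C * (s * ‖y‖) ^ 4) + C * (s * ‖y‖) ^ 2 := by gcongr
      _ = C * (s ^ 2 * (‖y‖ ^ 4 + ‖y‖ ^ 2)) := by
        linear_combination (C * s ^ 2 * ‖y‖ ^ 4) * hDs

end RelativeWave

end HarmonicDPT

namespace HarmonicDPT

/-! ### Laplace's method for the normalization integral -/

section Laplace

open MeasureTheory

variable {N : ℕ} {l : ℝ}

/-- The relative probability density, extended by zero. -/
noncomputable def relDensity (l : ℝ) (D : ℕ) : Internal N → ℝ :=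
  (domain N).indicator fun q => relWave l D q ^ 2

lemma relDensity_nonneg (l : ℝ) (D : ℕ) (q : Internal N) : 0 ≤ relDensity l D q :=
  Set.indicator_nonneg (fun _ _ => sq_nonneg _) _

lemma integrable_relDensity (hN : 1 ≤ N) (hl : 0 < l) {D : ℕ} (hD : N < D) :
    Integrable (relDensity (N := N) l D) := by
  have hD' : (0 : ℝ) < D := by exact_mod_cast (Nat.zero_le N).trans_lt hD
  rw [relDensity, integrable_indicator_iff isOpen_domain.measurableSet]
  simp only [relWave, div_pow]
  exact (integrableOn_wave_sq hN hl hD hD').div_const _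

lemma integrable_comp_displacement {f : Internal N → ℝ} (hf : Integrable f) (x : Internal N)
    {s : ℝ} (hs : s ≠ 0) : Integrable fun y => f (x + s • y) :=
  (integrable_comp_smul_iff volume (fun y => f (x + y)) hs).2 (hf.comp_add_left x)

lemma integral_comp_displacement (f : Internal N → ℝ) (x : Internal N) (s : ℝ) :
    ∫ y, f (x + s • y) = |(s ^ Module.finrank ℝ (Internal N))⁻¹| * ∫ q, f q := by
  rw [Measure.integral_comp_smul volume (fun y => f (x + y)) s, integral_add_left_eq_self f x,
    smul_eq_mul]

/-- Away from the large-dimension structure, the density decreases exponentially with the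
dimension. -/
lemma exists_relDensity_le (hN : 1 ≤ N) (hl : 0 < l) {ρ : ℝ} (hρ : 0 < ρ) :
    ∃ η, 0 < η ∧ ∀ D : ℕ, N + 1 ≤ D → ∀ q : Internal N, ρ ≤ ‖q - center N l‖ →
      relDensity l D q ≤ Real.exp (-(2 * (D - (N + 1 : ℕ)) * η)) * relDensity l (N + 1) q := by
  -- The phase gap is spent on D - (N + 1) copies of `phase`. The remaining N + 1 copies and
  -- `weight` form the density in dimension N + 1, which is integrable and independent of D.
  obtain ⟨η, hη, hgap⟩ := exists_phase_gap (N := N) hN hl hρ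
  refine ⟨η, hη, fun D hD q hq => ?_⟩
  by_cases hdom : q ∈ domain N
  · have h := hgap q hdom hq
    have hD' : (0 : ℝ) ≤ D - (N + 1 : ℕ) := sub_nonneg.2 (by exact_mod_cast hD)
    simp only [relDensity, Set.indicator_of_mem hdom, relWave_eq hN hl _ hdom, ← Real.exp_nat_mul]
    rw [← Real.exp_add, Real.exp_le_exp]
    have := mul_le_mul_of_nonneg_left h hD'
    push_cast at this ⊢
    linarith
  · simp [relDensity, hdom]

/-- The Jacobian of the displacement coordinates is a power of √D, which the exponential decay
outweighs; two further powers of √D produce the factor 1 / D. -/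
lemma exists_sqrt_pow_mul_exp_le (n : ℕ) {η : ℝ} (hη : 0 < η) (x : ℝ) :
    ∃ C, 0 ≤ C ∧ ∀ D : ℕ, 1 ≤ D →
      |(√(1 / (D : ℝ)) ^ n)⁻¹| * Real.exp (-(2 * (D - x) * η)) ≤ C * (1 / D) := by
  obtain ⟨C, hC, h⟩ := exists_rpow_mul_exp_le (n + 2 : ℕ) (c := 2 * η) (by positivity)
  refine ⟨C * Real.exp (2 * x * η), by positivity, fun D hD => ?_⟩
  have hD' : (0 : ℝ) < D := by exact_mod_cast hD
  have h1 := h (√D) (Real.sqrt_nonneg _)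
  rw [Real.sq_sqrt hD'.le, Real.rpow_natCast] at h1
  have h2 : |(√(1 / (D : ℝ)) ^ n)⁻¹| = √D ^ n := by
    rw [abs_of_nonneg (by positivity), one_div, Real.sqrt_inv, inv_pow, inv_inv]
  have h3 : √(D : ℝ) ^ n * D ≤ (1 + √D) ^ (n + 2) := by
    calc √(D : ℝ) ^ n * D = √(D : ℝ) ^ (n + 2) := by rw [pow_add, Real.sq_sqrt hD'.le]
      _ ≤ _ := by gcongr; linarith
  rw [h2, show -(2 * (D - x) * η) = -(2 * η) * D + 2 * x * η by ring, Real.exp_add, mul_one_div,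
    le_div_iff₀ hD']
  calc _ = (√(D : ℝ) ^ n * D) * Real.exp (-(2 * η) * D) * Real.exp (2 * x * η) := by ring
    _ ≤ (1 + √D) ^ (n + 2) * Real.exp (-(2 * η) * D) * Real.exp (2 * x * η) := by gcongr
    _ ≤ _ := by gcongr

lemma integrable_pow_mul_exp_neg (k : ℕ) {c : ℝ} (hc : 0 < c) :
    Integrable fun y : Internal N => (1 + ‖y‖) ^ k * Real.exp (-c * ‖y‖ ^ 2) := by
  simpa only [Real.rpow_natCast] using integrable_rpow_mul_exp_neg (k : ℝ) hc

/-- The normalization integral of the wavefunction in the displacement coordinates. -/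
theorem exists_abs_integral_relDensity_sub_le (hN : 1 ≤ N) (hl : 0 < l) :
    ∃ C, 0 ≤ C ∧ ∀ D : ℕ, N + 1 ≤ D →
      |(∫ y : Internal N, relDensity l D (center N l + √(1 / (D : ℝ)) • y))
        - ∫ y : Internal N, Real.exp (-(2 * quadForm N l y))| ≤ C * (1 / D) := by
  obtain ⟨c, M, ρ, hc, hM, hρ, hcQ, hexp⟩ := exists_relWave_pow_expansion (N := N) hN hl two_pos
  obtain ⟨a, ha, haT⟩ := exists_abs_correction_le (N := N) l
  obtain ⟨η, hη, hfar⟩ := exists_relDensity_le (N := N) hN hl hρ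
  obtain ⟨C₁, hC₁, hC₁le⟩ := exists_sqrt_pow_mul_exp_le (Module.finrank ℝ (Internal N)) hη
    ((N + 1 : ℕ) : ℝ)
  simp only [Nat.cast_ofNat] at hcQ hexp
  set G : Internal N → ℝ := fun y => (1 + ‖y‖) ^ 8 * Real.exp (-(c / 2) * ‖y‖ ^ 2) with hG
  have hGint : Integrable G := integrable_pow_mul_exp_neg 8 (by positivity)
  have hG0 : ∀ y, 0 ≤ G y := fun y => by rw [hG]; positivity
  have hK0 : 0 ≤ ∫ q : Internal N, relDensity l (N + 1) q :=
    integral_nonneg fun q => relDensity_nonneg l _ q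
  -- bounds for the terms of the limiting density
  have hcorr : ∀ y, |correction N l y| ≤ 2 * a * (1 + ‖y‖) ^ 4 := fun y => by
    have hn := norm_nonneg y
    have : ‖y‖ ^ 3 + ‖y‖ ≤ 2 * (1 + ‖y‖) ^ 4 := by
      nlinarith [pow_nonneg hn 2, pow_nonneg hn 3, pow_nonneg hn 4]
    calc _ ≤ a * (‖y‖ ^ 3 + ‖y‖) := haT y
      _ ≤ a * (2 * (1 + ‖y‖) ^ 4) := by gcongr
      _ = _ := by ring
  have hexpQ : ∀ y, Real.exp (-(2 * quadForm N l y)) ≤ Real.exp (-(c / 2) * ‖y‖ ^ 2) := fun y => by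
    rw [Real.exp_le_exp]
    have := hcQ y
    have : 0 ≤ c / 2 * ‖y‖ ^ 2 := by positivity
    linarith
  have hcont : Continuous fun y : Internal N => Real.exp (-(2 * quadForm N l y)) :=
    Real.continuous_exp.comp (((continuous_quadForm l).const_mul 2).neg)
  have hI1 : Integrable fun y : Internal N => Real.exp (-(2 * quadForm N l y)) := by
    refine hGint.mono' hcont.aestronglyMeasurable (Filter.Eventually.of_forall fun y => ?_)
    rw [Real.norm_of_nonneg (Real.exp_pos _).le]
    refine (hexpQ y).trans (le_mul_of_one_le_left (Real.exp_pos _).le ?_)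
    exact one_le_pow₀ (by linarith [norm_nonneg y])
  have hI2 : Integrable fun y : Internal N =>
      Real.exp (-(2 * quadForm N l y)) * correction N l y := by
    refine (hGint.const_mul (2 * a)).mono'
      (hcont.mul (continuous_correction l)).aestronglyMeasurable
      (Filter.Eventually.of_forall fun y => ?_)
    rw [norm_mul, Real.norm_of_nonneg (Real.exp_pos _).le, Real.norm_eq_abs]
    calc _ ≤ Real.exp (-(c / 2) * ‖y‖ ^ 2) * (2 * a * (1 + ‖y‖) ^ 8) := by
          gcongr
          · exact Real.exp_le_exp.1 (hexpQ y)
          · refine (hcorr y).trans ?_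
            gcongr
            · linarith [norm_nonneg y]
            · norm_num
      _ = _ := by rw [hG]; ring
  -- The Gaussian is even and the correction is odd, so the substitution y ↦ -y shows that the
  -- integral is its own negative.
  have hodd : ∫ y : Internal N, Real.exp (-(2 * quadForm N l y)) * correction N l y = 0 := by
    have h := integral_comp_displacement
      (fun y : Internal N => Real.exp (-(2 * quadForm N l y)) * correction N l y) 0 (-1)
    rw [abs_inv, abs_pow, abs_neg, abs_one, one_pow, inv_one, one_mul] at h
    have hq : ∀ y, quadForm N l (-y) = quadForm N l y := fun y => by
      rw [← neg_one_smul ℝ y, quadForm_smul]; ring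
    simp only [zero_add, neg_one_smul, hq, correction_neg, mul_neg, integral_neg] at h
    linarith
  refine ⟨(M + (1 + 4 * a) / ρ ^ 2) * (∫ y, G y) + C₁ * ∫ q : Internal N, relDensity l (N + 1) q,
    add_nonneg (mul_nonneg (by positivity) (integral_nonneg hG0)) (by positivity), fun D hD => ?_⟩
  have hD1 : 1 ≤ D := (Nat.le_add_left 1 N).trans hD
  have hD0 : (0 : ℝ) < D := by exact_mod_cast hD1
  have hexp' := hexp D hD1
  set s := √(1 / (D : ℝ)) with hs
  have hs0 : 0 < s := Real.sqrt_pos.2 (by positivity)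
  have hs2 : s ^ 2 = 1 / D := Real.sq_sqrt (by positivity)
  have hs1 : s ≤ 1 := by
    rw [hs, Real.sqrt_le_one]
    exact (div_le_one hD0).2 (by exact_mod_cast hD1)
  -- The density to first order in s. By oddness its integral is exactly the Gaussian integral.
  set ψ : Internal N → ℝ := fun y =>
    Real.exp (-(2 * quadForm N l y)) * (1 + s * (2 * correction N l y)) with hψ
  have hψeq : ψ = fun y => Real.exp (-(2 * quadForm N l y))
      + 2 * s * (Real.exp (-(2 * quadForm N l y)) * correction N l y) := by
    funext y; rw [hψ]; ring
  have hψint : Integrable ψ := by rw [hψeq]; exact hI1.add (hI2.const_mul _)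
  have hψval : ∫ y, ψ y = ∫ y : Internal N, Real.exp (-(2 * quadForm N l y)) := by
    rw [hψeq, integral_add hI1 (hI2.const_mul _), integral_const_mul, hodd, mul_zero, add_zero]
  have hFint : Integrable fun y : Internal N => relDensity l D (center N l + s • y) :=
    integrable_comp_displacement (integrable_relDensity hN hl hD) _ hs0.ne'
  have hF0int : Integrable fun y : Internal N => relDensity l (N + 1) (center N l + s • y) :=
    integrable_comp_displacement (integrable_relDensity hN hl (Nat.lt_succ_self N)) _ hs0.ne'
  -- For s ‖y‖ ≤ ρ the local expansion applies. Beyond that, density and `ψ` are estimated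
  -- separately: the first is exponentially small in D, the second a Gaussian tail.
  have hpt : ∀ y : Internal N, ‖relDensity l D (center N l + s • y) - ψ y‖
      ≤ 1 / D * (M + (1 + 4 * a) / ρ ^ 2) * G y
        + Real.exp (-(2 * (D - (N + 1 : ℕ)) * η)) * relDensity l (N + 1) (center N l + s • y) := by
    intro y
    rw [Real.norm_eq_abs]
    have hr0 : 0 ≤ Real.exp (-(2 * (D - (N + 1 : ℕ)) * η))
        * relDensity l (N + 1) (center N l + s • y) :=
      mul_nonneg (Real.exp_pos _).le (relDensity_nonneg _ _ _)
    rcases le_total (s * ‖y‖) ρ with h | h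
    · obtain ⟨hmem, hle⟩ := hexp' y h
      have h1 : relDensity l D (center N l + s • y) = relWave l D (center N l + s • y) ^ 2 := by
        rw [relDensity, Set.indicator_of_mem hmem]
      rw [h1]
      refine hle.trans (le_add_of_le_of_nonneg ?_ hr0)
      have : 0 ≤ 1 / D * ((1 + 4 * a) / ρ ^ 2) * G y := mul_nonneg (by positivity) (hG0 y)
      have e : 1 / (D : ℝ) * (M * ((1 + ‖y‖) ^ 8 * Real.exp (-(c / 2) * ‖y‖ ^ 2)))
        = 1 / D * M * G y := by rw [hG]; ring
      rw [e]; linarith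
    · have h1 : ρ ≤ ‖center N l + s • y - center N l‖ := by
        rwa [add_sub_cancel_left, norm_smul, Real.norm_of_nonneg hs0.le]
      have h2 := hfar D hD _ h1
      have h3 : |ψ y| ≤ 1 / D * ((1 + 4 * a) / ρ ^ 2) * G y := by
        have hn := norm_nonneg y
        have hA : |1 + s * (2 * correction N l y)| ≤ (1 + 4 * a) * (1 + ‖y‖) ^ 4 := by
          calc _ ≤ |(1 : ℝ)| + |s * (2 * correction N l y)| := abs_add_le _ _
            _ = 1 + s * (2 * |correction N l y|) := by
              rw [abs_one, abs_mul, abs_mul, abs_of_pos hs0, abs_of_pos (two_pos (α := ℝ))]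
            _ ≤ (1 + ‖y‖) ^ 4 + 1 * (2 * (2 * a * (1 + ‖y‖) ^ 4)) := by
              gcongr
              · exact one_le_pow₀ (by linarith)
              · exact hcorr y
            _ = _ := by ring
        -- In the far region 1 ≤ s² ‖y‖² / ρ², and s² = 1 / D supplies the required factor at the
        -- price of a power of ‖y‖.
        have hB : 1 ≤ 1 / D * (1 / ρ ^ 2) * (1 + ‖y‖) ^ 4 := by
          have h4 : ρ ^ 2 ≤ s ^ 2 * ‖y‖ ^ 2 := by rw [← mul_pow]; gcongr
          have h5 : 1 ≤ 1 / D * (1 / ρ ^ 2) * ‖y‖ ^ 2 := by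
            rw [← hs2]
            calc (1 : ℝ) = (1 / ρ ^ 2) * ρ ^ 2 := by field_simp
              _ ≤ (1 / ρ ^ 2) * (s ^ 2 * ‖y‖ ^ 2) := by gcongr
              _ = _ := by ring
          refine h5.trans ?_
          gcongr
          nlinarith [pow_nonneg hn 2, pow_nonneg hn 3, pow_nonneg hn 4]
        calc |ψ y| = Real.exp (-(2 * quadForm N l y)) * |1 + s * (2 * correction N l y)| := by
              rw [hψ, abs_mul, abs_of_pos (Real.exp_pos _)]
          _ ≤ Real.exp (-(c / 2) * ‖y‖ ^ 2) * ((1 + 4 * a) * (1 + ‖y‖) ^ 4) := by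
              gcongr
              exact Real.exp_le_exp.1 (hexpQ y)
          _ ≤ Real.exp (-(c / 2) * ‖y‖ ^ 2) * ((1 + 4 * a) * (1 + ‖y‖) ^ 4)
              * (1 / D * (1 / ρ ^ 2) * (1 + ‖y‖) ^ 4) := le_mul_of_one_le_right (by positivity) hB
          _ = _ := by rw [hG]; ring
      have h4 : 0 ≤ 1 / D * M * G y := mul_nonneg (by positivity) (hG0 y)
      calc _ ≤ |relDensity l D (center N l + s • y)| + |ψ y| := abs_sub _ _
        _ ≤ _ := by
          rw [abs_of_nonneg (relDensity_nonneg _ _ _)]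
          linarith
  rw [← hψval, ← integral_sub hFint hψint]
  calc |∫ y, (relDensity l D (center N l + s • y) - ψ y)|
      ≤ ∫ y, (1 / D * (M + (1 + 4 * a) / ρ ^ 2) * G y + Real.exp (-(2 * (D - (N + 1 : ℕ)) * η))
          * relDensity l (N + 1) (center N l + s • y)) :=
        norm_integral_le_of_norm_le ((hGint.const_mul _).add (hF0int.const_mul _))
          (Filter.Eventually.of_forall hpt)
    _ = 1 / D * (M + (1 + 4 * a) / ρ ^ 2) * (∫ y, G y)
        + |(s ^ Module.finrank ℝ (Internal N))⁻¹| * Real.exp (-(2 * (D - (N + 1 : ℕ)) * η))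
          * ∫ q : Internal N, relDensity l (N + 1) q := by
        rw [integral_add (hGint.const_mul _) (hF0int.const_mul _), integral_const_mul,
          integral_const_mul, integral_comp_displacement]
        ring
    _ ≤ 1 / D * (M + (1 + 4 * a) / ρ ^ 2) * (∫ y, G y)
        + C₁ * (1 / D) * ∫ q : Internal N, relDensity l (N + 1) q := by
        exact add_le_add_right (mul_le_mul_of_nonneg_right (hC₁le D hD1) hK0) _
    _ = _ := by ring

end Laplace

end HarmonicDPT

namespace HarmonicDPT

/-! ### Gaussian integrals -/

section Gaussian

open MeasureTheory

/-- The Gaussian integral of a positive definite quadratic form. -/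
lemma integral_exp_neg_posDef {ι : Type*} [Fintype ι] [DecidableEq ι] {A : Matrix ι ι ℝ}
    (hA : A.PosDef) : ∫ v : ι → ℝ, Real.exp (-(v ⬝ᵥ A *ᵥ v))
      = √Real.pi ^ Fintype.card ι / √A.det := by
  obtain ⟨B, hBu, rfl⟩ := exists_eq_transpose_mul_self hA
  have hdet : B.det ≠ 0 := ((Matrix.isUnit_iff_isUnit_det B).1 hBu).ne_zero
  set f : (ι → ℝ) → ℝ := fun v => ∏ i, Real.exp (-1 * v i ^ 2) with hf
  have h1 : ∀ v : ι → ℝ, Real.exp (-(v ⬝ᵥ (Bᵀ * B) *ᵥ v)) = f (Matrix.toLin' B v) := by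
    intro v
    rw [hf, ← Matrix.mulVec_mulVec, Matrix.dotProduct_mulVec, Matrix.vecMul_transpose]
    simp only [Matrix.toLin'_apply, ← Real.exp_sum, dotProduct, neg_mul, one_mul,
      Finset.sum_neg_distrib, pow_two]
  have hfc : Continuous f := by
    rw [hf]
    fun_prop
  have h2 : ∫ v, f v = √Real.pi ^ Fintype.card ι := by
    rw [hf, integral_fintype_prod_volume_eq_prod (fun (_ : ι) (x : ℝ) => Real.exp (-1 * x ^ 2))]
    simp only [integral_gaussian, div_one, Finset.prod_const, Finset.card_univ]
  have h3 : Measurable (Matrix.toLin' B) :=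
    (LinearMap.continuous_of_finiteDimensional _).measurable
  simp only [h1]
  rw [← integral_map h3.aemeasurable hfc.aestronglyMeasurable,
    Real.map_matrix_volume_pi_eq_smul_volume_pi hdet, integral_smul_measure, h2,
    ENNReal.toReal_ofReal (abs_nonneg _), Matrix.det_mul, Matrix.det_transpose, ← pow_two,
    Real.sqrt_sq_eq_abs, smul_eq_mul, abs_inv, div_eq_inv_mul]

variable {N : ℕ} {l : ℝ}

lemma card_pair (N : ℕ) : (Fintype.card (Pair N) : ℝ) = N * (N - 1) / 2 := by
  have h := sum_sum_eq_diag_add_pair (N := N) (fun _ _ => (1 : ℝ))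
  simp only [Finset.sum_const, Finset.card_univ, Fintype.card_fin, nsmul_eq_mul, mul_one] at h
  linarith

lemma integral_exp_neg_quadForm (hN : 1 ≤ N) (hl : 0 < l) :
    ∫ y : Internal N, Real.exp (-(2 * quadForm N l y))
      = √Real.pi ^ ((N : ℝ) * (N + 1) / 2) / √((2 : ℝ) • omegaMatrix N l).det := by
  have hΩ : ((2 : ℝ) • omegaMatrix N l).PosDef := (omegaMatrix_posDef hN hl).smul two_pos
  have h := (volume_measurePreserving_sumPiEquivProdPi
    (fun _ : Fin N ⊕ Pair N => ℝ)).integral_comp'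
      (fun y : Internal N => Real.exp (-(2 * quadForm N l y)))
  rw [← h]
  have h1 : ∀ v : Fin N ⊕ Pair N → ℝ, v ⬝ᵥ ((2 : ℝ) • omegaMatrix N l) *ᵥ v
      = 2 * quadForm N l (ofSum v) := fun v => by
    rw [Matrix.smul_mulVec, dotProduct_smul, dotProduct_omegaMatrix hN hl, smul_eq_mul]
  have h2 := integral_exp_neg_posDef hΩ
  simp only [h1] at h2
  refine Eq.trans ?_ (h2.trans ?_)
  · rfl
  · rw [← Real.rpow_natCast]
    congr 2
    rw [Fintype.card_sum, Fintype.card_fin, Nat.cast_add, card_pair]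
    ring

end Gaussian

/-! ### Dimensional scaling and the normalization constant -/

section Scaling

open MeasureTheory

variable {N : ℕ} {l : ℝ}

lemma unscale_mem_domain {ω : ℝ} (hω : 0 < ω) {D : ℕ} (hD : 0 < D) (q : Internal N) :
    unscale ω D q ∈ domain N ↔ q ∈ domain N := by
  have ht : 0 < √((D : ℝ) / ω) := Real.sqrt_pos.2 (div_pos (by exact_mod_cast hD) hω)
  simp only [domain, unscale, Set.mem_ofPred_eq, mul_pos_iff_of_pos_left ht]

/-- Only the N radii are scaled, so the Jacobian is the N-th power of the scale factor. -/
lemma integral_comp_unscale {ω : ℝ} (hω : 0 < ω) {D : ℕ} (hD : 0 < D) (f : Internal N → ℝ) :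
    ∫ q, f q = √((D : ℝ) / ω) ^ N * ∫ q, f (unscale ω D q) := by
  have ht : 0 < √((D : ℝ) / ω) := Real.sqrt_pos.2 (div_pos (by exact_mod_cast hD) hω)
  set t := √((D : ℝ) / ω) with htdef
  have hemb : MeasurableEmbedding (unscale ω D : Internal N → Internal N) :=
    ((Homeomorph.smulOfNeZero t ht.ne').prodCongr
      (Homeomorph.refl (Pair N → ℝ))).measurableEmbedding
  have hmap : Measure.map (unscale ω D) (volume : Measure (Internal N))
      = ENNReal.ofReal |(t ^ N)⁻¹| • volume := by
    have h := Measure.map_prod_map (volume : Measure (Fin N → ℝ)) (volume : Measure (Pair N → ℝ))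
      (measurable_const_smul t) measurable_id
    rw [Measure.map_addHaar_smul _ ht.ne', Measure.map_id, Measure.prod_smul_left,
      Module.finrank_fintype_fun_eq_card, Fintype.card_fin] at h
    exact h.symm
  rw [← hemb.integral_map, hmap, integral_smul_measure, ENNReal.toReal_ofReal (abs_nonneg _),
    abs_of_pos (by positivity), smul_eq_mul, mul_inv_cancel_left₀ (by positivity)]

lemma internalForm_unscale (l : ℝ) {ω : ℝ} (hω : 0 < ω) (D : ℕ) (q : Internal N) :
    internalForm l (unscale ω D q) = D / ω * internalForm l q := by
  have ht : (D : ℝ) / ω = √((D : ℝ) / ω) ^ 2 := (Real.sq_sqrt (by positivity)).symm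
  simp only [internalForm, innerMatrix, unscale, Matrix.of_apply]
  generalize √((D : ℝ) / ω) = t at ht
  rw [ht]
  simp only [mul_pow, mul_add, Finset.mul_sum]
  congr 1
  · exact Finset.sum_congr rfl fun i _ => by ring
  · exact Finset.sum_congr rfl fun i _ => Finset.sum_congr rfl fun j _ => by ring

/-- The form is homogeneous of degree two in the radii, so scaling replaces the frequency ω by D;
the radial Jacobian only contributes a constant, which the normalization absorbs. -/
lemma exists_wave_unscale (l : ℝ) {ω : ℝ} (hω : 0 < ω) {D : ℕ} (hD : 0 < D) :
    ∃ κ, 0 < κ ∧ ∀ q ∈ domain N, wave l D ω (unscale ω D q) = κ * wave l D D q := by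
  have hD' : (0 : ℝ) < D := by exact_mod_cast hD
  have ht : 0 < √((D : ℝ) / ω) := Real.sqrt_pos.2 (by positivity)
  refine ⟨(√((D : ℝ) / ω) ^ (((D : ℝ) - 1) / 2)) ^ N, by positivity, fun q hq => ?_⟩
  rw [wave, wave, internalForm_unscale l hω]
  have h1 : sqrtJacobian N D (unscale ω D q)
      = (√((D : ℝ) / ω) ^ (((D : ℝ) - 1) / 2)) ^ N * sqrtJacobian N D q := by
    simp only [sqrtJacobian, unscale]
    rw [Finset.prod_congr rfl fun j _ => Real.mul_rpow ht.le (hq.1 j).le, Finset.prod_mul_distrib,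
      Finset.prod_const, Finset.card_univ, Fintype.card_fin]
    ring
  rw [h1, show -(ω / 2) * (D / ω * internalForm l q) = -(D / 2) * internalForm l q by field_simp]
  ring

/-- The normalization integral in the displacement coordinates. -/
noncomputable def partition (N : ℕ) (l : ℝ) (D : ℕ) : ℝ :=
  ∫ y : Internal N, relDensity l D (center N l + √(1 / (D : ℝ)) • y)

lemma integral_relDensity_eq {D : ℕ} (hD : 0 < D) :
    ∫ q : Internal N, relDensity l D q
      = √(1 / (D : ℝ)) ^ (N + Fintype.card (Pair N)) * partition N l D := by
  have hs : 0 < √(1 / (D : ℝ)) := Real.sqrt_pos.2 (by positivity)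
  have hrank : Module.finrank ℝ (Internal N) = N + Fintype.card (Pair N) := by
    rw [Module.finrank_prod, Module.finrank_fintype_fun_eq_card,
      Module.finrank_fintype_fun_eq_card, Fintype.card_fin]
  rw [partition, integral_comp_displacement, hrank, abs_of_pos (by positivity),
    mul_inv_cancel_left₀ (by positivity)]

/-- The normalized wavefunction in scaled coordinates. -/
lemma jacobianWeighted_unscale_eq (hN : 1 ≤ N) {μ ω : ℝ} (hμ : 0 < 1 + N * μ) (hω : 0 < ω) {D : ℕ}
    (hD : N < D) {Ψ : Config N D → ℝ} (hΨ : IsGroundState ω μ Ψ) {ΨJ : Internal N → ℝ}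
    (hJ : IsJacobianWeighted Ψ ΨJ) : 0 < partition N (lam N μ) D ∧ ∀ q ∈ domain N,
      ΨJ (unscale ω D q) = ω ^ ((N : ℝ) / 4) * (D : ℝ) ^ ((N : ℝ) * ((N : ℝ) - 1) / 8)
        * (√(partition N (lam N μ) D))⁻¹ * relWave (lam N μ) D q := by
  have hD0 : 0 < D := (Nat.zero_le N).trans_lt hD
  have hD' : (0 : ℝ) < D := by exact_mod_cast hD0
  obtain ⟨⟨c, hc, hcq⟩, hint⟩ := (isJacobianWeighted_iff hN hμ hω hD hΨ ΨJ).1 hJ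
  have hl := lam_pos hμ
  set l := lam N μ
  obtain ⟨κ, hκ, hκq⟩ := exists_wave_unscale (N := N) l hω hD0
  set b := c * κ * wave l D D (center N l) with hb
  have hw := wave_pos l D (D : ℝ) (center_mem_domain (N := N) hN hl)
  have hb0 : 0 < b := by positivity
  have hval : ∀ q ∈ domain N, ΨJ (unscale ω D q) = b * relWave l D q := by
    intro q hq
    rw [hcq _ ((unscale_mem_domain hω hD0 q).2 hq), hκq q hq, relWave, hb]
    field_simp
  have hind : ∀ q, (domain N).indicator (fun q => ΨJ q ^ 2) (unscale ω D q)
      = b ^ 2 * relDensity l D q := by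
    intro q
    by_cases hq : q ∈ domain N
    · rw [Set.indicator_of_mem ((unscale_mem_domain hω hD0 q).2 hq), relDensity,
        Set.indicator_of_mem hq, hval q hq, mul_pow]
    · rw [Set.indicator_of_notMem (fun h => hq ((unscale_mem_domain hω hD0 q).1 h)), relDensity,
        Set.indicator_of_notMem hq, mul_zero]
  rw [← integral_indicator isOpen_domain.measurableSet, integral_comp_unscale hω hD0] at hint
  simp only [hind] at hint
  rw [integral_const_mul, integral_relDensity_eq hD0] at hint
  set Z := partition N l D
  have hs : 0 < √(1 / (D : ℝ)) := Real.sqrt_pos.2 (by positivity)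
  have ht : 0 < √((D : ℝ) / ω) := Real.sqrt_pos.2 (by positivity)
  -- Read off from the normalization: for Z ≤ 0 the integral could not be 1.
  have hZ : 0 < Z := by
    by_contra h
    have : √((D : ℝ) / ω) ^ N * (b ^ 2 * (√(1 / (D : ℝ)) ^ (N + Fintype.card (Pair N)) * Z)) ≤ 0 :=
      mul_nonpos_of_nonneg_of_nonpos (by positivity) (mul_nonpos_of_nonneg_of_nonpos (by positivity)
        (mul_nonpos_of_nonneg_of_nonpos (by positivity) (not_lt.1 h)))
    linarith
  refine ⟨hZ, fun q hq => ?_⟩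
  rw [hval q hq]
  congr 1
  clear_value b
  have hcard : (Fintype.card (Pair N) : ℝ) = N * (N - 1) / 2 := card_pair N
  -- The radii contribute (D/ω)^(N/2), and the displacement coordinates, N radii and N(N - 1)/2
  -- cosines, contribute D^(-N/2 - N(N - 1)/4). What remains is b² = ω^(N/2) D^(N(N - 1)/4) / Z.
  have hsq : b ^ 2
      = (ω ^ ((N : ℝ) / 4) * (D : ℝ) ^ ((N : ℝ) * ((N : ℝ) - 1) / 8) * (√Z)⁻¹) ^ 2 := by
    rw [mul_pow (_ * _), mul_pow (_ ^ _), inv_pow, Real.sq_sqrt hZ.le, 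
      ← Real.rpow_mul_natCast hω.le, ← Real.rpow_mul_natCast hD'.le, eq_mul_inv_iff_mul_eq₀ hZ.ne']
    have h1 : √((D : ℝ) / ω) ^ N = (D : ℝ) ^ ((N : ℝ) / 2) * (ω ^ ((N : ℝ) / 2))⁻¹ := by
      rw [Real.sqrt_eq_rpow, ← Real.rpow_natCast, ← Real.rpow_mul (by positivity),
        Real.div_rpow hD'.le hω.le, div_eq_mul_inv]
      ring_nf
    have h2 : √(1 / (D : ℝ)) ^ (N + Fintype.card (Pair N))
        = ((D : ℝ) ^ ((N : ℝ) / 2 + N * (N - 1) / 4))⁻¹ := by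
      rw [Real.sqrt_eq_rpow, ← Real.rpow_natCast, ← Real.rpow_mul (by positivity), Nat.cast_add,
        hcard, one_div, Real.inv_rpow hD'.le]
      ring_nf
    rw [h1, h2, Real.rpow_add hD'] at hint
    have e1 : (N : ℝ) / 4 * (2 : ℕ) = N / 2 := by push_cast; ring
    have e2 : (N : ℝ) * (N - 1) / 8 * (2 : ℕ) = N * (N - 1) / 4 := by push_cast; ring
    rw [e1, e2]
    have p1 : 0 < (D : ℝ) ^ ((N : ℝ) / 2) := by positivity
    have p2 : 0 < ω ^ ((N : ℝ) / 2) := by positivity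
    have p3 : 0 < (D : ℝ) ^ ((N : ℝ) * (N - 1) / 4) := by positivity
    field_simp at hint ⊢
    linarith
  exact (pow_left_inj₀ hb0.le (by positivity) two_ne_zero).1 hsq

end Scaling

end HarmonicDPT

namespace HarmonicDPT

/-! ### The limit of large dimension -/

section LargeDimension

variable {N : ℕ}

/-- The hypotheses keep w ≥ z / 2, so the denominator in √z - √w = (z - w) / (√z + √w) stays away
from zero. -/
lemma abs_sqrt_div_sqrt_sub_one_le {z w e : ℝ} (hz : 0 < z) (h : |w - z| ≤ e) (he : e ≤ z / 2) :
    |√z / √w - 1| ≤ 2 * e / z := by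
  have hw : z / 2 ≤ w := by linarith [(abs_le.1 h).1]
  have hw0 : 0 < w := by linarith
  have hsz := Real.sqrt_pos.2 hz
  have hsw := Real.sqrt_pos.2 hw0
  have h2 : √z / 2 ≤ √w := by
    refine Real.le_sqrt_of_sq_le ?_
    rw [div_pow, Real.sq_sqrt hz.le]
    linarith
  have h3 : √z / √w - 1 = (z - w) / (√w * (√z + √w)) := by
    rw [div_sub_one hsw.ne', div_eq_div_iff hsw.ne' (by positivity)]
    linear_combination √w * (Real.sq_sqrt hz.le) - √w * (Real.sq_sqrt hw0.le)
  have h4 : z / 2 ≤ √w * (√z + √w) := by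
    nlinarith [Real.sq_sqrt hz.le]
  rw [h3, abs_div, abs_of_pos (by positivity : 0 < √w * (√z + √w)), abs_sub_comm,
    div_le_div_iff₀ (by positivity) hz]
  calc |w - z| * z ≤ e * z := by gcongr
    _ = 2 * e * (z / 2) := by ring
    _ ≤ _ := by gcongr; linarith [(abs_nonneg _).trans h]

lemma inv_sqrt_gaussian {d p : ℝ} (hd : 0 < d) :
    (√(√Real.pi ^ p / √d))⁻¹ = d ^ ((1 : ℝ) / 4) * (1 / Real.pi ^ ((1 : ℝ) / 4)) ^ p := by
  have hπ := Real.pi_pos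
  rw [Real.sqrt_eq_rpow, Real.sqrt_eq_rpow, Real.sqrt_eq_rpow,
    Real.div_rpow (by positivity) (by positivity), ← Real.rpow_mul hπ.le, ← Real.rpow_mul hπ.le,
    ← Real.rpow_mul hd.le, one_div (Real.pi ^ _), Real.inv_rpow (by positivity),
    ← Real.rpow_mul hπ.le, inv_div, div_eq_mul_inv]
  ring_nf

lemma displaced_eq (l : ℝ) (D : ℕ) (y : Internal N) :
    displaced N l D y = center N l + √(1 / (D : ℝ)) • y := rfl

/-- The large-dimension structures are the critical points of the phase. -/
lemma isLargeDStructure_iff (hN : 1 ≤ N) {l : ℝ} (hl : 0 < l) {ω : ℕ → ℝ}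
    {ΨJ : ℕ → Internal N → ℝ} {b : ℕ → ℝ} (hb : ∀ D, N < D → 0 < b D)
    (hΨ : ∀ D, N < D → ∀ q ∈ domain N, ΨJ D (unscale (ω D) D q) = b D * relWave l D q)
    (q : Internal N) : IsLargeDStructure ω ΨJ q ↔ q = center N l := by
  -- Near q the logarithm is a constant plus D · `phase` - `weight`. Divided by D, its derivative
  -- therefore tends to that of `phase`.
  have key : ∀ q ∈ domain N, ∀ D, N < D →
      HasFDerivAt (fun q' => Real.log (ΨJ D (unscale (ω D) D q')))
        ((D : ℝ) • fderiv ℝ (phase l) q - fderiv ℝ weight q) q := by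
    intro q hq D hD
    have h1 : HasFDerivAt (fun q' => Real.log (b D) + (D * (phase l q' - phase l (center N l))
        - (weight q' - weight (center N l))))
        ((D : ℝ) • fderiv ℝ (phase l) q - fderiv ℝ weight q) q :=
      ((((differentiableAt_phase l hq).hasFDerivAt.sub_const _).const_mul (D : ℝ)).sub
        ((differentiableAt_weight hq).hasFDerivAt.sub_const _)).const_add _
    refine h1.congr_of_eventuallyEq ?_
    filter_upwards [isOpen_domain.mem_nhds hq] with q' hq'
    rw [hΨ D hD q' hq', relWave_eq hN hl D hq', Real.log_mul (hb D hD).ne' (Real.exp_pos _).ne',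
      Real.log_exp]
  have hlim : ∀ q ∈ domain N, Filter.Tendsto (fun D : ℕ => (D : ℝ)⁻¹ •
      fderiv ℝ (fun q' => Real.log (ΨJ D (unscale (ω D) D q'))) q) Filter.atTop
      (𝓝 (fderiv ℝ (phase l) q)) := by
    intro q hq
    have h1 : Filter.Tendsto (fun D : ℕ => fderiv ℝ (phase l) q - (D : ℝ)⁻¹ • fderiv ℝ weight q)
        Filter.atTop (𝓝 (fderiv ℝ (phase l) q - (0 : ℝ) • fderiv ℝ weight q)) :=
      tendsto_const_nhds.sub (tendsto_inv_atTop_nhds_zero_nat.smul_const _)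
    rw [zero_smul, sub_zero] at h1
    refine h1.congr' ?_
    filter_upwards [Filter.eventually_gt_atTop N] with D hD
    have hD' : (D : ℝ) ≠ 0 := by exact_mod_cast ((Nat.zero_le N).trans_lt hD).ne'
    rw [(key q hq D hD).fderiv, smul_sub, inv_smul_smul₀ hD']
  constructor
  · rintro ⟨hq, -, ht⟩
    exact eq_center_of_fderiv_phase_eq_zero hN hl hq (tendsto_nhds_unique (hlim q hq) ht)
  · rintro rfl
    have hq := center_mem_domain (N := N) hN hl
    refine ⟨hq, ?_, ?_⟩
    · filter_upwards [Filter.eventually_gt_atTop N] with D hD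
      exact (key _ hq D hD).differentiableAt
    · have := hlim _ hq
      rwa [fderiv_phase_center hN hl] at this

/-- The expansion of the normalized wavefunction about the large-dimension structure. -/
lemma exists_expansion_normalized (hN : 1 ≤ N) {l : ℝ} (hl : 0 < l) (R : ℝ) :
    ∃ (C : ℝ) (D₀ : ℕ), N < D₀ ∧ ∀ D : ℕ, D₀ ≤ D → ∀ y : Internal N, ‖y‖ ≤ R →
      displaced N l D y ∈ domain N ∧ ∃ ε : ℝ, |ε| ≤ C * (1 / (D : ℝ)) ∧
        (√(partition N l D))⁻¹ * relWave l D (displaced N l D y)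
          = (((2 : ℝ) • omegaMatrix N l).det ^ ((1 : ℝ) / 4)
              * (1 / Real.pi ^ ((1 : ℝ) / 4)) ^ ((N : ℝ) * ((N : ℝ) + 1) / 2))
            * (1 + √(1 / (D : ℝ)) * correction N l y + ε) * Real.exp (-quadForm N l y) := by
  obtain ⟨C₁, hC₁, hZ⟩ := exists_abs_integral_relDensity_sub_le (N := N) hN hl
  obtain ⟨c, M, ρ, hc, hM, hρ, -, hexp⟩ := exists_relWave_pow_expansion (N := N) hN hl one_pos
  obtain ⟨a, ha, haT⟩ := exists_abs_correction_le (N := N) l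
  obtain ⟨K, hK, hKQ⟩ := exists_abs_le_of_homogeneous (continuous_quadForm (N := N) l) two_ne_zero
    (quadForm_smul l)
  have hdet : 0 < ((2 : ℝ) • omegaMatrix N l).det :=
    ((omegaMatrix_posDef hN hl).smul two_pos).det_pos
  rw [integral_exp_neg_quadForm hN hl] at hZ
  set z := √Real.pi ^ ((N : ℝ) * (N + 1) / 2) / √((2 : ℝ) • omegaMatrix N l).det with hz
  have hz0 : 0 < z := by have := Real.pi_pos; positivity
  clear_value z
  -- The first ceiling ensures s ‖y‖ ≤ ρ for ‖y‖ ≤ R, the second C₁ / D ≤ z / 2, as needed to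
  -- compare the square roots of the normalization integrals.
  refine ⟨2 * C₁ / z * (1 + a * (R ^ 3 + R))
      + (1 + 2 * C₁ / z) * (M * (1 + R) ^ 8 * Real.exp (K * R ^ 2)),
    N + 1 + ⌈R ^ 2 / ρ ^ 2⌉₊ + ⌈2 * C₁ / z⌉₊, by omega, fun D hD y hy => ?_⟩
  have hR : 0 ≤ R := (norm_nonneg y).trans hy
  have hDN : N + 1 ≤ D := by omega
  have hD1 : (1 : ℝ) ≤ D := by exact_mod_cast (Nat.le_add_left 1 N).trans hDN
  have hD0 : (0 : ℝ) < D := by linarith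
  have hDR : R ^ 2 / ρ ^ 2 ≤ D := (Nat.le_ceil _).trans (by exact_mod_cast (by omega))
  have hDC : 2 * C₁ / z ≤ D := (Nat.le_ceil _).trans (by exact_mod_cast (by omega))
  have hexp' := hexp D ((Nat.le_add_left 1 N).trans hDN) y
  set s := √(1 / (D : ℝ)) with hs
  have hs0 : 0 ≤ s := Real.sqrt_nonneg _
  have hs2 : s ^ 2 = 1 / D := Real.sq_sqrt (by positivity)
  have hs1 : s ≤ 1 := by
    rw [hs, Real.sqrt_le_one]
    exact (div_le_one hD0).2 hD1
  have hsy : s * ‖y‖ ≤ ρ := by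
    refine le_of_sq_le_sq ?_ hρ.le
    rw [div_le_iff₀ (by positivity)] at hDR
    calc (s * ‖y‖) ^ 2 = 1 / D * ‖y‖ ^ 2 := by rw [mul_pow, hs2]
      _ ≤ 1 / D * R ^ 2 := by gcongr
      _ ≤ 1 / D * (D * ρ ^ 2) := by gcongr
      _ = ρ ^ 2 := by field_simp
  obtain ⟨hmem, hle⟩ := hexp' hsy
  rw [← displaced_eq] at hmem hle
  simp only [Nat.cast_one, one_mul, pow_one] at hle
  refine ⟨hmem, ?_⟩
  set e := relWave l D (displaced N l D y)
    - Real.exp (-quadForm N l y) * (1 + s * correction N l y) with he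
  set u := √z / √(partition N l D) with hu
  have hu1 : |u - 1| ≤ 2 * C₁ / z * (1 / D) := by
    refine (abs_sqrt_div_sqrt_sub_one_le hz0 (hZ D hDN) ?_).trans (le_of_eq (by ring))
    rw [div_le_iff₀ hz0] at hDC
    rw [mul_one_div, div_le_iff₀ hD0]
    linarith
  clear_value e u s
  have hexpQ : Real.exp (quadForm N l y) ≤ Real.exp (K * R ^ 2) := by
    rw [Real.exp_le_exp]
    calc _ ≤ _ := le_abs_self _
      _ ≤ K * ‖y‖ ^ 2 := hKQ y
      _ ≤ _ := by gcongr
  have heb : |e| ≤ 1 / D * (M * (1 + R) ^ 8) := by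
    refine hle.trans ?_
    have : Real.exp (-(c / 2) * ‖y‖ ^ 2) ≤ 1 := Real.exp_le_one_iff.2 (by
      have : 0 ≤ c / 2 * ‖y‖ ^ 2 := by positivity
      linarith)
    calc _ ≤ 1 / (D : ℝ) * (M * ((1 + R) ^ 8 * 1)) := by gcongr
      _ = _ := by ring
  have hT : |1 + s * correction N l y| ≤ 1 + a * (R ^ 3 + R) := by
    calc _ ≤ |(1 : ℝ)| + |s * correction N l y| := abs_add_le _ _
      _ = 1 + s * |correction N l y| := by rw [abs_one, abs_mul, abs_of_nonneg hs0]
      _ ≤ 1 + 1 * (a * (‖y‖ ^ 3 + ‖y‖)) := by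
        gcongr
        exact haT y
      _ ≤ _ := by rw [one_mul]; gcongr
  have hu2 : |u| ≤ 1 + 2 * C₁ / z := by
    have h1 : |u| ≤ |u - 1| + |(1 : ℝ)| := by simpa using abs_add_le (u - 1) 1
    have h2 : 2 * C₁ / z * (1 / D) ≤ 2 * C₁ / z :=
      mul_le_of_le_one_right (by positivity) ((div_le_one hD0).2 hD1)
    rw [abs_one] at h1
    linarith
  -- The relative error has two sources: u - 1 from the normalization, and the pointwise error e.
  -- The Gaussian is factored out, so e is multiplied by exp(`quadForm`), which is bounded for ‖y‖ ≤
  -- R.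
  refine ⟨(u - 1) * (1 + s * correction N l y) + u * (e * Real.exp (quadForm N l y)), ?_, ?_⟩
  · calc _ ≤ |(u - 1) * (1 + s * correction N l y)| + |u * (e * Real.exp (quadForm N l y))| :=
          abs_add_le _ _
      _ = |u - 1| * |1 + s * correction N l y| + |u| * (|e| * Real.exp (quadForm N l y)) := by
          rw [abs_mul, abs_mul, abs_mul, abs_of_pos (Real.exp_pos _)]
      _ ≤ 2 * C₁ / z * (1 / D) * (1 + a * (R ^ 3 + R))
          + (1 + 2 * C₁ / z) * (1 / D * (M * (1 + R) ^ 8) * Real.exp (K * R ^ 2)) := by gcongr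
      _ = _ := by ring
  · rw [← inv_sqrt_gaussian hdet, ← hz]
    have hrel : relWave l D (displaced N l D y)
        = e + Real.exp (-quadForm N l y) * (1 + s * correction N l y) := by rw [he]; ring
    have hinv : (√(partition N l D))⁻¹ = (√z)⁻¹ * u := by
      rw [hu, div_eq_mul_inv, inv_mul_cancel_left₀ (Real.sqrt_pos.2 hz0).ne']
    have hQ : Real.exp (quadForm N l y) * Real.exp (-quadForm N l y) = 1 := by
      rw [← Real.exp_add, add_neg_cancel, Real.exp_zero]
    rw [hrel, hinv]
    linear_combination (-((√z)⁻¹ * u * e)) * hQ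

end LargeDimension

end HarmonicDPT


/-! ### Assembly of the theorem -/

theorem mainTheorem2 (N : ℕ) (hN : 1 ≤ N) (μ : ℝ) (hμ : 0 < 1 + N * μ)
    (ω : ℕ → ℝ) (hω : ∀ D, 0 < ω D) :
    (∀ D : ℕ, N < D →
      ∃! Ψ : HarmonicDPT.Config N D → ℝ, HarmonicDPT.IsGroundState (ω D) μ Ψ) ∧
    (∀ D : ℕ, N < D →
      ∀ Ψ : HarmonicDPT.Config N D → ℝ, HarmonicDPT.IsGroundState (ω D) μ Ψ →
        ∃ ΨJ : HarmonicDPT.Internal N → ℝ, HarmonicDPT.IsJacobianWeighted Ψ ΨJ) ∧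
    ∀ (Ψ : (D : ℕ) → HarmonicDPT.Config N D → ℝ) (ΨJ : ℕ → HarmonicDPT.Internal N → ℝ),
      (∀ D : ℕ, N < D → HarmonicDPT.IsGroundState (ω D) μ (Ψ D) ∧
        HarmonicDPT.IsJacobianWeighted (Ψ D) (ΨJ D)) →
      (∀ q : HarmonicDPT.Internal N, HarmonicDPT.IsLargeDStructure ω ΨJ q ↔
        q = (fun _ => HarmonicDPT.rInf N (HarmonicDPT.lam N μ),
             fun _ => HarmonicDPT.gammaInf N (HarmonicDPT.lam N μ))) ∧
      ∃ Ω : Matrix (Fin N ⊕ HarmonicDPT.Pair N) (Fin N ⊕ HarmonicDPT.Pair N) ℝ,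
        Ω.PosDef ∧
        (∀ y : HarmonicDPT.Internal N,
          Sum.elim y.1 y.2 ⬝ᵥ Ω *ᵥ Sum.elim y.1 y.2 =
            ∑ G : HarmonicDPT.Graph with G.rank = 2,
              HarmonicDPT.coeff N (HarmonicDPT.lam N μ) G * G.contract y) ∧
        ∀ R : ℝ, ∃ (C : ℝ) (D₀ : ℕ), ∀ D : ℕ, D₀ ≤ D → ∀ y : HarmonicDPT.Internal N, ‖y‖ ≤ R →
          HarmonicDPT.displaced N (HarmonicDPT.lam N μ) D y ∈ HarmonicDPT.domain N ∧
          ∃ ε : ℝ, |ε| ≤ C * (1 / (D : ℝ)) ∧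
            ΨJ D (HarmonicDPT.unscale (ω D) D
                (HarmonicDPT.displaced N (HarmonicDPT.lam N μ) D y)) =
              (ω D) ^ ((N : ℝ) / 4) * (D : ℝ) ^ ((N : ℝ) * ((N : ℝ) - 1) / 8)
                * ((2 : ℝ) • Ω).det ^ ((1 : ℝ) / 4)
                * (1 / Real.pi ^ ((1 : ℝ) / 4)) ^ ((N : ℝ) * ((N : ℝ) + 1) / 2)
                * (1 + 1 / 2 * √(1 / (D : ℝ)) *
                    (∑ G : HarmonicDPT.Graph with G.rank = 1 ∨ G.rank = 3,
                      HarmonicDPT.coeff N (HarmonicDPT.lam N μ) G * G.contract y) + ε)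
                * Real.exp (-(Sum.elim y.1 y.2 ⬝ᵥ Ω *ᵥ Sum.elim y.1 y.2)) := by
  have hl := HarmonicDPT.lam_pos hμ
  refine ⟨fun D _ => ?_, fun D hD Ψ hΨ => HarmonicDPT.exists_isJacobianWeighted hN hμ (hω D) hD hΨ,
    fun Ψ ΨJ h => ?_⟩
  · simp only [HarmonicDPT.isGroundState_iff hN hμ (hω D)]
    exact existsUnique_eq
  · have hΨJ := fun D (hD : N < D) =>
      HarmonicDPT.jacobianWeighted_unscale_eq hN hμ (hω D) hD (h D hD).1 (h D hD).2
    have hΩ : ∀ y : HarmonicDPT.Internal N, Sum.elim y.1 y.2 ⬝ᵥ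
        HarmonicDPT.omegaMatrix N (HarmonicDPT.lam N μ) *ᵥ Sum.elim y.1 y.2
        = HarmonicDPT.quadForm N (HarmonicDPT.lam N μ) y := fun y => by
      rw [HarmonicDPT.dotProduct_omegaMatrix hN hl, HarmonicDPT.ofSum_elim]
    refine ⟨HarmonicDPT.isLargeDStructure_iff hN hl (fun D hD => ?_) fun D hD => (hΨJ D hD).2,
      HarmonicDPT.omegaMatrix N (HarmonicDPT.lam N μ), HarmonicDPT.omegaMatrix_posDef hN hl,
      fun y => ?_, fun R => ?_⟩
    · have hD' : (0 : ℝ) < D := by exact_mod_cast (Nat.zero_le N).trans_lt hD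
      have := hω D
      have := Real.sqrt_pos.2 (hΨJ D hD).1
      positivity
    · rw [hΩ, HarmonicDPT.sum_coeff_mul_contract_rank_two hN hl]
    · obtain ⟨C, D₀, hD₀, hC⟩ := HarmonicDPT.exists_expansion_normalized (N := N) hN hl R
      refine ⟨C, D₀, fun D hD y hy => ?_⟩
      obtain ⟨hmem, ε, hε, heq⟩ := hC D hD y hy
      refine ⟨hmem, ε, hε, ?_⟩
      rw [(hΨJ D (hD₀.trans_le hD)).2 _ hmem, mul_assoc, heq, hΩ,
        HarmonicDPT.sum_coeff_mul_contract_rank_one_three hN hl, HarmonicDPT.correction]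
      ring
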